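/- A latent MDP (LMDP) $\theta$ with $L$ instances, finite state space $\mathcal S$ ($|\mathcal S|=S$), finite action space $\mathcal A$ ($|\mathcal A|=A$) and horizon $H$ consists of a mixing distribution $\rho\in\Delta([L])$, initial distributions $\nu_m\in\Delta(\mathcal S)$ and transition kernels $\mathbb T_m:\mathcal S\times\mathcal A\to\Delta(\mathcal S)$, $m\in[L]$. In each episode a latent index $m^\star\sim\rho$ is drawn and not shown to the agent, then $s_1\sim\nu_{m^\star}$ and $s_{h+1}\sim\mathbb T_{m^\star}(\cdot|s_h,a_h)$, where the actions $a_h$ are drawn by a (history-dependent, randomized) policy; $\mathbb P_\theta^\pi$ is the law of the trajectory $\tau=(s_1,a_1,\dots,s_H,a_H)$ under $\pi$. Rewards $R_h:\mathcal S\times\mathcal A\to[0,1]$ are known, with $\sum_{h=1}^H\sup_{s,a}R_h(s,a)\le 1$, and $V_\theta(\pi)=\mathbb E_\theta^\pi[\sum_h R_h(s_h,a_h)]$. A mixture of policies is executed by drawing one of them before the episode. $\theta$ is $\delta$-strongly separated if $D_{\rm TV}(\mathbb T_m(\cdot|s,a),\mathbb T_l(\cdot|s,a))\ge\delta$ for all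 $s,a$ and all $m\ne l$ with $\rho(m),\rho(l)>0$, where $D_{\rm TV}(p,q)=\frac12\|p-q\|_1$. Let $\Theta$ be the class of all $\delta$-strongly separated LMDPs with given $\mathcal S,\mathcal A,L,H$. For $1\le W\le H$ let $m_\theta(s_1,a_1,\dots,s_W)$ be a maximizer over $m$ with $\rho(m)>0$ of $\log\rho(m)+\log\nu_m(s_1)+\sum_{h<W}\log\mathbb T_m(s_{h+1}|s_h,a_h)$, and let $e_{\theta,W}(\pi)$ be the probability under $\theta,\pi$ that $m_\theta(s_1,a_1,\dots,s_W)\ne m^\star$. For policies $\pi,\pi'$ let $\pi\circ_h\pi'$ execute $\pi$ for the first $h-1$ steps (no step if $h\le 1$) and then start $\pi'$ afresh, discarding the history. Given a policy $\pi_{\rm exp}$, let $\varphi_h(\pi)=\pi\circ_h{\rm Unif}(\mathcal A)\circ_{h+1}\pi_{\rm exp}$ (so $\varphi_0(\pi)=\pi_{\rm exp}$) and let $\mathrm{expl}(\pi)$ be the mixture $\frac12(\pi\circ_W\pi_{\rm exp})+\frac1{2H}\sum_{h=0}^{H-1}\varphi_h(\pi)$. The algorithm OMLE with parameters $\pi_{\rm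 exp}$, $\beta>0$, $\varepsilon_s\in(0,1]$, $1\le W\le H$, $K\geq 1$ starts with $\Theta^1=\Theta$ and empty data $\mathcal D$. In each round $k=1,\dots,K$ it picks $(\theta^k,\pi^k)$ maximizing $V_\theta(\pi)$ over all $\theta\in\Theta^k$ and all policies $\pi$ with $e_{\theta,W}(\pi)\le\varepsilon_s$ (ties are broken by any rule that depends only on the data); executes $\mathrm{expl}(\pi^k)$ for one episode in the unknown LMDP; adds the executed policy and the observed trajectory to $\mathcal D$; and sets $$\Theta^{k+1}=\Big\{\hat\theta\in\Theta:\ \sum_{(\pi,\tau)\in\mathcal D}\log\mathbb P_{\hat\theta}^{\pi}(\tau)\ \ge\ \max_{\theta\in\Theta}\sum_{(\pi,\tau)\in\mathcal D}\log\mathbb P_{\theta}^{\pi}(\tau)-\beta\Big\}.$$ It outputs the uniform mixture $\hat\pi$ of $\pi^1,\dots,\pi^K$. **Corollary 4.3.** There are absolute constants $C,C_1>0$ and $c\in\mathbb N$ such that the following holds for all nonempty finite $\mathcal S,\mathcal A$, all $L\ge 1$, $H$, and all $\delta,\varepsilon\in(0,1]$, $p\in(0,1)$ with $$H\ \ge\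 \frac{10\log\big(LS\varepsilon^{-1}\delta^{-1}\big)+C}{\delta^2}.$$ There are parameters $K,W,\beta,\varepsilon_s$ as above with $$K\ \le\ C_1\,\frac{L^2S^4A^2H^4}{\varepsilon^2}\,\log^{c}\!\Big(\frac{C_1LSAH}{\varepsilon p}\Big)$$ such that for every policy $\pi_{\rm exp}$ and all rewards $R$ as above, OMLE can be run (the maximizers exist in all $K$ rounds, whatever is observed), and, however ties are broken and for every true model $\theta^\star\in\Theta$, with probability at least $1-p$ over its $K$ episodes OMLE outputs an $\varepsilon$-optimal $\hat\pi$, i.e. $\sup_\pi V_{\theta^\star}(\pi)-V_{\theta^\star}(\hat\pi)\le\varepsilon$. -/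

import Mathlib

noncomputable section

namespace LatentMDP

/-- An element of `Δ(X)`: a probability distribution on a finite type `X`. -/
abbrev Dist (X : Type*) [Fintype X] : Type _ := stdSimplex ℝ X

/-- Total variation distance `(1/2) ∑ₓ |p x - q x|`. -/
def tvDist {X : Type*} [Fintype X] (p q : Dist X) : ℝ := (1 / 2) * ∑ x, |p x - q x|

/-- The logarithm of a nonnegative real, with `log 0 = -∞`. -/
def elog (x : ℝ) : EReal := ENNReal.log (ENNReal.ofReal x)

/-- The dynamics of a latent MDP with `L` instances, state space `S` and action space `A`. -/
structure LMDP (L : ℕ) (S A : Type*) [Fintype S] where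
  /-- the mixing distribution `ρ` -/
  mix : Dist (Fin L)
  /-- the initial state distributions `ν_m` -/
  init : Fin L → Dist S
  /-- the transition kernels `T_m(· | s, a)` -/
  trans : Fin L → S → A → Dist S

/-- A trajectory `(s_1, a_1, …, s_H, a_H)`; steps are numbered from `0` to `H - 1`. -/
abbrev Traj (H : ℕ) (S A : Type*) : Type _ := Fin H → S × A

/-- A history-dependent randomized policy: at each step it maps the past state-action pairs and the
current state to a distribution over actions. -/
abbrev Policy (H : ℕ) (S A : Type*) [Fintype A] : Type _ :=
  (h : Fin H) → (Fin h → S × A) → S → Dist A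

/-- A finite mixture `∑ᵢ wᵢ πᵢ` of policies, as a formal linear combination: one draws `πᵢ` with
probability `wᵢ` before the episode and then executes it. -/
abbrev MixedPolicy (H : ℕ) (S A : Type*) [Fintype A] : Type _ := Policy H S A →₀ ℝ

section Model

variable {L H : ℕ} {S A : Type*} [Fintype S]

/-- The support of the mixing distribution. -/
def LMDP.supp (θ : LMDP L S A) : Set (Fin L) := {m | 0 < θ.mix m}

/-- `δ`-strong separation. -/
def LMDP.StronglySeparated (θ : LMDP L S A) (δ : ℝ) : Prop :=
  ∀ m ∈ θ.supp, ∀ l ∈ θ.supp, m ≠ l → ∀ s a, δ ≤ tvDist (θ.trans m s a) (θ.trans l s a)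

/-- The class of all `δ`-strongly separated LMDPs. -/
def separatedClass (L : ℕ) (S A : Type*) [Fintype S] (δ : ℝ) : Set (LMDP L S A) :=
  {θ | θ.StronglySeparated δ}

/-- The probability, in the instance `m`, of the state that `τ` shows at step `h`, given the
previous state and action (for `h = 0`: of the initial state). -/
def LMDP.stepProb (θ : LMDP L S A) (m : Fin L) (τ : Traj H S A) (h : Fin H) : ℝ :=
  if (h : ℕ) = 0 then θ.init m (τ h).1
  else θ.trans m (τ ⟨h - 1, by omega⟩).1 (τ ⟨h - 1, by omega⟩).2 (τ h).1

/-- The log-likelihood of the latent index `m` given the first `W` states and `W - 1` actions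
of `τ`. -/
def LMDP.latentLogLik (θ : LMDP L S A) (W : ℕ) (τ : Traj H S A) (m : Fin L) : EReal :=
  elog (θ.mix m) + ∑ h ∈ Finset.univ.filter (fun h : Fin H => (h : ℕ) < W), elog (θ.stepProb m τ h)

theorem LMDP.exists_isMax_latentLogLik (θ : LMDP L S A) (W : ℕ) (τ : Traj H S A) :
    ∃ m ∈ θ.supp, ∀ l ∈ θ.supp, θ.latentLogLik W τ l ≤ θ.latentLogLik W τ m := by
  classical
  have hne : θ.supp.Nonempty := by
    by_contra h
    rw [Set.not_nonempty_iff_eq_empty] at h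
    have h0 : ∀ m, θ.mix m = 0 := fun m => le_antisymm
      (not_lt.mp fun hm => (Set.eq_empty_iff_forall_notMem.mp h m) hm) (stdSimplex.zero_le _ _)
    have h1 := stdSimplex.sum_eq_one θ.mix
    simp [h0] at h1
  exact
    Set.exists_max_image θ.supp (θ.latentLogLik W τ) (Set.toFinite _) hne

/-- The maximum likelihood decoder `m_θ` of the latent index (ties broken arbitrarily). -/
def LMDP.decode (θ : LMDP L S A) (W : ℕ) (τ : Traj H S A) : Fin L :=
  (θ.exists_isMax_latentLogLik W τ).choose

variable [Fintype A]

/-- The probability that `π` takes the action that `τ` shows at step `h`, given the history. -/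
def actionProb (π : Policy H S A) (τ : Traj H S A) (h : Fin H) : ℝ :=
  π h (fun i => τ ⟨i, by omega⟩) (τ h).1 (τ h).2

/-- The joint law of the latent index and the trajectory under the policy `π`. -/
def LMDP.jointProb (θ : LMDP L S A) (π : Policy H S A) (m : Fin L) (τ : Traj H S A) : ℝ :=
  θ.mix m * ∏ h, (θ.stepProb m τ h * actionProb π τ h)

/-- The law `P_θ^π` of the trajectory under the policy `π`. -/
def LMDP.trajProb (θ : LMDP L S A) (π : Policy H S A) (τ : Traj H S A) : ℝ :=
  ∑ m, θ.jointProb π m τ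

/-- The law of the trajectory under a mixture of policies. -/
def LMDP.mixProb (θ : LMDP L S A) (μ : MixedPolicy H S A) (τ : Traj H S A) : ℝ :=
  μ.sum fun π w => w * θ.trajProb π τ

/-- The value `V_θ(μ)`: the expected total reward. -/
def LMDP.mixValue (θ : LMDP L S A) (R : Fin H → S → A → ℝ) (μ : MixedPolicy H S A) : ℝ :=
  ∑ τ, θ.mixProb μ τ * ∑ h, R h (τ h).1 (τ h).2

/-- The value `V_θ(π)` of a single policy. -/
def LMDP.value (θ : LMDP L S A) (R : Fin H → S → A → ℝ) (π : Policy H S A) : ℝ :=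
  ∑ τ, θ.trajProb π τ * ∑ h, R h (τ h).1 (τ h).2

/-- `μ` is `ε`-optimal among all policies. -/
def LMDP.IsEpsOptimal (θ : LMDP L S A) (R : Fin H → S → A → ℝ) (ε : ℝ)
    (μ : MixedPolicy H S A) : Prop :=
  ∀ π : Policy H S A, θ.value R π - θ.mixValue R μ ≤ ε

/-- Known rewards with values in `[0, 1]` and `∑ₕ sup_{s,a} R_h(s,a) ≤ 1`. -/
def IsReward (R : Fin H → S → A → ℝ) : Prop :=
  (∀ h s a, R h s a ∈ Set.Icc (0 : ℝ) 1) ∧ ∑ h, (⨆ x : S × A, R h x.1 x.2) ≤ 1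

open Classical in
/-- The decoding error `e_{θ,W}(π)`: the probability that the decoder misses the latent index. -/
def LMDP.decodeError (θ : LMDP L S A) (W : ℕ) (π : Policy H S A) : ℝ :=
  ∑ τ : Traj H S A, ∑ m, if θ.decode W τ ≠ m then θ.jointProb π m τ else 0

end Model

section Exploration

variable {H : ℕ} {S A : Type*} [Fintype A]

/-- `π ∘_h π'` with steps counted from `1`: execute `π` for the first `h - 1` steps (none if
`h ≤ 1`), then start executing `π'` from its own first step, discarding the earlier history. -/
def Policy.circ (h : ℕ) (π π' : Policy H S A) : Policy H S A := fun t hist s =>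
  if (t : ℕ) < h - 1 then π t hist s
  else π' ⟨t - (h - 1), by omega⟩
    (fun i => hist ⟨(h - 1) + i, by have := i.isLt; simp only at this; omega⟩) s

/-- The policy that takes uniformly random actions. -/
def Policy.unif (H : ℕ) (S A : Type*) [Fintype A] [Nonempty A] : Policy H S A :=
  fun _ _ _ => stdSimplex.barycenter

/-- The modification `φ_h(π) = π ∘_h Unif(A) ∘_{h+1} π_exp`; so `φ_0(π) = π_exp`. -/
def Policy.phi [Nonempty A] (πexp : Policy H S A) (h : ℕ) (π : Policy H S A) : Policy H S A :=
  ((π.circ h (Policy.unif H S A)).circ (h + 1) πexp)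

/-- The exploration strategy `(1/2) (π ∘_W π_exp) + (1/(2H)) ∑_{h=0}^{H-1} φ_h(π)`. -/
def explore [Nonempty A] (πexp : Policy H S A) (W : ℕ) (π : Policy H S A) : MixedPolicy H S A :=
  Finsupp.single (π.circ W πexp) (1 / 2) +
    ∑ h ∈ Finset.range H, Finsupp.single (Policy.phi πexp h π) (1 / (2 * (H : ℝ)))

end Exploration

section Algorithm

variable {L H : ℕ} {S A : Type*} [Fintype S] [Fintype A]

/-- The data collected so far: the executed policies with the observed trajectories. -/
abbrev Dataset (H : ℕ) (S A : Type*) [Fintype A] : Type _ :=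
  List (MixedPolicy H S A × Traj H S A)

/-- The log-likelihood of the data under `θ`. -/
def LMDP.logLik (θ : LMDP L S A) (D : Dataset H S A) : EReal :=
  (D.map fun x => elog (θ.mixProb x.1 x.2)).sum

/-- The confidence set: the models in `Θ` whose log-likelihood is within `β` of the maximum. -/
def confidenceSet (Θ : Set (LMDP L S A)) (β : ℝ) (D : Dataset H S A) : Set (LMDP L S A) :=
  {θ ∈ Θ | ∀ θ' ∈ Θ, θ'.logLik D - (β : EReal) ≤ θ.logLik D}

/-- `x = (θ, π)` maximizes `V_θ(π)` over the confidence set of `D` under the constraint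
`e_{θ,W}(π) ≤ εs`. -/
def IsOptimisticChoice (Θ : Set (LMDP L S A)) (R : Fin H → S → A → ℝ) (β εs : ℝ) (W : ℕ)
    (D : Dataset H S A) (x : LMDP L S A × Policy H S A) : Prop :=
  (x.1 ∈ confidenceSet Θ β D ∧ x.1.decodeError W x.2 ≤ εs) ∧
    ∀ y : LMDP L S A × Policy H S A, y.1 ∈ confidenceSet Θ β D → y.1.decodeError W y.2 ≤ εs →
      y.1.value R y.2 ≤ x.1.value R x.2

/-- A rule that maps the data to the next (model, policy) pair. -/
abbrev Selection (L H : ℕ) (S A : Type*) [Fintype S] [Fintype A] : Type _ :=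
  Dataset H S A → LMDP L S A × Policy H S A

variable [Nonempty A]

/-- The data after `k` rounds, in which the trajectories `τ 0, …, τ (k-1)` were observed. -/
def dataset (πexp : Policy H S A) (W : ℕ) (sel : Selection L H S A) :
    (k : ℕ) → (Fin k → Traj H S A) → Dataset H S A
  | 0, _ => []
  | k + 1, τ =>
    (explore πexp W (sel (dataset πexp W sel k (Fin.init τ))).2, τ (Fin.last k)) ::
      dataset πexp W sel k (Fin.init τ)

/-- The selection rule makes an optimistic choice in each of the rounds `1, …, K`, whatever was
observed before: it is a rule by which OMLE can be run for `K` rounds. -/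
def IsOMLE (Θ : Set (LMDP L S A)) (R : Fin H → S → A → ℝ) (πexp : Policy H S A) (β εs : ℝ)
    (W K : ℕ) (sel : Selection L H S A) : Prop :=
  ∀ k < K, ∀ τ : Fin k → Traj H S A,
    IsOptimisticChoice Θ R β εs W (dataset πexp W sel k τ) (sel (dataset πexp W sel k τ))

/-- The probability that the first `k` rounds in the true model `θ` produce the trajectories `τ`. -/
def runProb (θ : LMDP L S A) (πexp : Policy H S A) (W : ℕ) (sel : Selection L H S A) :
    (k : ℕ) → (Fin k → Traj H S A) → ℝ
  | 0, _ => 1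
  | k + 1, τ =>
    runProb θ πexp W sel k (Fin.init τ) *
      θ.mixProb (explore πexp W (sel (dataset πexp W sel k (Fin.init τ))).2) (τ (Fin.last k))

/-- The policies `π^1, …, π^k` selected in the first `k` rounds. -/
def chosenPolicies (πexp : Policy H S A) (W : ℕ) (sel : Selection L H S A) :
    (k : ℕ) → (Fin k → Traj H S A) → List (Policy H S A)
  | 0, _ => []
  | k + 1, τ =>
    (sel (dataset πexp W sel k (Fin.init τ))).2 :: chosenPolicies πexp W sel k (Fin.init τ)

/-- The output after `K` rounds: the uniform mixture of `π^1, …, π^K`. -/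
def output (πexp : Policy H S A) (W : ℕ) (sel : Selection L H S A) (K : ℕ)
    (τ : Fin K → Traj H S A) : MixedPolicy H S A :=
  ((chosenPolicies πexp W sel K τ).map fun π => Finsupp.single π (1 / (K : ℝ))).sum

/-- The probability that `K` rounds in the true model `θ` output an `ε`-optimal policy. -/
def successProb (θ : LMDP L S A) (R : Fin H → S → A → ℝ) (πexp : Policy H S A) (W : ℕ)
    (sel : Selection L H S A) (K : ℕ) (ε : ℝ) : ℝ :=
  ∑ τ : Fin K → Traj H S A,
    Set.indicator {τ | θ.IsEpsOptimal R ε (output πexp W sel K τ)} (runProb θ πexp W sel K) τ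

end Algorithm

end LatentMDP

end

set_option linter.unusedSectionVars false

/-! Strong separation makes the latent index visible. By separation, the transition kernels of two
instances have Bhattacharyya coefficient at most exp(-δ²/2), and this coefficient multiplies along a
trajectory whatever the policy does. After n steps the index can therefore be decoded with error at
most L exp(-δ²n/2) (`pastDec_error_le`, `futDec_error_le`, `decodeError_le`). With W close to H/2,
the steps before W and those after W both reveal the index, up to an error that the lower bound on H
makes negligible (`misspecification_le`). In particular the constraint on the decoding error holds
for every separated model and every policy. So maximizers exist by compactness (`exists_isOMLE`),
and optimism competes with every policy.

Statistics enter only through `exists_likelihood_event`. A supermartingale built from square roots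
of likelihood ratios, with a union bound over a finite grid of upper brackets, shows that with
probability 1 - p the true model θ* stays in all confidence sets, and that every model in a
confidence set has cumulative squared Hellinger distance at most 2β from θ* under the strategies
executed so far. By optimism, the regret of round r is at most the ℓ¹ distance between the
trajectory laws of θ^r and θ* under π^r (`value_sub_value_le`). What remains is to turn control on
the past data into control of the sum of these distances (`sum_abs_obs_sub_le`). The exploratory
policies φ_h provide the link: they follow π up to some step and then observe a fresh future under
π_exp.

Up to step w = W - 1, futures serve as a test for the latent index. The future decoder of a model
has a confusion matrix close to the identity, whose inverse has ℓ¹ norm at most 2. A joint law of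
history and latent index is thus a linear image of the observable law of futures, and the laws under
θ and θ* can be compared through it (`latentDiff`). Every step adds an error that is linear in the
posterior of θ* and otherwise sees only the current state, that is, a linear functional in dimension
L S. The elliptical potential lemma then bounds the sum over the rounds (`sum_stepErr_le`,
`sum_latErr_le`).

From step w on, the past pins down the index in both models, and `matching` pairs each instance of
θ* with one of θ. The remaining discrepancy is the distance between the kernels of paired instances,
which depends only on the index, the state at step w and the current state. These are L S² cells,
and a pigeonhole argument bounds the sum over the rounds (`occ_mul_kerGap_le`,
`sum_le_of_pigeonhole`).

Up to logarithms and the negligible decoding error, the total grows like √K, and K is chosen so that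
the average over the rounds is at most ε. -/

noncomputable section

namespace LatentMDP

/-! ### Histories, Markov chain weights and action weights -/

section Histories

variable {S A : Type*}

/-- The probability of the states of a history and of the current state in a Markov decision process
with initial distribution `ν` and kernel `T`, given the actions. -/
def chain (ν : S → ℝ) (T : S → A → S → ℝ) : (n : ℕ) → (Fin n → S × A) → S → ℝ
  | 0, _, s => ν s
  | n + 1, τ, s =>
    chain ν T n (Fin.init τ) (τ (Fin.last n)).1 * T (τ (Fin.last n)).1 (τ (Fin.last n)).2 s

/-- Action kernels for histories of every length. -/
abbrev ActionKernel (S A : Type*) : Type _ := (n : ℕ) → (Fin n → S × A) → S → A → ℝ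

/-- The probability of the actions of a history, given the states. -/
def actWeight (κ : ActionKernel S A) : (n : ℕ) → (Fin n → S × A) → ℝ
  | 0, _ => 1
  | n + 1, τ =>
    actWeight κ n (Fin.init τ) * κ n (Fin.init τ) (τ (Fin.last n)).1 (τ (Fin.last n)).2

@[simp] theorem chain_zero (ν : S → ℝ) (T : S → A → S → ℝ) (τ : Fin 0 → S × A) (s : S) :
    chain ν T 0 τ s = ν s := rfl

@[simp] theorem chain_snoc (ν : S → ℝ) (T : S → A → S → ℝ) (n : ℕ) (τ : Fin n → S × A) (x : S × A)
    (s : S) : chain ν T (n + 1) (Fin.snoc τ x) s = chain ν T n τ x.1 * T x.1 x.2 s := by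
  simp [chain]

@[simp] theorem actWeight_zero (κ : ActionKernel S A) (τ : Fin 0 → S × A) :
    actWeight κ 0 τ = 1 := rfl

@[simp] theorem actWeight_snoc (κ : ActionKernel S A) (n : ℕ) (τ : Fin n → S × A) (x : S × A) :
    actWeight κ (n + 1) (Fin.snoc τ x) = actWeight κ n τ * κ n τ x.1 x.2 := by
  simp [actWeight]

theorem chain_nonneg {ν : S → ℝ} {T : S → A → S → ℝ} (hν : ∀ s, 0 ≤ ν s)
    (hT : ∀ s a s', 0 ≤ T s a s') (n : ℕ) (τ : Fin n → S × A) (s : S) : 0 ≤ chain ν T n τ s := by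
  induction n generalizing s with
  | zero => exact hν s
  | succ n ih => exact mul_nonneg (ih _ _) (hT _ _ _)

theorem append_snoc {X : Type*} {h k : ℕ} (τ : Fin h → X) (y : Fin k → X) (x : X) :
    Fin.append τ (Fin.snoc y x : Fin (k + 1) → X) = (Fin.snoc (Fin.append τ y) x :
      Fin (h + k + 1) → X) := by
  funext i
  refine Fin.lastCases ?_ (fun i => ?_) i
  · exact (Fin.append_right τ (Fin.snoc y x : Fin (k + 1) → X) (Fin.last k)).trans
      ((Fin.snoc_last (α := fun _ => X) x y).trans
        (Fin.snoc_last (α := fun _ => X) x (Fin.append τ y)).symm)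
  · rw [Fin.snoc_castSucc]
    refine Fin.addCases (fun i => ?_) (fun i => ?_) i
    · rw [Fin.append_left]
      exact Fin.append_left τ (Fin.snoc y x : Fin (k + 1) → X) i
    · rw [Fin.append_right]
      exact (Fin.append_right τ (Fin.snoc y x : Fin (k + 1) → X) i.castSucc).trans (by simp)

/-- The Markov property: past and future are linked only through the state at step h, so the future
restarts from a point mass there. -/
theorem chain_append (ν : S → ℝ) (T : S → A → S → ℝ) [Fintype S] [DecidableEq S] (h k : ℕ)
    (τ : Fin h → S × A) (y : Fin k → S × A) (s' : S) :
    chain ν T (h + k) (Fin.append τ y) s' =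
      ∑ s, chain ν T h τ s * chain (Pi.single s 1) T k y s' := by
  induction k generalizing s' with
  | zero =>
    have : Fin.append τ y = τ := by
      rw [Subsingleton.elim y Fin.elim0, Fin.append_elim0]; rfl
    simp [this, Pi.single_apply]
  | succ k ih =>
    induction y using Fin.snocCases with
    | snoc y x =>
      rw [append_snoc]
      refine (chain_snoc ν T (h + k) _ _ _).trans ?_
      rw [ih]
      simp [Finset.sum_mul, mul_assoc]

/-- The first state of a history with current state `s`. -/
def firstState : (n : ℕ) → (Fin n → S × A) → S → S
  | 0, _, s => s
  | _ + 1, τ, _ => (τ 0).1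

/-- A future records its own starting state, as its first state or, when it is empty, as its current
one. Hence at most one term of the sum in `chain_append` survives, and square roots can be taken
inside that sum. -/
theorem chain_single_eq_zero [DecidableEq S] (T : S → A → S → ℝ) {n : ℕ} {τ : Fin n → S × A}
    {s s' : S} (h : s ≠ firstState n τ s') : chain (Pi.single s 1) T n τ s' = 0 := by
  induction n generalizing s' with
  | zero => simpa [firstState, Pi.single_apply] using Ne.symm h
  | succ n ih =>
    have : chain (Pi.single s 1) T n (Fin.init τ) (τ (Fin.last n)).1 = 0 := by
      apply ih
      cases n with
      | zero => simpa [firstState] using h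
      | succ n => simpa [firstState, Fin.init] using h
    simp [chain, this]

theorem sum_snoc [Fintype S] [Fintype A] {M : Type*} [AddCommMonoid M] (n : ℕ)
    (F : (Fin (n + 1) → S × A) → M) :
    ∑ τ, F τ = ∑ τ : Fin n → S × A, ∑ s, ∑ a, F (Fin.snoc τ (s, a)) := by
  rw [← (Fin.snocEquiv fun _ : Fin (n + 1) => S × A).sum_comp, Fintype.sum_prod_type_right]
  simp only [Fintype.sum_prod_type]
  rfl

theorem sum_append [Fintype S] [Fintype A] {M : Type*} [AddCommMonoid M] (h k : ℕ)
    (F : (Fin (h + k) → S × A) → M) :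
    ∑ τ, F τ = ∑ τ : Fin h → S × A, ∑ y : Fin k → S × A, F (Fin.append τ y) := by
  rw [← (Fin.appendEquiv h k).sum_comp, Fintype.sum_prod_type]
  rfl

/-- The action kernel consists of probability distributions. -/
structure ActionKernel.IsProb [Fintype A] (κ : ActionKernel S A) : Prop where
  nonneg : ∀ n τ s a, 0 ≤ κ n τ s a
  sum_eq_one : ∀ n τ s, ∑ a, κ n τ s a = 1

theorem actWeight_nonneg [Fintype A] {κ : ActionKernel S A} (hκ : κ.IsProb) (n : ℕ)
    (τ : Fin n → S × A) : 0 ≤ actWeight κ n τ := by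
  induction n with
  | zero => simp
  | succ n ih => exact mul_nonneg (ih _) (hκ.nonneg _ _ _ _)

variable [Fintype S] [Fintype A]

/-- One step of a weighted sum over histories. -/
theorem sum_actWeight_succ {κ : ActionKernel S A} (n : ℕ)
    (F : (Fin n → S × A) → S → A → ℝ) :
    ∑ τ : Fin (n + 1) → S × A, actWeight κ (n + 1) τ * F (Fin.init τ) (τ (Fin.last n)).1
        (τ (Fin.last n)).2 =
      ∑ τ : Fin n → S × A, ∑ s, actWeight κ n τ * ∑ a, κ n τ s a * F τ s a := by
  rw [sum_snoc]
  simp [Finset.mul_sum, mul_assoc]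

theorem sum_chain {κ : ActionKernel S A} (hκ : κ.IsProb) {ν : S → ℝ} {T : S → A → S → ℝ}
    (hν : ∑ s, ν s = 1) (hT : ∀ s a, ∑ s', T s a s' = 1) (n : ℕ) :
    ∑ τ : Fin n → S × A, ∑ s, actWeight κ n τ * chain ν T n τ s = 1 := by
  induction n with
  | zero => simpa using hν
  | succ n ih =>
    rw [sum_snoc, ← ih]
    refine Finset.sum_congr rfl fun τ _ => Finset.sum_congr rfl fun s _ => ?_
    simp only [chain_snoc, actWeight_snoc]
    calc _ = ∑ a, actWeight κ n τ * chain ν T n τ s * κ n τ s a * ∑ s', T s a s' := by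
          refine Finset.sum_congr rfl fun a _ => ?_
          rw [Finset.mul_sum]
          exact Finset.sum_congr rfl fun s' _ => by ring
      _ = _ := by simp [hT, ← Finset.mul_sum, hκ.sum_eq_one]

end Histories

/-! ### Laws of histories and futures in a latent MDP, and their Hellinger distances -/

section Dynamics

variable {L : ℕ} {S A : Type*} [Fintype S]

/-- The transition kernel of the instance `m` as a real function. -/
def LMDP.ker (θ : LMDP L S A) (m : Fin L) (s : S) (a : A) (s' : S) : ℝ := θ.trans m s a s'

theorem LMDP.ker_nonneg (θ : LMDP L S A) (m : Fin L) (s : S) (a : A) (s' : S) :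
    0 ≤ θ.ker m s a s' := stdSimplex.zero_le _ _

theorem LMDP.sum_ker (θ : LMDP L S A) (m : Fin L) (s : S) (a : A) : ∑ s', θ.ker m s a s' = 1 :=
  stdSimplex.sum_eq_one (θ.trans m s a)

/-- The joint probability of the latent index and of the states of a history. -/
def LMDP.pre (θ : LMDP L S A) (n : ℕ) (τ : Fin n → S × A) (s : S) (m : Fin L) : ℝ :=
  θ.mix m * chain (θ.init m) (θ.ker m) n τ s

/-- The probability of the states of a history. -/
def LMDP.obs (θ : LMDP L S A) (n : ℕ) (τ : Fin n → S × A) (s : S) : ℝ := ∑ m, θ.pre n τ s m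

open Classical in
/-- The probability of a future that starts in the state `s` in the instance `m`. -/
def LMDP.fut (θ : LMDP L S A) (m : Fin L) (s : S) (k : ℕ) (y : Fin k → S × A) (t : S) : ℝ :=
  chain (Pi.single s 1) (θ.ker m) k y t

/-- The joint probability of a history and a future. -/
def LMDP.preFut (θ : LMDP L S A) (n : ℕ) (τ : Fin n → S × A) (s : S) (k : ℕ) (y : Fin k → S × A)
    (s' : S) : ℝ := ∑ m, θ.pre n τ s m * θ.fut m s k y s'

theorem LMDP.pre_nonneg (θ : LMDP L S A) (n : ℕ) (τ : Fin n → S × A) (s : S) (m : Fin L) :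
    0 ≤ θ.pre n τ s m :=
  mul_nonneg (stdSimplex.zero_le _ _)
    (chain_nonneg (fun _ => stdSimplex.zero_le _ _) (θ.ker_nonneg m) _ _ _)

theorem LMDP.obs_nonneg (θ : LMDP L S A) (n : ℕ) (τ : Fin n → S × A) (s : S) :
    0 ≤ θ.obs n τ s := Finset.sum_nonneg fun _ _ => θ.pre_nonneg _ _ _ _

theorem LMDP.pre_le_obs (θ : LMDP L S A) (n : ℕ) (τ : Fin n → S × A) (s : S) (m : Fin L) :
    θ.pre n τ s m ≤ θ.obs n τ s :=
  Finset.single_le_sum (f := fun m => θ.pre n τ s m) (fun _ _ => θ.pre_nonneg _ _ _ _)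
    (Finset.mem_univ m)

theorem LMDP.fut_nonneg (θ : LMDP L S A) (m : Fin L) (s : S) (k : ℕ) (y : Fin k → S × A)
    (s' : S) : 0 ≤ θ.fut m s k y s' := by
  classical
  exact chain_nonneg (fun t => by by_cases h : t = s <;> simp [h])
    (θ.ker_nonneg m) _ _ _

theorem LMDP.preFut_nonneg (θ : LMDP L S A) (n : ℕ) (τ : Fin n → S × A) (s : S) (k : ℕ)
    (y : Fin k → S × A) (s' : S) : 0 ≤ θ.preFut n τ s k y s' :=
  Finset.sum_nonneg fun _ _ => mul_nonneg (θ.pre_nonneg _ _ _ _) (θ.fut_nonneg _ _ _ _ _)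

@[simp] theorem LMDP.pre_snoc (θ : LMDP L S A) (n : ℕ) (τ : Fin n → S × A) (x : S × A) (s' : S)
    (m : Fin L) : θ.pre (n + 1) (Fin.snoc τ x) s' m = θ.pre n τ x.1 m * θ.ker m x.1 x.2 s' := by
  simp [LMDP.pre, mul_assoc]

theorem LMDP.sum_obs_snoc (θ : LMDP L S A) (n : ℕ) (τ : Fin n → S × A) (s : S) (a : A) :
    ∑ s', θ.obs (n + 1) (Fin.snoc τ (s, a)) s' = θ.obs n τ s := by
  simp only [LMDP.obs, LMDP.pre_snoc]
  rw [Finset.sum_comm]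
  exact Finset.sum_congr rfl fun m _ => by rw [← Finset.mul_sum, θ.sum_ker, mul_one]

theorem LMDP.pre_eq_zero (θ : LMDP L S A) {m : Fin L} (hm : θ.mix m = 0) (n : ℕ)
    (τ : Fin n → S × A) (s : S) : θ.pre n τ s m = 0 := by simp [LMDP.pre, hm]

theorem LMDP.obs_append (θ : LMDP L S A) (h k : ℕ) (τ : Fin h → S × A) (y : Fin k → S × A)
    (s' : S) : θ.obs (h + k) (Fin.append τ y) s' = ∑ s, θ.preFut h τ s k y s' := by
  classical
  simp only [LMDP.obs, LMDP.preFut, LMDP.pre, LMDP.fut]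
  rw [Finset.sum_comm]
  refine Finset.sum_congr rfl fun m _ => ?_
  rw [chain_append, Finset.mul_sum]
  exact Finset.sum_congr rfl fun s _ => by
    rw [mul_assoc]

theorem LMDP.preFut_eq_zero (θ : LMDP L S A) {h k : ℕ} {τ : Fin h → S × A} {y : Fin k → S × A}
    {s s' : S} (hs : s ≠ firstState k y s') : θ.preFut h τ s k y s' = 0 := by
  classical
  exact Finset.sum_eq_zero fun m _ => by
    rw [LMDP.fut, chain_single_eq_zero _ hs, mul_zero]

variable [Fintype A] {κ : ActionKernel S A}

theorem LMDP.sum_fut (θ : LMDP L S A) (hκ : κ.IsProb) (m : Fin L) (s : S) (k : ℕ) :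
    ∑ y : Fin k → S × A, ∑ s', actWeight κ k y * θ.fut m s k y s' = 1 := by
  classical
  exact sum_chain hκ (by simp [Pi.single_apply]) (θ.sum_ker m) k

theorem LMDP.sum_pre (θ : LMDP L S A) (hκ : κ.IsProb) (m : Fin L) (n : ℕ) :
    ∑ τ : Fin n → S × A, ∑ s, actWeight κ n τ * θ.pre n τ s m = θ.mix m := by
  have := sum_chain hκ (stdSimplex.sum_eq_one (θ.init m)) (θ.sum_ker m) n
  rw [← mul_one (θ.mix m), ← this, Finset.mul_sum]
  refine Finset.sum_congr rfl fun τ _ => ?_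
  rw [Finset.mul_sum]
  exact Finset.sum_congr rfl fun s _ => by rw [LMDP.pre]; ring

theorem LMDP.sum_obs (θ : LMDP L S A) (hκ : κ.IsProb) (n : ℕ) :
    ∑ τ : Fin n → S × A, ∑ s, actWeight κ n τ * θ.obs n τ s = 1 := by
  rw [← stdSimplex.sum_eq_one θ.mix]
  simp only [← θ.sum_pre hκ _ n, LMDP.obs, Finset.mul_sum]
  exact Finset.sum_comm_cycle

theorem LMDP.sum_preFut (θ : LMDP L S A) (hκ : κ.IsProb) (n : ℕ) (τ : Fin n → S × A) (s : S)
    (k : ℕ) :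
    ∑ y : Fin k → S × A, ∑ s', actWeight κ k y * θ.preFut n τ s k y s' = θ.obs n τ s := by
  simp only [LMDP.preFut, LMDP.obs, Finset.mul_sum]
  calc _ = ∑ m, ∑ y : Fin k → S × A, ∑ s', actWeight κ k y * (θ.pre n τ s m * θ.fut m s k y s') := by
        exact Finset.sum_comm_cycle
      _ = ∑ m, θ.pre n τ s m * ∑ y : Fin k → S × A, ∑ s', actWeight κ k y * θ.fut m s k y s' := by
        simp only [Finset.mul_sum]
        exact Finset.sum_congr rfl fun m _ => Finset.sum_congr rfl fun y _ =>
          Finset.sum_congr rfl fun s' _ => by ring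
      _ = _ := by simp [θ.sum_fut hκ]

/-- The squared Hellinger distance of the laws of histories of length `n` (without a factor `1/2`). -/
def hellSq (κ : ActionKernel S A) (n : ℕ) (θ θ' : LMDP L S A) : ℝ :=
  ∑ τ : Fin n → S × A, ∑ s, actWeight κ n τ * (√(θ.obs n τ s) - √(θ'.obs n τ s)) ^ 2

/-- The contribution to the squared Hellinger distance of the futures of a given history. -/
def hellFut (κ : ActionKernel S A) (θ θ' : LMDP L S A) (h : ℕ) (τ : Fin h → S × A) (s : S)
    (k : ℕ) : ℝ :=
  ∑ y : Fin k → S × A, ∑ s', actWeight κ k y *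
    (√(θ.preFut h τ s k y s') - √(θ'.preFut h τ s k y s')) ^ 2

theorem hellFut_nonneg (hκ : κ.IsProb) (θ θ' : LMDP L S A) (h : ℕ) (τ : Fin h → S × A) (s : S)
    (k : ℕ) : 0 ≤ hellFut κ θ θ' h τ s k :=
  Finset.sum_nonneg fun _ _ => Finset.sum_nonneg fun _ _ =>
    mul_nonneg (actWeight_nonneg hκ _ _) (sq_nonneg _)

theorem hellSq_nonneg (hκ : κ.IsProb) (n : ℕ) (θ θ' : LMDP L S A) : 0 ≤ hellSq κ n θ θ' :=
  Finset.sum_nonneg fun _ _ => Finset.sum_nonneg fun _ _ =>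
    mul_nonneg (actWeight_nonneg hκ _ _) (sq_nonneg _)

/-- By `preFut_eq_zero`, the sum over s in `obs_append` has a single nonzero term, the same for both
models. So the square root and the square act on that term alone, and no inequality is lost when the
distance is split along the prefix. -/
theorem hellSq_append {κ κ₁ κ₂ : ActionKernel S A} {h k : ℕ}
    (hκ : ∀ (τ : Fin h → S × A) (y : Fin k → S × A),
      actWeight κ (h + k) (Fin.append τ y) = actWeight κ₁ h τ * actWeight κ₂ k y)
    (θ θ' : LMDP L S A) :
    hellSq κ (h + k) θ θ' =
      ∑ τ : Fin h → S × A, ∑ s, actWeight κ₁ h τ * hellFut κ₂ θ θ' h τ s k := by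
  classical
  unfold hellSq hellFut
  rw [sum_append]
  refine Finset.sum_congr rfl fun τ _ => ?_
  simp only [hκ, LMDP.obs_append]
  simp only [Finset.mul_sum]
  rw [← Finset.sum_comm_cycle]
  refine Finset.sum_congr rfl fun y _ => Finset.sum_congr rfl fun s' _ => ?_
  have hz : ∀ s ≠ firstState k y s', ∀ η : LMDP L S A, η.preFut h τ s k y s' = 0 :=
    fun s hs η => η.preFut_eq_zero hs
  rw [Fintype.sum_eq_single (firstState k y s') (fun s hs => hz s hs θ),
    Fintype.sum_eq_single (firstState k y s') (fun s hs => hz s hs θ'),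
    Fintype.sum_eq_single (firstState k y s') (fun s hs => by simp [hz s hs]), mul_assoc]

end Dynamics

/-! ### From policies and trajectories to action kernels and histories -/

section Translation

variable {L H n : ℕ} {S A : Type*} [Fintype S] [Fintype A]

/-- The action kernels of a policy, extended by uniform actions after its horizon. -/
def Policy.ext (π : Policy H S A) : ActionKernel S A := fun n τ s a =>
  if h : n < H then π ⟨n, h⟩ τ s a else 1 / Fintype.card A

theorem Policy.ext_of_lt (π : Policy H S A) (h : n < H) (τ : Fin n → S × A) (s : S) (a : A) :
    π.ext n τ s a = π ⟨n, h⟩ τ s a := dif_pos h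

theorem Policy.ext_isProb [Nonempty A] (π : Policy H S A) : π.ext.IsProb where
  nonneg n τ s a := by
    unfold Policy.ext
    split_ifs with h
    · exact stdSimplex.zero_le _ _
    · positivity
  sum_eq_one n τ s := by
    unfold Policy.ext
    split_ifs with h
    · exact stdSimplex.sum_eq_one _
    · simp

theorem prod_actionProb (π : Policy H S A) (τ : Traj H S A) :
    ∏ h, actionProb π τ h = actWeight π.ext H τ := by
  suffices h : ∀ n (hn : n ≤ H), actWeight π.ext n (fun i => τ (Fin.castLE hn i)) =
      ∏ i : Fin n, actionProb π τ (Fin.castLE hn i) by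
    simpa using (h H le_rfl).symm
  intro n hn
  induction n with
  | zero => simp
  | succ n ih =>
    rw [Fin.prod_univ_castSucc, actWeight, π.ext_of_lt hn]
    exact congrArg₂ _ (ih (by omega)) rfl

theorem prod_stepProb (θ : LMDP L S A) (m : Fin L) (τ : Traj (n + 1) S A) :
    ∏ h, θ.stepProb m τ h =
      chain (θ.init m) (θ.ker m) n (Fin.init τ) (τ (Fin.last n)).1 := by
  induction n with
  | zero => simp [LMDP.stepProb]
  | succ n ih =>
    rw [Fin.prod_univ_castSucc]
    have h := ih (Fin.init τ)
    refine congrArg₂ _ (Eq.trans ?_ h) ?_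
    · exact Finset.prod_congr rfl fun i _ => rfl
    · simp only [LMDP.stepProb, Fin.val_last]
      rfl

theorem jointProb_eq (θ : LMDP L S A) (π : Policy (n + 1) S A) (m : Fin L)
    (τ : Traj (n + 1) S A) :
    θ.jointProb π m τ =
      actWeight π.ext (n + 1) τ * θ.pre n (Fin.init τ) (τ (Fin.last n)).1 m := by
  rw [LMDP.jointProb, Finset.prod_mul_distrib, prod_actionProb, prod_stepProb, LMDP.pre]
  ring

theorem trajProb_eq (θ : LMDP L S A) (π : Policy (n + 1) S A) (τ : Traj (n + 1) S A) :
    θ.trajProb π τ = actWeight π.ext (n + 1) τ * θ.obs n (Fin.init τ) (τ (Fin.last n)).1 := by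
  simp only [LMDP.trajProb, jointProb_eq, LMDP.obs, Finset.mul_sum]

/-- A sum over trajectories that does not see the last action. -/
theorem sum_traj [Nonempty A] (π : Policy H S A) (F : (Fin n → S × A) → S → ℝ) :
    ∑ τ : Fin (n + 1) → S × A, actWeight π.ext (n + 1) τ * F (Fin.init τ) (τ (Fin.last n)).1 =
      ∑ τ : Fin n → S × A, ∑ s, actWeight π.ext n τ * F τ s := by
  rw [sum_actWeight_succ n fun τ s _ => F τ s]
  simp [← Finset.sum_mul, π.ext_isProb.sum_eq_one]

theorem actWeight_congr {κ κ' : ActionKernel S A} (h : ∀ i < n, κ i = κ' i)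
    (τ : Fin n → S × A) : actWeight κ n τ = actWeight κ' n τ := by
  induction n with
  | zero => rfl
  | succ n ih =>
    rw [actWeight, actWeight, ih (fun i hi => h i (by omega)), h n (by omega)]

theorem Policy.ext_circ_of_lt (π π' : Policy H S A) {h i : ℕ} (hi : i < h) (hH : i < H) :
    (π.circ (h + 1) π').ext i = π.ext i := by
  funext τ s a
  rw [Policy.ext_of_lt _ hH, Policy.ext_of_lt _ hH, Policy.circ, if_pos (by simpa using hi)]

theorem Policy.ext_circ_append (π π' : Policy H S A) {h k : ℕ} (hH : h + k < H)
    (τ : Fin h → S × A) (y : Fin k → S × A) (s : S) (a : A) :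
    (π.circ (h + 1) π').ext (h + k) (Fin.append τ y) s a = π'.ext k y s a := by
  rw [Policy.ext_of_lt _ hH, Policy.ext_of_lt _ (by omega : k < H), Policy.circ,
    if_neg (by simp)]
  -- The restarted clock shows `h + k - (h + 1 - 1)`, equal to `k` only propositionally; the length
  -- is generalized in order to substitute.
  have key : ∀ (j : ℕ) (hj : j < H) (f : Fin j → S × A) (e : j = k),
      (∀ i : Fin j, f i = y ⟨i, e ▸ i.2⟩) → π' ⟨j, hj⟩ f s a = π' ⟨k, by omega⟩ y s a := by
    rintro j hj f rfl hf
    rw [show f = y from funext hf]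
  refine key _ _ _ (by simp) fun i => ?_
  exact Fin.append_right τ y ⟨i, by have := i.2; simp at this; omega⟩

/-- The second policy discards the history, so the action weights factor into a past and a future
part. Data collected by the φ_h are analysed through this product. -/
theorem actWeight_circ (π π' : Policy H S A) {h k : ℕ} (hH : h + k ≤ H)
    (τ : Fin h → S × A) (y : Fin k → S × A) :
    actWeight (π.circ (h + 1) π').ext (h + k) (Fin.append τ y) =
      actWeight π.ext h τ * actWeight π'.ext k y := by
  induction k with
  | zero =>
    have : Fin.append τ y = τ := by
      rw [Subsingleton.elim y Fin.elim0, Fin.append_elim0]; rfl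
    rw [this]
    simpa using actWeight_congr (fun i hi => π.ext_circ_of_lt π' hi (by omega)) τ
  | succ k ih =>
    induction y using Fin.snocCases with
    | snoc y x =>
      rw [append_snoc, actWeight_snoc]
      refine (actWeight_snoc _ (h + k) _ _).trans ?_
      rw [ih (by omega), Policy.ext_circ_append _ _ (by omega), mul_assoc]

variable [Nonempty A]

theorem actWeight_circ_unif (π : Policy H S A) {j : ℕ} (hj : j < H) (τ : Fin j → S × A)
    (x : S × A) :
    actWeight (π.circ (j + 1) (Policy.unif H S A)).ext (j + 1) (Fin.snoc τ x) =
      actWeight π.ext j τ * (1 / Fintype.card A) := by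
  have h := Policy.ext_circ_append π (Policy.unif H S A) (h := j) (k := 0) hj τ Fin.elim0 x.1 x.2
  rw [Fin.append_elim0] at h
  rw [actWeight_snoc, actWeight_congr (fun i hi => π.ext_circ_of_lt _ hi (by omega))]
  refine congrArg₂ _ rfl (Eq.trans h ?_)
  rw [Policy.ext_of_lt _ (by omega)]
  exact (stdSimplex.barycenter_apply x.2).trans (one_div _).symm

/-- The outer composition switches after `0 + 1 - 1 = 0` steps, so `φ_0` is `πexp` from its first
step and the inner composition is never executed. -/
theorem hellSq_phi_zero (πexp π : Policy (n + 1) S A) (θ θ' : LMDP L S A) :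
    hellSq (Policy.phi πexp 0 π).ext n θ θ' =
      ∑ s, hellFut πexp.ext θ θ' 0 Fin.elim0 s n := by
  have := hellSq_append (h := 0) (k := n)
    (actWeight_circ (π.circ 0 (Policy.unif (n + 1) S A)) πexp (by omega)) θ θ'
  rw [Fintype.sum_unique] at this
  simp only [actWeight_zero, one_mul] at this
  convert this using 2
  · rfl
  · simp
  · rw [Subsingleton.elim default Fin.elim0]

/-- The uniform action has the constant weight `1 / |A|`. Once this is pulled out, all actions at
that step are tested at once, whatever `π` would do. -/
theorem hellSq_phi_succ (πexp π : Policy (n + 1) S A) {j k : ℕ} (hn : j + 1 + k = n)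
    (θ θ' : LMDP L S A) :
    hellSq (Policy.phi πexp (j + 1) π).ext n θ θ' = 1 / Fintype.card A *
      ∑ τ : Fin j → S × A, ∑ s, actWeight π.ext j τ *
        ∑ a, ∑ s', hellFut πexp.ext θ θ' (j + 1) (Fin.snoc τ (s, a)) s' k := by
  subst hn
  rw [Policy.phi, hellSq_append
    (actWeight_circ (π.circ (j + 1) (Policy.unif _ S A)) πexp (by omega)) θ θ', sum_snoc]
  simp only [actWeight_circ_unif π (show j < j + 1 + k + 1 by omega), Finset.mul_sum]
  refine Finset.sum_congr rfl fun τ _ => Finset.sum_congr rfl fun s _ =>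
    Finset.sum_congr rfl fun a _ => Finset.sum_congr rfl fun s' _ => by ring

end Translation

/-! ### Logarithms with values in the extended reals -/

section Elog

theorem elog_mul {x y : ℝ} (hx : 0 ≤ x) : elog (x * y) = elog x + elog y := by
  rw [elog, ENNReal.ofReal_mul hx, ENNReal.log_mul_add]; rfl

theorem elog_one : elog 1 = 0 := by simp [elog]

theorem elog_le_elog_iff {x y : ℝ} (hy : 0 ≤ y) : elog x ≤ elog y ↔ x ≤ y := by
  rw [elog, elog, ENNReal.log_le_log_iff, ENNReal.ofReal_le_ofReal_iff hy]

theorem elog_finset_prod {ι : Type*} (t : Finset ι) (f : ι → ℝ) (hf : ∀ i ∈ t, 0 ≤ f i) :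
    ∑ i ∈ t, elog (f i) = elog (∏ i ∈ t, f i) := by
  classical
  induction t using Finset.induction_on with
  | empty => simp [elog_one]
  | insert i t hi ih =>
    rw [Finset.sum_insert hi, Finset.prod_insert hi, elog_mul (hf i (by simp)),
      ih fun j hj => hf j (by simp [hj])]

theorem elog_exp (x : ℝ) : elog (Real.exp x) = x := by
  rw [elog, ENNReal.log_ofReal_of_pos (Real.exp_pos x), Real.log_exp]

end Elog

/-! ### Bhattacharyya coefficients of separated instances -/

section Bhattacharyya

variable {L : ℕ} {S A : Type*} [Fintype S]

/-- Cauchy–Schwarz for |p - q| = |√p - √q| (√p + √q) gives (2 TV)² ≤ (2 - 2b)(2 + 2b), where b is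
the coefficient. So b² ≤ 1 - δ² ≤ exp(-δ²). -/
theorem sum_sqrt_mul_le (p q : Dist S) {δ : ℝ} (hδ : 0 ≤ δ) (h : δ ≤ tvDist p q) :
    ∑ s, √(p s * q s) ≤ Real.exp (-(δ ^ 2 / 2)) := by
  have hp : ∀ s, 0 ≤ p s := fun s => stdSimplex.zero_le _ _
  have hq : ∀ s, 0 ≤ q s := fun s => stdSimplex.zero_le _ _
  set b := ∑ s, √(p s * q s) with hb
  have hb0 : 0 ≤ b := Finset.sum_nonneg fun _ _ => Real.sqrt_nonneg _
  have h1 : ∑ s, (√(p s) - √(q s)) ^ 2 = 2 - 2 * b := by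
    calc _ = ∑ s, (p s + q s - 2 * √(p s * q s)) := by
          refine Finset.sum_congr rfl fun s _ => ?_
          rw [Real.sqrt_mul (hp s), sub_sq, Real.sq_sqrt (hp s), Real.sq_sqrt (hq s)]; ring
      _ = _ := by
          rw [Finset.sum_sub_distrib, Finset.sum_add_distrib, stdSimplex.sum_eq_one,
            stdSimplex.sum_eq_one, ← Finset.mul_sum]; ring
  have h2 : ∑ s, (√(p s) + √(q s)) ^ 2 = 2 + 2 * b := by
    calc _ = ∑ s, (p s + q s + 2 * √(p s * q s)) := by
          refine Finset.sum_congr rfl fun s _ => ?_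
          rw [Real.sqrt_mul (hp s), add_sq, Real.sq_sqrt (hp s), Real.sq_sqrt (hq s)]; ring
      _ = _ := by
          rw [Finset.sum_add_distrib, Finset.sum_add_distrib, stdSimplex.sum_eq_one,
            stdSimplex.sum_eq_one, ← Finset.mul_sum]; ring
  have h3 : ∑ s, |p s - q s| = ∑ s, |√(p s) - √(q s)| * (√(p s) + √(q s)) := by
    refine Finset.sum_congr rfl fun s _ => ?_
    rw [← abs_of_nonneg (add_nonneg (Real.sqrt_nonneg (p s)) (Real.sqrt_nonneg (q s))), ← abs_mul]
    congr 1
    nlinarith [Real.sq_sqrt (hp s), Real.sq_sqrt (hq s)]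
  have h4 := Finset.sum_mul_sq_le_sq_mul_sq Finset.univ (fun s => |√(p s) - √(q s)|)
    (fun s => √(p s) + √(q s))
  simp only [sq_abs] at h4
  rw [← h3, h1, h2] at h4
  have h5 : δ ^ 2 ≤ 1 - b ^ 2 := by
    have : δ ^ 2 ≤ (tvDist p q) ^ 2 := by gcongr
    rw [tvDist] at this
    nlinarith
  have h6 : b ^ 2 ≤ Real.exp (-(δ ^ 2 / 2)) ^ 2 := by
    rw [← Real.exp_nat_mul]
    have := Real.add_one_le_exp (-(δ ^ 2))
    have e : ((2 : ℕ) : ℝ) * -(δ ^ 2 / 2) = -δ ^ 2 := by push_cast; ring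
    rw [e]; linarith
  exact le_of_sq_le_sq h6 (Real.exp_pos _).le |>.trans' le_rfl

theorem sum_sqrt_mul_le_one {ι : Type*} [Fintype ι] {p q : ι → ℝ} (hp : ∀ i, 0 ≤ p i)
    (hq : ∀ i, 0 ≤ q i) (hp1 : ∑ i, p i = 1) (hq1 : ∑ i, q i = 1) :
    ∑ i, √(p i * q i) ≤ 1 := by
  calc _ ≤ ∑ i, (p i + q i) / 2 := Finset.sum_le_sum fun i _ => by
        rw [Real.sqrt_le_left (by linarith [hp i, hq i])]
        nlinarith [sq_nonneg (p i - q i)]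
    _ = 1 := by rw [← Finset.sum_div, Finset.sum_add_distrib, hp1, hq1]; norm_num

variable [Fintype A] {κ : ActionKernel S A}

/-- Both chains see the same action weights, so these do not enter the square root. Summing out the
last transition gives a factor at most `c` for every action, hence for every history-dependent
kernel. -/
theorem sum_sqrt_chain_le (hκ : κ.IsProb) {ν ν' : S → ℝ} {T T' : S → A → S → ℝ}
    (hν : ∀ s, 0 ≤ ν s) (hν' : ∀ s, 0 ≤ ν' s)
    (hT : ∀ s a s', 0 ≤ T s a s') (hT' : ∀ s a s', 0 ≤ T' s a s') {c : ℝ} (hc : 0 ≤ c)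
    (h : ∀ s a, ∑ s', √(T s a s' * T' s a s') ≤ c) (h0 : ∑ s, √(ν s * ν' s) ≤ 1) (n : ℕ) :
    ∑ τ : Fin n → S × A, ∑ s, actWeight κ n τ * √(chain ν T n τ s * chain ν' T' n τ s) ≤ c ^ n := by
  induction n with
  | zero => simpa using h0
  | succ n ih =>
    rw [sum_snoc]
    calc _ = ∑ τ : Fin n → S × A, ∑ s, ∑ a, actWeight κ n τ *
            √(chain ν T n τ s * chain ν' T' n τ s) * κ n τ s a *
              ∑ s', √(T s a s' * T' s a s') := by
          refine Finset.sum_congr rfl fun τ _ => Finset.sum_congr rfl fun s _ =>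
            Finset.sum_congr rfl fun a _ => ?_
          rw [Finset.mul_sum]
          refine Finset.sum_congr rfl fun s' _ => ?_
          simp only [chain_snoc, actWeight_snoc]
          rw [show chain ν T n τ s * T s a s' * (chain ν' T' n τ s * T' s a s') =
            chain ν T n τ s * chain ν' T' n τ s * (T s a s' * T' s a s') by ring,
            Real.sqrt_mul (mul_nonneg (chain_nonneg hν hT _ _ _) (chain_nonneg hν' hT' _ _ _))]
          ring
      _ ≤ ∑ τ : Fin n → S × A, ∑ s, ∑ a, actWeight κ n τ *
            √(chain ν T n τ s * chain ν' T' n τ s) * κ n τ s a * c := by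
          gcongr with τ _ s _ a _
          · exact mul_nonneg (mul_nonneg (actWeight_nonneg hκ _ _) (Real.sqrt_nonneg _))
              (hκ.nonneg _ _ _ _)
          · exact h s a
      _ = (∑ τ : Fin n → S × A, ∑ s, actWeight κ n τ *
            √(chain ν T n τ s * chain ν' T' n τ s)) * c := by
          simp only [Finset.sum_mul]
          refine Finset.sum_congr rfl fun τ _ => Finset.sum_congr rfl fun s _ => ?_
          rw [← Finset.sum_mul, ← Finset.mul_sum, hκ.sum_eq_one, mul_one]
      _ ≤ c ^ (n + 1) := by rw [pow_succ]; gcongr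

theorem sep_ker {θ : LMDP L S A} {δ : ℝ} (hδ : 0 ≤ δ) (hθ : θ.StronglySeparated δ) {m l : Fin L}
    (hm : 0 < θ.mix m) (hl : 0 < θ.mix l) (hml : m ≠ l) (s : S) (a : A) :
    ∑ s', √(θ.ker m s a s' * θ.ker l s a s') ≤ Real.exp (-(δ ^ 2 / 2)) :=
  sum_sqrt_mul_le _ _ hδ (hθ m hm l hl hml s a)

theorem sum_sqrt_pre_le {θ : LMDP L S A} {δ : ℝ} (hδ : 0 ≤ δ) (hθ : θ.StronglySeparated δ)
    (hκ : κ.IsProb) {m l : Fin L} (hml : m ≠ l) (n : ℕ) :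
    ∑ τ : Fin n → S × A, ∑ s, actWeight κ n τ * √(θ.pre n τ s m * θ.pre n τ s l) ≤
      √(θ.mix m) * √(θ.mix l) * Real.exp (-(δ ^ 2 / 2)) ^ n := by
  have h0 : ∀ i, 0 ≤ θ.mix i := fun i => stdSimplex.zero_le _ _
  -- Separation is only assumed between instances of positive weight; if one of the weights is zero,
  -- both sides vanish.
  by_cases hm : θ.mix m = 0
  · simp [LMDP.pre_eq_zero θ hm, hm]
  by_cases hl : θ.mix l = 0
  · simp [LMDP.pre_eq_zero θ hl, hl]
  have := sum_sqrt_chain_le hκ (fun s => stdSimplex.zero_le (θ.init m) s)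
    (fun s => stdSimplex.zero_le (θ.init l) s) (θ.ker_nonneg m) (θ.ker_nonneg l)
    (Real.exp_pos (-(δ ^ 2 / 2))).le
    (sep_ker hδ hθ ((h0 m).lt_of_ne' hm) ((h0 l).lt_of_ne' hl) hml)
    (sum_sqrt_mul_le_one (stdSimplex.zero_le _) (stdSimplex.zero_le _) (stdSimplex.sum_eq_one _)
      (stdSimplex.sum_eq_one _)) n
  refine le_trans (le_of_eq ?_) (mul_le_mul_of_nonneg_left this
    (mul_nonneg (Real.sqrt_nonneg (θ.mix m)) (Real.sqrt_nonneg (θ.mix l))))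
  rw [Finset.mul_sum]
  refine Finset.sum_congr rfl fun τ _ => ?_
  rw [Finset.mul_sum]
  refine Finset.sum_congr rfl fun s _ => ?_
  rw [LMDP.pre, LMDP.pre, show θ.mix m * chain (θ.init m) (θ.ker m) n τ s *
    (θ.mix l * chain (θ.init l) (θ.ker l) n τ s) = θ.mix m * (θ.mix l *
    (chain (θ.init m) (θ.ker m) n τ s * chain (θ.init l) (θ.ker l) n τ s)) by ring,
    Real.sqrt_mul (h0 m), Real.sqrt_mul (h0 l)]
  ring

theorem sum_sqrt_fut_le {θ : LMDP L S A} {δ : ℝ} (hδ : 0 ≤ δ) (hθ : θ.StronglySeparated δ)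
    (hκ : κ.IsProb) {m l : Fin L} (hm : 0 < θ.mix m) (hl : 0 < θ.mix l) (hml : m ≠ l) (s : S)
    (k : ℕ) :
    ∑ y : Fin k → S × A, ∑ s', actWeight κ k y * √(θ.fut m s k y s' * θ.fut l s k y s') ≤
      Real.exp (-(δ ^ 2 / 2)) ^ k := by
  classical
  have h0 : ∀ t : S, 0 ≤ (Pi.single s 1 : S → ℝ) t := fun t => by
    by_cases h : t = s <;> simp [h]
  exact sum_sqrt_chain_le hκ h0 h0 (θ.ker_nonneg m) (θ.ker_nonneg l)
    (Real.exp_pos (-(δ ^ 2 / 2))).le (sep_ker hδ hθ hm hl hml)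
    (sum_sqrt_mul_le_one h0 h0 (by simp) (by simp)) k

/-- The sum over all pairs of distinct indices of the Bhattacharyya terms. -/
def pairSum (x : Fin L → ℝ) : ℝ := ∑ m, ∑ l, if l ≠ m then √(x m * x l) else 0

/-- Keeping the factors √ρ(m) √ρ(l) yields (∑ √ρ)² ≤ L, hence one factor `L` instead of the number
of pairs. -/
theorem sum_pairSum_pre_le {θ : LMDP L S A} {δ : ℝ} (hδ : 0 ≤ δ) (hθ : θ.StronglySeparated δ)
    (hκ : κ.IsProb) (n : ℕ) :
    ∑ τ : Fin n → S × A, ∑ s, actWeight κ n τ * pairSum (θ.pre n τ s) ≤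
      L * Real.exp (-(δ ^ 2 / 2)) ^ n := by
  set E := Real.exp (-(δ ^ 2 / 2)) ^ n
  have hE : 0 ≤ E := by positivity
  calc _ = ∑ m, ∑ l, if l ≠ m then ∑ τ : Fin n → S × A, ∑ s, actWeight κ n τ *
            √(θ.pre n τ s m * θ.pre n τ s l) else 0 := by
        simp only [pairSum, Finset.mul_sum]
        rw [Finset.sum_comm_cycle]
        refine Finset.sum_congr rfl fun m _ => ?_
        rw [Finset.sum_comm_cycle]
        refine Finset.sum_congr rfl fun l _ => ?_
        split_ifs <;> simp
    _ ≤ ∑ m, ∑ l, √(θ.mix m) * √(θ.mix l) * E := by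
        refine Finset.sum_le_sum fun m _ => Finset.sum_le_sum fun l _ => ?_
        split_ifs with h
        · exact sum_sqrt_pre_le hδ hθ hκ h.symm n
        · positivity
    _ = (∑ m, √(θ.mix m)) ^ 2 * E := by
        rw [sq, Finset.sum_mul_sum, Finset.sum_mul]
        exact Finset.sum_congr rfl fun m _ => (Finset.sum_mul _ _ _).symm
    _ ≤ _ := by
        gcongr
        have := Finset.sum_mul_sq_le_sq_mul_sq Finset.univ (fun _ : Fin L => (1 : ℝ))
          (fun m => √(θ.mix m))
        simp only [one_mul, one_pow, Finset.sum_const, Finset.card_univ, Fintype.card_fin,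
          nsmul_eq_mul, mul_one] at this
        refine this.trans (le_of_eq ?_)
        rw [Finset.sum_congr rfl fun m _ => Real.sq_sqrt (stdSimplex.zero_le θ.mix m),
          stdSimplex.sum_eq_one, mul_one]

/-- An instance that loses against `d` has weight at most its geometric mean with `d`, which is one
of the Bhattacharyya terms. -/
theorem le_sum_sqrt_of_isMax {x : Fin L → ℝ} (hx : ∀ i, 0 ≤ x i) {d m : Fin L} (hd : x m ≤ x d)
    (hm : d ≠ m) : x m ≤ ∑ l, if l ≠ m then √(x m * x l) else 0 := by
  calc x m = √(x m * x m) := (Real.sqrt_mul_self (hx m)).symm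
    _ ≤ √(x m * x d) := Real.sqrt_le_sqrt (mul_le_mul_of_nonneg_left hd (hx m))
    _ = if d ≠ m then √(x m * x d) else 0 := (if_pos hm).symm
    _ ≤ _ := Finset.single_le_sum (f := fun l => if l ≠ m then √(x m * x l) else 0)
        (fun l _ => by split_ifs <;> positivity) (Finset.mem_univ d)

theorem sum_ne_le_pairSum {x : Fin L → ℝ} (hx : ∀ i, 0 ≤ x i) {d : Fin L}
    (hd : ∀ l, x l ≤ x d) : ∑ m, (if d ≠ m then x m else 0) ≤ pairSum x := by
  refine Finset.sum_le_sum fun m _ => ?_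
  split_ifs with h
  · exact le_sum_sqrt_of_isMax hx (hd m) h
  · exact Finset.sum_nonneg fun l _ => by split_ifs <;> positivity

end Bhattacharyya

/-! ### Past and future decoders; inverting the confusion matrix -/

section Decoders

variable {L : ℕ} {S A : Type*} [Fintype S]

theorem LMDP.exists_mix_pos (θ : LMDP L S A) : ∃ m, 0 < θ.mix m := by
  by_contra! h
  have h1 := stdSimplex.sum_eq_one θ.mix
  linarith [Finset.sum_nonpos fun m (_ : m ∈ Finset.univ) => h m]

theorem LMDP.exists_isMax_pre (θ : LMDP L S A) (n : ℕ) (τ : Fin n → S × A) (s : S) :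
    ∃ d, ∀ l, θ.pre n τ s l ≤ θ.pre n τ s d :=
  have : Nonempty (Fin L) := ⟨θ.exists_mix_pos.choose⟩
  Finite.exists_max _

/-- The maximum a posteriori decoder of the latent index from a history. -/
def LMDP.pastDec (θ : LMDP L S A) (n : ℕ) (τ : Fin n → S × A) (s : S) : Fin L :=
  (θ.exists_isMax_pre n τ s).choose

theorem LMDP.pre_le_pastDec (θ : LMDP L S A) (n : ℕ) (τ : Fin n → S × A) (s : S) (l : Fin L) :
    θ.pre n τ s l ≤ θ.pre n τ s (θ.pastDec n τ s) := (θ.exists_isMax_pre n τ s).choose_spec l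

theorem LMDP.exists_isMax_fut (θ : LMDP L S A) (s : S) (k : ℕ) (y : Fin k → S × A) (s' : S) :
    ∃ d, 0 < θ.mix d ∧ ∀ l, 0 < θ.mix l → θ.fut l s k y s' ≤ θ.fut d s k y s' :=
  Set.exists_max_image θ.supp (fun l => θ.fut l s k y s') (Set.toFinite _) θ.exists_mix_pos

/-- The maximum likelihood decoder of the latent index from a future. -/
def LMDP.futDec (θ : LMDP L S A) (s : S) (k : ℕ) (y : Fin k → S × A) (s' : S) : Fin L :=
  (θ.exists_isMax_fut s k y s').choose

theorem LMDP.mix_futDec_pos (θ : LMDP L S A) (s : S) (k : ℕ) (y : Fin k → S × A) (s' : S) :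
    0 < θ.mix (θ.futDec s k y s') := (θ.exists_isMax_fut s k y s').choose_spec.1

theorem LMDP.fut_le_futDec (θ : LMDP L S A) (s : S) (k : ℕ) (y : Fin k → S × A) (s' : S)
    {l : Fin L} (hl : 0 < θ.mix l) : θ.fut l s k y s' ≤ θ.fut (θ.futDec s k y s') s k y s' :=
  (θ.exists_isMax_fut s k y s').choose_spec.2 l hl

variable [Fintype A] {κ : ActionKernel S A} {θ : LMDP L S A} {δ : ℝ}

theorem pastDec_error_le (hδ : 0 ≤ δ) (hθ : θ.StronglySeparated δ) (hκ : κ.IsProb) (n : ℕ) :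
    ∑ τ : Fin n → S × A, ∑ s, actWeight κ n τ *
        ∑ m, (if θ.pastDec n τ s ≠ m then θ.pre n τ s m else 0) ≤
      L * Real.exp (-(δ ^ 2 / 2)) ^ n := by
  refine le_trans ?_ (sum_pairSum_pre_le hδ hθ hκ n)
  gcongr with τ _ s _
  · exact actWeight_nonneg hκ _ _
  · exact sum_ne_le_pairSum (θ.pre_nonneg n τ s) (θ.pre_le_pastDec n τ s)

/-- The decoder uses no prior, so its error is small in each instance separately and not just on
average. This is what a column of the confusion matrix needs; the comparison with all competitors
costs the factor `L`. -/
theorem futDec_error_le (hδ : 0 ≤ δ) (hθ : θ.StronglySeparated δ) (hκ : κ.IsProb) {m : Fin L}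
    (hm : 0 < θ.mix m) (s : S) (k : ℕ) :
    ∑ y : Fin k → S × A, ∑ s', actWeight κ k y *
        (if θ.futDec s k y s' ≠ m then θ.fut m s k y s' else 0) ≤
      L * Real.exp (-(δ ^ 2 / 2)) ^ k := by
  classical
  calc _ ≤ ∑ y : Fin k → S × A, ∑ s', actWeight κ k y *
          ∑ l, (if 0 < θ.mix l ∧ l ≠ m then √(θ.fut m s k y s' * θ.fut l s k y s') else 0) := by
        gcongr with y _ s' _
        · exact actWeight_nonneg hκ _ _
        · have hnn : ∀ l, 0 ≤ (if 0 < θ.mix l ∧ l ≠ m then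
              √(θ.fut m s k y s' * θ.fut l s k y s') else 0) := fun l => by
            split_ifs <;> positivity
          split_ifs with h
          · calc θ.fut m s k y s' = √(θ.fut m s k y s' * θ.fut m s k y s') :=
                  (Real.sqrt_mul_self (θ.fut_nonneg _ _ _ _ _)).symm
              _ ≤ √(θ.fut m s k y s' * θ.fut (θ.futDec s k y s') s k y s') :=
                  Real.sqrt_le_sqrt (mul_le_mul_of_nonneg_left (θ.fut_le_futDec s k y s' hm)
                    (θ.fut_nonneg _ _ _ _ _))
              _ = _ := (if_pos ⟨θ.mix_futDec_pos s k y s', h⟩).symm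
              _ ≤ _ := Finset.single_le_sum (f := fun l => if 0 < θ.mix l ∧ l ≠ m then
                  √(θ.fut m s k y s' * θ.fut l s k y s') else 0) (fun l _ => hnn l)
                  (Finset.mem_univ _)
          · exact Finset.sum_nonneg fun l _ => hnn l
    _ = ∑ l, if 0 < θ.mix l ∧ l ≠ m then ∑ y : Fin k → S × A, ∑ s', actWeight κ k y *
          √(θ.fut m s k y s' * θ.fut l s k y s') else 0 := by
        simp only [Finset.mul_sum]
        rw [Finset.sum_comm_cycle]
        refine Finset.sum_congr rfl fun l _ => ?_
        split_ifs <;> simp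
    _ ≤ ∑ _l : Fin L, Real.exp (-(δ ^ 2 / 2)) ^ k := by
        refine Finset.sum_le_sum fun l _ => ?_
        split_ifs with h
        · exact sum_sqrt_fut_le hδ hθ hκ hm h.1 h.2.symm s k
        · positivity
    _ = _ := by simp

open Classical in
/-- The law of the future decoder in each instance; instances of weight zero are treated as
decoded perfectly. -/
def LMDP.confusion (θ : LMDP L S A) (κ : ActionKernel S A) (s : S) (k : ℕ) :
    Matrix (Fin L) (Fin L) ℝ := fun l l' =>
  if 0 < θ.mix l' then
    ∑ y : Fin k → S × A, ∑ s', actWeight κ k y *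
      (if θ.futDec s k y s' = l then θ.fut l' s k y s' else 0)
  else if l = l' then 1 else 0

theorem confusion_nonneg (hκ : κ.IsProb) (s : S) (k : ℕ) (l l' : Fin L) :
    0 ≤ θ.confusion κ s k l l' := by
  unfold LMDP.confusion
  split_ifs
  · refine Finset.sum_nonneg fun _ _ => Finset.sum_nonneg fun _ _ =>
      mul_nonneg (actWeight_nonneg hκ _ _) ?_
    split_ifs
    · exact θ.fut_nonneg _ _ _ _ _
    · exact le_rfl
  · exact zero_le_one
  · exact le_rfl

theorem sum_confusion (hκ : κ.IsProb) (s : S) (k : ℕ) (l' : Fin L) :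
    ∑ l, θ.confusion κ s k l l' = 1 := by
  unfold LMDP.confusion
  by_cases h : 0 < θ.mix l'
  · simp only [h, if_true]
    rw [← Finset.sum_comm_cycle, ← θ.sum_fut hκ l' s k]
    refine Finset.sum_congr rfl fun y _ => Finset.sum_congr rfl fun s' _ => ?_
    simp
  · simp [h]

theorem confusion_diag_ge (hδ : 0 ≤ δ) (hθ : θ.StronglySeparated δ) (hκ : κ.IsProb) (s : S)
    (k : ℕ) (l' : Fin L) :
    1 - L * Real.exp (-(δ ^ 2 / 2)) ^ k ≤ θ.confusion κ s k l' l' := by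
  unfold LMDP.confusion
  split_ifs with h
  · have h1 := futDec_error_le hδ hθ hκ h s k
    rw [← θ.sum_fut hκ l' s k, sub_le_iff_le_add]
    refine le_trans (le_of_eq ?_) (add_le_add le_rfl h1)
    simp only [← Finset.sum_add_distrib, ← mul_add]
    refine Finset.sum_congr rfl fun y _ => Finset.sum_congr rfl fun s' _ => ?_
    by_cases h2 : θ.futDec s k y s' = l' <;> simp [h2]
  · have : 0 ≤ (L : ℝ) * Real.exp (-(δ ^ 2 / 2)) ^ k := by positivity
    linarith
  · exact absurd rfl ‹_›

/-- Columns of M are probability vectors with diagonal entry at least 3/4, so each column of M - 1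
has ℓ¹ norm 2(1 - M l l) ≤ 1/2. Then ‖x‖ ≤ ‖Mx‖ + ‖x‖/2. -/
theorem sum_abs_le_confusion (hδ : 0 ≤ δ) (hθ : θ.StronglySeparated δ) (hκ : κ.IsProb) (s : S)
    (k : ℕ) (hη : L * Real.exp (-(δ ^ 2 / 2)) ^ k ≤ 1 / 4) (x : Fin L → ℝ) :
    ∑ l, |x l| ≤ 2 * ∑ l, |(θ.confusion κ s k).mulVec x l| := by
  set M := θ.confusion κ s k
  have hM : ∀ l', ∑ l, |M l l' - if l = l' then 1 else 0| ≤ 1 / 2 := fun l' => by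
    have h1 := sum_confusion (θ := θ) hκ s k l'
    have h2 := confusion_diag_ge hδ hθ hκ s k l'
    have h3 : ∑ l, |M l l' - if l = l' then 1 else 0| =
        ∑ l, (M l l' - (if l = l' then 1 else 0) + if l = l' then 2 * (1 - M l' l') else 0) := by
      refine Finset.sum_congr rfl fun l _ => ?_
      by_cases hl : l = l'
      · subst hl
        have : M l l ≤ 1 := by
          rw [← h1]
          exact Finset.single_le_sum (f := fun i => θ.confusion κ s k i l)
            (fun i _ => confusion_nonneg hκ s k i l) (Finset.mem_univ l)
        simp only [if_true]
        rw [abs_of_nonpos (by linarith)]; ring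
      · simp [hl, abs_of_nonneg (confusion_nonneg (θ := θ) hκ s k l l'), M]
    rw [h3, Finset.sum_add_distrib, Finset.sum_sub_distrib, h1]
    simp only [Finset.sum_ite_eq', Finset.mem_univ, if_true]
    linarith
  have h1 : ∀ l, |x l| ≤ |M.mulVec x l| + ∑ l', |M l l' - if l = l' then 1 else 0| * |x l'| := by
    intro l
    have : x l = M.mulVec x l - ∑ l', (M l l' - if l = l' then 1 else 0) * x l' := by
      simp [Matrix.mulVec, dotProduct, sub_mul, Finset.sum_sub_distrib]
    calc |x l| = |M.mulVec x l - ∑ l', (M l l' - if l = l' then 1 else 0) * x l'| := by rw [← this]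
      _ ≤ |M.mulVec x l| + |∑ l', (M l l' - if l = l' then 1 else 0) * x l'| := abs_sub _ _
      _ ≤ _ := by
          gcongr
          refine (Finset.abs_sum_le_sum_abs _ _).trans (le_of_eq ?_)
          simp only [abs_mul]
  have h2 : ∑ l, ∑ l', |M l l' - if l = l' then 1 else 0| * |x l'| ≤ 1 / 2 * ∑ l, |x l| := by
    rw [Finset.sum_comm, Finset.mul_sum]
    refine Finset.sum_le_sum fun l' _ => ?_
    rw [← Finset.sum_mul]
    exact mul_le_mul_of_nonneg_right (hM l') (abs_nonneg _)
  have h3 := Finset.sum_le_sum fun l (_ : l ∈ Finset.univ) => h1 l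
  rw [Finset.sum_add_distrib] at h3
  linarith

theorem isUnit_confusion (hδ : 0 ≤ δ) (hθ : θ.StronglySeparated δ) (hκ : κ.IsProb) (s : S)
    (k : ℕ) (hη : L * Real.exp (-(δ ^ 2 / 2)) ^ k ≤ 1 / 4) : IsUnit (θ.confusion κ s k) := by
  rw [← Matrix.mulVec_injective_iff_isUnit]
  intro x y hxy
  have := sum_abs_le_confusion hδ hθ hκ s k hη (x - y)
  rw [Matrix.mulVec_sub, show (θ.confusion κ s k).mulVec x = _ from hxy] at this
  simp only [sub_self, Pi.zero_apply, abs_zero, Finset.sum_const_zero, mul_zero] at this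
  funext l
  have h0 := (Finset.sum_eq_zero_iff_of_nonneg (fun l _ => abs_nonneg _)).1
    (le_antisymm this (Finset.sum_nonneg fun l _ => abs_nonneg _)) l (Finset.mem_univ l)
  simpa [sub_eq_zero] using h0

theorem sum_abs_confusion_inv_le (hδ : 0 ≤ δ) (hθ : θ.StronglySeparated δ) (hκ : κ.IsProb) (s : S)
    (k : ℕ) (hη : L * Real.exp (-(δ ^ 2 / 2)) ^ k ≤ 1 / 4) (l' : Fin L) :
    ∑ l, |(θ.confusion κ s k)⁻¹ l l'| ≤ 2 := by
  classical
  have h := sum_abs_le_confusion hδ hθ hκ s k hη (fun l => (θ.confusion κ s k)⁻¹ l l')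
  have hu := (Matrix.isUnit_iff_isUnit_det _).1 (isUnit_confusion hδ hθ hκ s k hη)
  have h2 : (θ.confusion κ s k).mulVec (fun l => (θ.confusion κ s k)⁻¹ l l') =
      fun l => (1 : Matrix (Fin L) (Fin L) ℝ) l l' := by
    rw [← Matrix.mul_nonsing_inv _ hu]
    rfl
  rw [h2] at h
  simpa [Matrix.one_apply, apply_ite abs] using h

end Decoders

/-! ### The decoding error is uniformly small -/

section DecodeError

variable {L n : ℕ} {S A : Type*}

/-- The action kernels after the history `τ`. -/
def ActionKernel.shift (κ : ActionKernel S A) {h : ℕ} (τ : Fin h → S × A) : ActionKernel S A :=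
  fun k y => κ (h + k) (Fin.append τ y)

theorem ActionKernel.IsProb.shift [Fintype A] {κ : ActionKernel S A} (hκ : κ.IsProb) {h : ℕ}
    (τ : Fin h → S × A) : (κ.shift τ).IsProb where
  nonneg _ _ _ _ := hκ.nonneg _ _ _ _
  sum_eq_one _ _ _ := hκ.sum_eq_one _ _ _

theorem actWeight_append (κ : ActionKernel S A) {h k : ℕ} (τ : Fin h → S × A)
    (y : Fin k → S × A) :
    actWeight κ (h + k) (Fin.append τ y) = actWeight κ h τ * actWeight (κ.shift τ) k y := by
  induction k with
  | zero =>
    have : Fin.append τ y = τ := by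
      rw [Subsingleton.elim y Fin.elim0, Fin.append_elim0]; rfl
    simp [this]
  | succ k ih =>
    induction y using Fin.snocCases with
    | snoc y x =>
      rw [append_snoc, actWeight_snoc]
      refine (actWeight_snoc _ (h + k) _ _).trans ?_
      rw [ih, mul_assoc]
      rfl

variable [Fintype S] [Fintype A]

theorem prod_filter_stepProb {H w : ℕ} (hw : w + 1 ≤ H) (θ : LMDP L S A) (m : Fin L)
    (τ : Traj H S A) :
    ∏ h ∈ Finset.univ.filter (fun h : Fin H => (h : ℕ) < w + 1), θ.stepProb m τ h =
      chain (θ.init m) (θ.ker m) w (fun i => τ ⟨i, by omega⟩) (τ ⟨w, by omega⟩).1 := by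
  have h1 := prod_stepProb θ m (fun i : Fin (w + 1) => τ (Fin.castLE hw i))
  refine Eq.trans ?_ h1
  symm
  refine Finset.prod_bij (fun i _ => Fin.castLE hw i) (fun i _ => by simp; omega)
    (fun i _ j _ h => by simpa using h)
    (fun j hj => ⟨⟨j, by simpa using hj⟩, by simp, rfl⟩) fun i _ => rfl

/-- The first w + 1 states and w actions form a history of length w with its current state. So the
decoder of the algorithm is a maximum a posteriori decoder after w steps. -/
theorem latentLogLik_eq {H w : ℕ} (hw : w + 1 ≤ H) (θ : LMDP L S A) (m : Fin L)
    (τ : Traj H S A) :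
    θ.latentLogLik (w + 1) τ m =
      elog (θ.pre w (fun i => τ ⟨i, by omega⟩) (τ ⟨w, by omega⟩).1 m) := by
  rw [LMDP.latentLogLik, LMDP.pre, elog_mul (stdSimplex.zero_le _ _), elog_finset_prod,
    prod_filter_stepProb hw]
  intro i _
  unfold LMDP.stepProb
  split_ifs <;> exact stdSimplex.zero_le _ _

theorem pre_le_decode {H w : ℕ} (hw : w + 1 ≤ H) (θ : LMDP L S A) (l : Fin L) (τ : Traj H S A) :
    θ.pre w (fun i => τ ⟨i, by omega⟩) (τ ⟨w, by omega⟩).1 l ≤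
      θ.pre w (fun i => τ ⟨i, by omega⟩) (τ ⟨w, by omega⟩).1 (θ.decode (w + 1) τ) := by
  by_cases hl : 0 < θ.mix l
  · have := (θ.exists_isMax_latentLogLik (w + 1) τ).choose_spec.2 l hl
    rwa [latentLogLik_eq hw, latentLogLik_eq hw, elog_le_elog_iff (θ.pre_nonneg _ _ _ _)] at this
  · rw [θ.pre_eq_zero (le_antisymm (not_lt.1 hl) (stdSimplex.zero_le _ _))]
    exact θ.pre_nonneg _ _ _ _

variable [Nonempty A]

/-- The decoder reads a prefix while the joint law covers the whole trajectory. The error is bounded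
pointwise by a Bhattacharyya term of the prefix times the probability of the rest, and the rest sums
to one. As no property of the policy is used, the decoding constraint is void on the separated
class. -/
theorem decodeError_le {θ : LMDP L S A} {δ : ℝ} (hδ : 0 ≤ δ) (hθ : θ.StronglySeparated δ) {w : ℕ}
    (hw : w ≤ n) (π : Policy (n + 1) S A) :
    θ.decodeError (w + 1) π ≤ L * Real.exp (-(δ ^ 2 / 2)) ^ w := by
  classical
  obtain ⟨k, rfl⟩ := Nat.exists_eq_add_of_le hw
  have hπ := π.ext_isProb
  refine le_trans ?_ (sum_pairSum_pre_le hδ hθ hπ w)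
  have hpt : ∀ (τ : Fin w → S × A) (y : Fin k → S × A) (s' : S) (a : A) (m : Fin L),
      (if θ.decode (w + 1) (Fin.snoc (Fin.append τ y) (s', a) : Traj (w + k + 1) S A) ≠ m then
        θ.pre (w + k) (Fin.append τ y) s' m else 0) ≤
      ∑ s, (∑ l, if l ≠ m then √(θ.pre w τ s m * θ.pre w τ s l) else 0) * θ.fut m s k y s' := by
    intro τ y s' a m
    have hnn : ∀ s, 0 ≤ (∑ l, if l ≠ m then √(θ.pre w τ s m * θ.pre w τ s l) else 0) *
        θ.fut m s k y s' := fun s =>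
      mul_nonneg (Finset.sum_nonneg fun l _ => by split_ifs <;> positivity)
        (θ.fut_nonneg _ _ _ _ _)
    split_ifs with h
    · have h1 : θ.pre (w + k) (Fin.append τ y) s' m =
          ∑ s, θ.pre w τ s m * θ.fut m s k y s' := by
        simp only [LMDP.pre, LMDP.fut, chain_append, Finset.mul_sum, mul_assoc]
      rw [h1]
      refine Finset.sum_le_sum fun s _ => ?_
      -- Only the state that the trajectory shows at step w contributes, and there the prefix is
      -- exactly what the decoder has seen.
      by_cases hs : s = firstState k y s'
      · refine mul_le_mul_of_nonneg_right ?_ (θ.fut_nonneg _ _ _ _ _)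
        refine le_sum_sqrt_of_isMax (θ.pre_nonneg w τ s) ?_ h
        have h2 := pre_le_decode (H := w + k + 1) (w := w) (by omega) θ m
          (Fin.snoc (Fin.append τ y) (s', a) : Traj (w + k + 1) S A)
        have h3 : (fun i : Fin w => (Fin.snoc (Fin.append τ y) (s', a) : Traj (w + k + 1) S A)
            ⟨i, by omega⟩) = τ := by
          funext i
          have : (⟨i, by omega⟩ : Fin (w + k + 1)) = Fin.castSucc (Fin.castAdd k i) := rfl
          rw [this, Fin.snoc_castSucc, Fin.append_left]
        have h4 : ((Fin.snoc (Fin.append τ y) (s', a) : Traj (w + k + 1) S A) ⟨w, by omega⟩).1 =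
            s := by
          rw [hs]
          cases k with
          | zero =>
            have : (⟨w, by omega⟩ : Fin (w + 0 + 1)) = Fin.last w := rfl
            rw [this]
            exact congrArg Prod.fst
              (Fin.snoc_last (α := fun _ => S × A) (s', a) (Fin.append τ y))
          | succ k =>
            have : (⟨w, by omega⟩ : Fin (w + (k + 1) + 1)) =
              Fin.castSucc (Fin.natAdd w (0 : Fin (k + 1))) := rfl
            rw [this, Fin.snoc_castSucc, Fin.append_right]
            rfl
        rw [h3, h4] at h2
        exact h2
      · rw [LMDP.fut, chain_single_eq_zero _ hs]; simp
    · exact Finset.sum_nonneg fun s _ => hnn s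
  unfold LMDP.decodeError
  simp only [jointProb_eq]
  rw [sum_snoc, sum_append]
  calc _ = ∑ τ : Fin w → S × A, ∑ y : Fin k → S × A, ∑ s', ∑ a,
          actWeight π.ext (w + k) (Fin.append τ y) * π.ext (w + k) (Fin.append τ y) s' a *
          ∑ m, (if θ.decode (w + 1) (Fin.snoc (Fin.append τ y) (s', a) : Traj (w + k + 1) S A) ≠ m
            then θ.pre (w + k) (Fin.append τ y) s' m else 0) := by
        refine Finset.sum_congr rfl fun τ _ => Finset.sum_congr rfl fun y _ =>
          Finset.sum_congr rfl fun s' _ => Finset.sum_congr rfl fun a _ => ?_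
        rw [Finset.mul_sum]
        refine Finset.sum_congr rfl fun m _ => ?_
        simp only [actWeight_snoc, Fin.init_snoc, Fin.snoc_last, mul_ite, mul_zero]
    _ ≤ ∑ τ : Fin w → S × A, ∑ y : Fin k → S × A, ∑ s', ∑ a,
          actWeight π.ext (w + k) (Fin.append τ y) * π.ext (w + k) (Fin.append τ y) s' a *
          ∑ m, ∑ s, (∑ l, if l ≠ m then √(θ.pre w τ s m * θ.pre w τ s l) else 0) *
            θ.fut m s k y s' := by
        refine Finset.sum_le_sum fun τ _ => Finset.sum_le_sum fun y _ =>
          Finset.sum_le_sum fun s' _ => Finset.sum_le_sum fun a _ => ?_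
        exact mul_le_mul_of_nonneg_left (Finset.sum_le_sum fun m _ => hpt τ y s' a m)
          (mul_nonneg (actWeight_nonneg hπ _ _) (hπ.nonneg _ _ _ _))
    _ = ∑ τ : Fin w → S × A, ∑ y : Fin k → S × A, ∑ s', ∑ m, ∑ s, actWeight π.ext w τ *
          (∑ l, if l ≠ m then √(θ.pre w τ s m * θ.pre w τ s l) else 0) *
            (actWeight (π.ext.shift τ) k y * θ.fut m s k y s') := by
        refine Finset.sum_congr rfl fun τ _ => Finset.sum_congr rfl fun y _ =>
          Finset.sum_congr rfl fun s' _ => ?_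
        rw [← Finset.sum_mul, ← Finset.mul_sum, hπ.sum_eq_one, mul_one, actWeight_append,
          Finset.mul_sum]
        refine Finset.sum_congr rfl fun m _ => ?_
        rw [Finset.mul_sum]
        refine Finset.sum_congr rfl fun s _ => by ring
    _ = ∑ τ : Fin w → S × A, ∑ m, ∑ s, actWeight π.ext w τ *
          (∑ l, if l ≠ m then √(θ.pre w τ s m * θ.pre w τ s l) else 0) *
            ∑ y : Fin k → S × A, ∑ s', (actWeight (π.ext.shift τ) k y * θ.fut m s k y s') := by
        refine Finset.sum_congr rfl fun τ _ => ?_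
        rw [Finset.sum_comm_cycle]
        refine Finset.sum_congr rfl fun m _ => ?_
        rw [Finset.sum_comm_cycle]
        refine Finset.sum_congr rfl fun s _ => ?_
        simp only [Finset.mul_sum]
    _ ≤ _ := by
        refine Finset.sum_le_sum fun τ _ => le_of_eq ?_
        rw [Finset.sum_comm]
        refine Finset.sum_congr rfl fun s _ => ?_
        rw [pairSum, Finset.mul_sum]
        refine Finset.sum_congr rfl fun m _ => ?_
        rw [θ.sum_fut (hπ.shift τ), mul_one]

end DecodeError

/-! ### The elliptical potential lemma for distributions over vectors -/

section Eluder

open Matrix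

variable {d ι : Type*} [Fintype d] [DecidableEq d] [Fintype ι]
theorem le_two_mul_log_one_add {x : ℝ} (h0 : 0 ≤ x) (h1 : x ≤ 1) : x ≤ 2 * Real.log (1 + x) := by
  have := Real.one_sub_inv_le_log_of_pos (show 0 < 1 + x by linarith)
  have e : 1 - (1 + x)⁻¹ = x / (1 + x) := by field_simp; ring
  rw [e, div_le_iff₀ (by linarith)] at this
  have hl := Real.log_nonneg (show 1 ≤ 1 + x by linarith)
  nlinarith

theorem one_add_sum_le_prod {ι : Type*} (s : Finset ι) {f : ι → ℝ} (hf : ∀ i, 0 ≤ f i) :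
    1 + ∑ i ∈ s, f i ≤ ∏ i ∈ s, (1 + f i) := by
  classical
  induction s using Finset.induction_on with
  | empty => simp
  | insert i s hi ih =>
    rw [Finset.sum_insert hi, Finset.prod_insert hi]
    have := Finset.sum_nonneg fun i (_ : i ∈ s) => hf i
    nlinarith [hf i]

/-- In terms of the nonnegative eigenvalues this is 1 + ∑ λ ≤ ∏ (1 + λ). -/
theorem one_add_trace_le_det {X : Matrix d d ℝ} (hX : X.PosSemidef) : 1 + X.trace ≤ (1 + X).det := by
  have h1 : (1 + X).det = ∏ i, (1 + hX.1.eigenvalues i) := by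
    conv_lhs => rw [hX.1.spectral_theorem]
    have : (1 : Matrix d d ℝ) = Unitary.conjStarAlgAut ℝ _ hX.1.eigenvectorUnitary 1 := by simp
    rw [this, ← map_add, Unitary.conjStarAlgAut_apply, Matrix.det_mul_right_comm]
    have e : (1 + diagonal (RCLike.ofReal ∘ hX.1.eigenvalues) : Matrix d d ℝ) =
      diagonal (fun i => 1 + hX.1.eigenvalues i) := by
      rw [← diagonal_one, diagonal_add]; rfl
    rw [e]
    simp
  rw [h1, hX.1.trace_eq_sum_eigenvalues]
  exact one_add_sum_le_prod _ hX.eigenvalues_nonneg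

/-- Every eigenvalue is at most the trace. The bound is crude, but the determinant enters only
through its logarithm. -/
theorem det_le_trace_pow {V : Matrix d d ℝ} (hV : V.PosSemidef) : V.det ≤ V.trace ^ Fintype.card d := by
  rw [hV.1.det_eq_prod_eigenvalues, hV.1.trace_eq_sum_eigenvalues]
  calc _ ≤ ∏ _i : d, ∑ j, hV.1.eigenvalues j := Finset.prod_le_prod (fun i _ => hV.eigenvalues_nonneg i)
        fun i _ => Finset.single_le_sum (f := fun i => hV.1.eigenvalues i) (fun i _ => hV.eigenvalues_nonneg i) (Finset.mem_univ i)
    _ = _ := by simp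

open scoped MatrixOrder in
theorem exists_eq_transpose_mul_self {V : Matrix d d ℝ} (hV : V.PosDef) : ∃ B : Matrix d d ℝ, IsUnit B.det ∧ V = Bᵀ * B := by
  obtain ⟨B, hB⟩ := CStarAlgebra.nonneg_iff_eq_star_mul_self.1 hV.posSemidef.nonneg
  refine ⟨B, ?_, by simpa [Matrix.star_eq_conjTranspose] using hB⟩
  have h := hV.det_pos
  rw [hB, det_mul] at h
  exact isUnit_iff_ne_zero.2 fun h0 => by simp [h0] at h

/-- The weighted Gram matrix of a family of vectors. -/
def gram (q : ι → ℝ) (v : ι → d → ℝ) : Matrix d d ℝ := ∑ i, q i • vecMulVec (v i) (v i)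

theorem gram_posSemidef {q : ι → ℝ} (hq : ∀ i, 0 ≤ q i) (v : ι → d → ℝ) :
    (gram q v).PosSemidef :=
  posSemidef_sum _ fun i _ => (posSemidef_vecMulVec_self_star (v i)).smul (hq i)

theorem dotProduct_gram (q : ι → ℝ) (v : ι → d → ℝ) (x : d → ℝ) :
    x ⬝ᵥ (gram q v *ᵥ x) = ∑ i, q i * (x ⬝ᵥ v i) ^ 2 := by
  simp only [gram, sum_mulVec, dotProduct_sum, smul_mulVec, dotProduct_smul, vecMulVec_mulVec,
    smul_eq_mul]
  refine Finset.sum_congr rfl fun i _ => ?_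
  rw [dotProduct_comm (v i) x]
  simp [sq]

theorem trace_gram (q : ι → ℝ) (v : ι → d → ℝ) :
    (gram q v).trace = ∑ i, q i * (v i ⬝ᵥ v i) := by
  simp [gram, trace_sum, trace_vecMulVec]

theorem dotProduct_sq_le (x y : d → ℝ) : (x ⬝ᵥ y) ^ 2 ≤ (x ⬝ᵥ x) * (y ⬝ᵥ y) := by
  simpa [dotProduct, sq] using Finset.sum_mul_sq_le_sq_mul_sq Finset.univ x y

/-- Write V = BᵀB. The potential is the squared norm of the whitened vector B⁻ᵀ v, that is, of v in
the norm of V⁻¹, and the second claim is Cauchy–Schwarz. The hypothesis V ≥ 1 makes the potential at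
most 1. Its average is the trace of the whitened Gram matrix, so 1 + trace ≤ det bounds it by the
increase of log det V. A whole distribution `q` counts as one update. -/
theorem exists_potential {V : Matrix d d ℝ} (hV : V.PosDef) (hV1 : ∀ x, x ⬝ᵥ x ≤ x ⬝ᵥ (V *ᵥ x))
    {q : ι → ℝ} (hq : ∀ i, 0 ≤ q i) (hq1 : ∑ i, q i ≤ 1) {v : ι → d → ℝ}
    (hv : ∀ i, v i ⬝ᵥ v i ≤ 1) :
    ∃ φ : ι → ℝ, (∀ i, 0 ≤ φ i) ∧ (∀ g i, (g ⬝ᵥ v i) ^ 2 ≤ (g ⬝ᵥ (V *ᵥ g)) * φ i) ∧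
      ∑ i, q i * φ i ≤ 2 * (Real.log (V + gram q v).det - Real.log V.det) := by
  obtain ⟨B, hB, rfl⟩ := exists_eq_transpose_mul_self hV
  have hBt : IsUnit Bᵀ.det := by rwa [det_transpose]
  set z : ι → d → ℝ := fun i => Bᵀ⁻¹ *ᵥ v i with hz
  have hzv : ∀ i, Bᵀ *ᵥ z i = v i := fun i => by
    rw [hz, mulVec_mulVec, mul_nonsing_inv _ hBt, one_mulVec]
  have hVq : ∀ g, g ⬝ᵥ ((Bᵀ * B) *ᵥ g) = (B *ᵥ g) ⬝ᵥ (B *ᵥ g) := fun g => by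
    rw [← mulVec_mulVec, dotProduct_mulVec, vecMul_transpose]
  have hgv : ∀ g i, g ⬝ᵥ v i = (B *ᵥ g) ⬝ᵥ z i := fun g i => by
    rw [← hzv, dotProduct_mulVec, vecMul_transpose]
  have hφ0 : ∀ i, 0 ≤ z i ⬝ᵥ z i := fun i => by
    simpa [dotProduct] using Finset.sum_nonneg fun j (_ : j ∈ Finset.univ) => mul_self_nonneg (z i j)
  have hφ1 : ∀ i, z i ⬝ᵥ z i ≤ 1 := fun i => by
    set u := B⁻¹ *ᵥ z i
    have hu : B *ᵥ u = z i := by rw [mulVec_mulVec, mul_nonsing_inv _ hB, one_mulVec]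
    have h1 := hgv u i
    have h2 := hV1 u
    rw [hVq, hu] at h2
    rw [hu] at h1
    have h3 := dotProduct_sq_le u (v i)
    rw [h1] at h3
    have h4 : (z i ⬝ᵥ z i) ^ 2 ≤ z i ⬝ᵥ z i := by
      refine h3.trans ((mul_le_mul h2 (hv i) ?_ (hφ0 i)).trans (by rw [mul_one]))
      simpa [dotProduct] using
        Finset.sum_nonneg fun j (_ : j ∈ Finset.univ) => mul_self_nonneg (v i j)
    by_contra! h
    nlinarith
  refine ⟨fun i => z i ⬝ᵥ z i, hφ0, fun g i => ?_, ?_⟩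
  · rw [hVq, hgv]
    exact dotProduct_sq_le _ _
  · have h1 : Bᵀ * B + gram q v = Bᵀ * (1 + gram q z) * B := by
      have : gram q v = Bᵀ * gram q z * B := by
        simp only [gram, Finset.mul_sum, Finset.sum_mul]
        refine Finset.sum_congr rfl fun i _ => ?_
        rw [mul_smul_comm, smul_mul_assoc, mul_vecMulVec, vecMulVec_mul, hzv, ← mulVec_transpose,
          hzv]
      rw [this]; noncomm_ring
    have h2 : (Bᵀ * B + gram q v).det = (Bᵀ * B).det * (1 + gram q z).det := by
      rw [h1, det_mul, det_mul, det_mul]; ring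
    have h3 := one_add_trace_le_det (gram_posSemidef hq z)
    rw [trace_gram] at h3
    set p := ∑ i, q i * (z i ⬝ᵥ z i)
    have hp0 : 0 ≤ p := Finset.sum_nonneg fun i _ => mul_nonneg (hq i) (hφ0 i)
    have hp1 : p ≤ 1 := le_trans (Finset.sum_le_sum fun i _ =>
      mul_le_of_le_one_right (hq i) (hφ1 i)) hq1
    rw [h2, Real.log_mul hV.det_pos.ne' (by linarith), add_sub_cancel_left]
    have h4 := le_two_mul_log_one_add hp0 hp1
    have := Real.log_le_log (by linarith) h3
    linarith

/-- A form of the elliptical potential lemma. -/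
theorem sum_le_of_eluder {K : ℕ} {q : ℕ → ι → ℝ} (hq : ∀ k i, 0 ≤ q k i)
    (hq1 : ∀ k, ∑ i, q k i ≤ 1) {v : ι → d → ℝ} (hv : ∀ i, v i ⬝ᵥ v i ≤ 1)
    {g : ℕ → ι → d → ℝ} {F : ℕ → ι → ℝ} {G B : ℝ} (hG : ∀ k i, g k i ⬝ᵥ g k i ≤ G)
    (hF : ∀ k i, F k i = g k i ⬝ᵥ v i) (hgF : ∀ k i j, |g k i ⬝ᵥ v j| ≤ F k j)
    (hB : ∀ k < K, ∑ t ∈ Finset.range k, ∑ i, q t i * F k i ^ 2 ≤ B) (hGB : 0 ≤ G + B) :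
    ∑ k ∈ Finset.range K, ∑ i, q k i * F k i ≤
      √(K * ((G + B) * (2 * (Fintype.card d * Real.log (Fintype.card d + K))))) := by
  -- The regularized sum of the expected Gram matrices of the earlier rounds. The logarithms of its
  -- determinants telescope.
  set V : ℕ → Matrix d d ℝ := fun k => 1 + ∑ t ∈ Finset.range k, gram (q t) v with hVdef
  have hPS : ∀ k, (∑ t ∈ Finset.range k, gram (q t) v).PosSemidef := fun k =>
    posSemidef_sum _ fun t _ => gram_posSemidef (hq t) v
  have hV : ∀ k, (V k).PosDef := fun k => PosDef.one.add_posSemidef (hPS k)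
  have hVform : ∀ k x, x ⬝ᵥ (V k *ᵥ x) = x ⬝ᵥ x + ∑ t ∈ Finset.range k, ∑ i, q t i * (x ⬝ᵥ v i) ^ 2 :=
    fun k x => by
      simp only [hVdef, add_mulVec, one_mulVec, dotProduct_add, sum_mulVec, dotProduct_sum,
        dotProduct_gram]
  have hV1 : ∀ k x, x ⬝ᵥ x ≤ x ⬝ᵥ (V k *ᵥ x) := fun k x => by
    rw [hVform]
    exact le_add_of_nonneg_right (Finset.sum_nonneg fun t _ => Finset.sum_nonneg fun i _ =>
      mul_nonneg (hq t i) (sq_nonneg _))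
  have hVs : ∀ k, V (k + 1) = V k + gram (q k) v := fun k => by
    simp only [hVdef, Finset.sum_range_succ, add_assoc]
  choose φ hφ0 hφ hφs using fun k => exists_potential (hV k) (hV1 k) (hq k) (hq1 k) hv
  have hsum : ∑ k ∈ Finset.range K, ∑ i, q k i * φ k i ≤
      2 * (Fintype.card d * Real.log (Fintype.card d + K)) := by
    calc _ ≤ ∑ k ∈ Finset.range K, 2 * (Real.log (V (k + 1)).det - Real.log (V k).det) :=
          Finset.sum_le_sum fun k _ => by rw [hVs]; exact hφs k
      _ = 2 * Real.log (V K).det := by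
          rw [← Finset.mul_sum, Finset.sum_range_sub (fun k => Real.log (V k).det)]
          simp [hVdef]
      _ ≤ 2 * (Fintype.card d * Real.log (Fintype.card d + K)) := by
          rw [← Real.log_pow]
          have h1 := det_le_trace_pow (hV K).posSemidef
          have h2 : (V K).trace ≤ Fintype.card d + K := by
            simp only [hVdef, trace_add, trace_one, trace_sum, trace_gram]
            gcongr
            calc _ ≤ ∑ _t ∈ Finset.range K, (1 : ℝ) := Finset.sum_le_sum fun t _ =>
                  (Finset.sum_le_sum fun i _ => mul_le_of_le_one_right (hq t i) (hv i)).trans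
                    (hq1 t)
              _ = K := by simp
          have h3 := Real.log_le_log (hV K).det_pos
            (h1.trans (pow_le_pow_left₀ (hV K).posSemidef.trace_nonneg h2 _))
          linarith
  have hk : ∀ k ∈ Finset.range K, ∑ i, q k i * F k i ≤ √(G + B) * √(∑ i, q k i * φ k i) := by
    intro k hk
    -- In the norm of V k, the functional of round k has squared length at most `G` (from the
    -- identity) plus `B` (from its errors on the earlier rounds).
    have hFi : ∀ i, F k i ≤ √(G + B) * √(φ k i) := fun i => by
      have h1 := hφ k (g k i) i
      have h2 : g k i ⬝ᵥ (V k *ᵥ g k i) ≤ G + B := by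
        rw [hVform]
        refine add_le_add (hG k i) (le_trans ?_ (hB k (Finset.mem_range.1 hk)))
        refine Finset.sum_le_sum fun t _ => Finset.sum_le_sum fun j _ =>
          mul_le_mul_of_nonneg_left ?_ (hq t j)
        rw [← sq_abs]
        exact pow_le_pow_left₀ (abs_nonneg _) (hgF k i j) 2
      rw [← Real.sqrt_mul hGB, hF]
      exact Real.le_sqrt_of_sq_le (h1.trans (mul_le_mul_of_nonneg_right h2 (hφ0 k i)))
    have hcs := Finset.sum_mul_sq_le_sq_mul_sq Finset.univ (fun i => √(q k i))
      (fun i => √(q k i * φ k i))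
    have e1 : ∑ i, √(q k i) * √(q k i * φ k i) = ∑ i, q k i * √(φ k i) :=
      Finset.sum_congr rfl fun i _ => by
        rw [Real.sqrt_mul (hq k i), ← mul_assoc, Real.mul_self_sqrt (hq k i)]
    simp only [Real.sq_sqrt (hq k _), Real.sq_sqrt (mul_nonneg (hq k _) (hφ0 k _))] at hcs
    rw [e1] at hcs
    have h0 : 0 ≤ ∑ i, q k i * φ k i := Finset.sum_nonneg fun i _ => mul_nonneg (hq k i) (hφ0 k i)
    have h5 : ∑ i, q k i * √(φ k i) ≤ √(∑ i, q k i * φ k i) := by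
      apply Real.le_sqrt_of_sq_le
      nlinarith [hq1 k]
    calc _ ≤ ∑ i, q k i * (√(G + B) * √(φ k i)) :=
          Finset.sum_le_sum fun i _ => mul_le_mul_of_nonneg_left (hFi i) (hq k i)
      _ = √(G + B) * ∑ i, q k i * √(φ k i) := by
          rw [Finset.mul_sum]; exact Finset.sum_congr rfl fun i _ => by ring
      _ ≤ _ := by gcongr
  refine (Finset.sum_le_sum hk).trans ?_
  rw [← Finset.mul_sum]
  have hcs := Finset.sum_mul_sq_le_sq_mul_sq (Finset.range K) (fun _ => (1 : ℝ))
    (fun k => √(∑ i, q k i * φ k i))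
  have h0 : ∀ k, 0 ≤ ∑ i, q k i * φ k i := fun k =>
    Finset.sum_nonneg fun i _ => mul_nonneg (hq k i) (hφ0 k i)
  simp only [one_mul, one_pow, Finset.sum_const, Finset.card_range, nsmul_eq_mul, mul_one,
    Real.sq_sqrt (h0 _)] at hcs
  apply Real.le_sqrt_of_sq_le
  rw [mul_pow, Real.sq_sqrt hGB]
  calc _ ≤ (G + B) * (K * (2 * (Fintype.card d * Real.log (Fintype.card d + K)))) := by
        gcongr
        exact hcs.trans (by gcongr)
    _ = _ := by ring

end Eluder

/-! ### The pigeonhole bound for a single cell -/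

section Tabular

/-- A pigeonhole bound: an error that is at most of order `U / n + √(B / n)` after total weight `n`
has a small weighted sum. -/
theorem sum_le_of_pigeonhole {K : ℕ} {P G : ℕ → ℝ} {U B : ℝ} (hP0 : ∀ k, 0 ≤ P k)
    (hP1 : ∀ k, P k ≤ 1) (hG2 : ∀ k, G k ≤ 2) (hU : 0 ≤ U)
    (hB : 0 ≤ B)
    (h : ∀ k < K, (∑ t ∈ Finset.range k, P t) * G k ≤ U + √(B * ∑ t ∈ Finset.range k, P t)) :
    ∑ k ∈ Finset.range K, P k * G k ≤
      6 * ((U + 1) * Real.log (1 + K / (U + 1))) +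
        3 * √(B * ((∑ k ∈ Finset.range K, P k) + 1)) := by
  set N : ℕ → ℝ := fun k => ∑ t ∈ Finset.range k, P t with hN
  have hN0 : ∀ k, 0 ≤ N k := fun k => Finset.sum_nonneg fun t _ => hP0 t
  have hNs : ∀ k, N (k + 1) = N k + P k := fun k => Finset.sum_range_succ _ _
  set U1 := U + 1
  have hU1 : 1 ≤ U1 := by simp only [U1]; linarith
  -- Adding 2 U1 to the hypothesis turns the prefactor N into N + U1, which also covers the rounds
  -- with little accumulated weight. The two resulting terms are then bounded by increments of log
  -- (N + U1) and √(N + 1), which telescope.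
  have hk : ∀ k ∈ Finset.range K, P k * G k ≤
      6 * U1 * (Real.log (N (k + 1) + U1) - Real.log (N k + U1)) +
        3 * √B * (√(N (k + 1) + 1) - √(N k + 1)) := by
    intro k hk
    have h1 := h k (Finset.mem_range.1 hk)
    have hpos : 0 < N k + U1 := by linarith [hN0 k]
    have hx0 : 0 ≤ P k / (N k + U1) := div_nonneg (hP0 k) hpos.le
    have hx1 : P k / (N k + U1) ≤ 1 := (div_le_one hpos).2 (by linarith [hN0 k, hP1 k])
    have hlog := le_two_mul_log_one_add hx0 hx1
    have e : 1 + P k / (N k + U1) = (N (k + 1) + U1) / (N k + U1) := by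
      rw [hNs]; field_simp; ring
    rw [e, Real.log_div (by linarith [hN0 (k + 1)]) hpos.ne'] at hlog
    have hG : G k ≤ (3 * U1 + √B * √(N k)) / (N k + U1) := by
      rw [le_div_iff₀ hpos, ← Real.sqrt_mul hB]
      have : G k * U1 ≤ 2 * U1 := mul_le_mul_of_nonneg_right (hG2 k) (by linarith)
      have hU2 : U ≤ U1 := by simp only [U1]; linarith
      change N k * G k ≤ U + √(B * N k) at h1
      nlinarith
    have hs1 : 1 ≤ √(N k + 1) := Real.one_le_sqrt.2 (by linarith [hN0 k])
    have hsq : √(N k) / (N k + U1) ≤ 1 / √(N k + 1) := by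
      rw [div_le_div_iff₀ hpos (by linarith)]
      have h2 : √(N k) ≤ √(N k + 1) := Real.sqrt_le_sqrt (by linarith)
      have h3 := Real.mul_self_sqrt (show 0 ≤ N k + 1 by linarith [hN0 k])
      nlinarith [Real.sqrt_nonneg (N k)]
    have hsq2 : P k / √(N k + 1) ≤ 3 * (√(N (k + 1) + 1) - √(N k + 1)) := by
      rw [div_le_iff₀ (by linarith)]
      have h3 := Real.mul_self_sqrt (show 0 ≤ N k + 1 by linarith [hN0 k])
      have h4 := Real.mul_self_sqrt (show 0 ≤ N (k + 1) + 1 by linarith [hN0 (k + 1)])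
      have h5 : √(N k + 1) ≤ √(N (k + 1) + 1) := Real.sqrt_le_sqrt (by linarith [hNs k, hP0 k])
      have h6 : √(N (k + 1) + 1) ≤ 2 * √(N k + 1) := by
        rw [Real.sqrt_le_left (by linarith)]
        nlinarith [hNs k, hP1 k, hN0 k]
      have h7 : P k = √(N (k + 1) + 1) * √(N (k + 1) + 1) - √(N k + 1) * √(N k + 1) := by
        rw [h3, h4, hNs]; ring
      nlinarith
    calc P k * G k ≤ P k * ((3 * U1 + √B * √(N k)) / (N k + U1)) :=
          mul_le_mul_of_nonneg_left hG (hP0 k)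
      _ = 3 * U1 * (P k / (N k + U1)) + √B * P k * (√(N k) / (N k + U1)) := by ring
      _ ≤ 3 * U1 * (2 * (Real.log (N (k + 1) + U1) - Real.log (N k + U1))) +
            √B * P k * (1 / √(N k + 1)) := by
          gcongr
          exact mul_nonneg (Real.sqrt_nonneg _) (hP0 k)
      _ = 6 * U1 * (Real.log (N (k + 1) + U1) - Real.log (N k + U1)) +
            √B * (P k / √(N k + 1)) := by ring
      _ ≤ 6 * U1 * (Real.log (N (k + 1) + U1) - Real.log (N k + U1)) +
            √B * (3 * (√(N (k + 1) + 1) - √(N k + 1))) := by gcongr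
      _ = _ := by ring
  refine (Finset.sum_le_sum hk).trans ?_
  rw [Finset.sum_add_distrib, ← Finset.mul_sum, ← Finset.mul_sum,
    Finset.sum_range_sub (fun k => Real.log (N k + U1)),
    Finset.sum_range_sub (fun k => √(N k + 1))]
  have hNK : N K ≤ K := by
    calc N K ≤ ∑ _t ∈ Finset.range K, (1 : ℝ) := Finset.sum_le_sum fun t _ => hP1 t
      _ = K := by simp
  have hN00 : N 0 = 0 := by simp [hN]
  rw [hN00]
  have e1 : Real.log (N K + U1) - Real.log (0 + U1) ≤ Real.log (1 + K / U1) := by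
    rw [zero_add, ← Real.log_div (by linarith [hN0 K]) (by linarith)]
    apply Real.log_le_log (div_pos (by linarith [hN0 K]) (by linarith))
    rw [add_div, div_self (by linarith), add_comm]
    gcongr
  have e2 : 3 * √B * (√(N K + 1) - √(0 + 1)) ≤ 3 * √(B * (N K + 1)) := by
    rw [Real.sqrt_mul hB, mul_assoc]
    gcongr
    simp
  have e3 := mul_le_mul_of_nonneg_left e1 (show 0 ≤ 6 * U1 by linarith)
  rw [← mul_assoc]
  exact add_le_add e3 e2

end Tabular

/-! ### Elementary inequalities for Hellinger distances -/

section Hellinger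

variable {ι : Type*} [Fintype ι]

/-- Equivalent to (2√a - √b)² ≥ 0. It moves the mass of an event between models at the price of a
constant factor and a squared, not a plain, Hellinger distance. -/
theorem le_two_mul_add_hell {a b : ℝ} (ha : 0 ≤ a) (hb : 0 ≤ b) :
    b ≤ 2 * a + 2 * (√a - √b) ^ 2 := by
  nlinarith [Real.sq_sqrt ha, Real.sq_sqrt hb, sq_nonneg (2 * √a - √b)]

theorem sum_sqrt_mul_le_sqrt {ω a b : ι → ℝ} (hω : ∀ i, 0 ≤ ω i) (ha : ∀ i, 0 ≤ a i)
    (hb : ∀ i, 0 ≤ b i) :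
    ∑ i, ω i * (√(a i) * √(b i)) ≤ √((∑ i, ω i * a i) * ∑ i, ω i * b i) := by
  apply Real.le_sqrt_of_sq_le
  have h := Finset.sum_mul_sq_le_sq_mul_sq Finset.univ (fun i => √(ω i * a i))
    (fun i => √(ω i * b i))
  simp only [Real.sq_sqrt (mul_nonneg (hω _) (ha _)),
    Real.sq_sqrt (mul_nonneg (hω _) (hb _))] at h
  refine le_trans (le_of_eq ?_) h
  congr 1
  refine Finset.sum_congr rfl fun i _ => ?_
  rw [Real.sqrt_mul (hω i), Real.sqrt_mul (hω i), mul_mul_mul_comm, Real.mul_self_sqrt (hω i)]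

/-- Use |a - b| ≤ (√a - √b)² + 2 |√a - √b| √b and Cauchy–Schwarz. Keeping the mass of `b` under the
root lets the error scale with the probability of the history. -/
theorem sum_abs_sub_le_hell {ω a b : ι → ℝ} (hω : ∀ i, 0 ≤ ω i) (ha : ∀ i, 0 ≤ a i)
    (hb : ∀ i, 0 ≤ b i) :
    ∑ i, ω i * |a i - b i| ≤ (∑ i, ω i * (√(a i) - √(b i)) ^ 2) +
      2 * √((∑ i, ω i * (√(a i) - √(b i)) ^ 2) * ∑ i, ω i * b i) := by
  have h1 := sum_sqrt_mul_le_sqrt hω (fun i => sq_nonneg (√(a i) - √(b i))) hb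
  calc _ ≤ ∑ i, (ω i * (√(a i) - √(b i)) ^ 2 +
          2 * (ω i * (√((√(a i) - √(b i)) ^ 2) * √(b i)))) := by
        refine Finset.sum_le_sum fun i _ => ?_
        rw [Real.sqrt_sq_eq_abs]
        have : |a i - b i| ≤ (√(a i) - √(b i)) ^ 2 + 2 * (|√(a i) - √(b i)| * √(b i)) := by
          have e : a i - b i = (√(a i) - √(b i)) * (√(a i) + √(b i)) := by
            nlinarith [Real.mul_self_sqrt (ha i), Real.mul_self_sqrt (hb i)]
          rw [e, abs_mul, ← sq_abs (√(a i) - √(b i)),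
            abs_of_nonneg (add_nonneg (Real.sqrt_nonneg (a i)) (Real.sqrt_nonneg (b i)))]
          nlinarith [abs_nonneg (√(a i) - √(b i)), le_abs_self (√(a i) - √(b i))]
        nlinarith [hω i]
    _ ≤ _ := by
        rw [Finset.sum_add_distrib, ← Finset.mul_sum]
        linarith

/-- Hellinger distances decrease under coarse-graining. -/
theorem hell_sum_le {ω a b : ι → ℝ} (hω : ∀ i, 0 ≤ ω i) (ha : ∀ i, 0 ≤ a i)
    (hb : ∀ i, 0 ≤ b i) :
    (√(∑ i, ω i * a i) - √(∑ i, ω i * b i)) ^ 2 ≤ ∑ i, ω i * (√(a i) - √(b i)) ^ 2 := by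
  have h1 := sum_sqrt_mul_le_sqrt hω ha hb
  have hA : 0 ≤ ∑ i, ω i * a i := Finset.sum_nonneg fun i _ => mul_nonneg (hω i) (ha i)
  have hB : 0 ≤ ∑ i, ω i * b i := Finset.sum_nonneg fun i _ => mul_nonneg (hω i) (hb i)
  rw [Real.sqrt_mul hA] at h1
  have h2 : ∑ i, ω i * (√(a i) - √(b i)) ^ 2 =
      (∑ i, ω i * a i) + (∑ i, ω i * b i) - 2 * ∑ i, ω i * (√(a i) * √(b i)) := by
    rw [Finset.mul_sum, ← Finset.sum_add_distrib, ← Finset.sum_sub_distrib]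
    refine Finset.sum_congr rfl fun i _ => ?_
    rw [sub_sq, Real.sq_sqrt (ha i), Real.sq_sqrt (hb i)]; ring
  rw [h2, sub_sq, Real.sq_sqrt hA, Real.sq_sqrt hB]
  linarith

/-- If q < D₁ + D₂, the bound f ≤ 4 suffices. Otherwise the linear terms are dominated by the roots,
so q f ≤ 8 √((D₁ + D₂) q); square and divide by q. -/
theorem mul_sq_le_of_hell {q f D₁ D₂ : ℝ} (hq : 0 ≤ q) (hf : 0 ≤ f) (hf4 : f ≤ 4) (h₁ : 0 ≤ D₁)
    (h₂ : 0 ≤ D₂)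
    (h : q * f ≤ 2 * (D₁ + 2 * √(D₁ * q)) + 2 * (D₂ + 2 * √(D₂ * q))) :
    q * f ^ 2 ≤ 64 * (D₁ + D₂) := by
  rcases lt_or_ge q (D₁ + D₂) with hlt | hge
  · have : q * f ^ 2 ≤ q * 16 := by gcongr; nlinarith
    linarith
  rcases hq.eq_or_lt with rfl | hq0
  · simp; linarith
  set r := √((D₁ + D₂) * q) with hr
  have hr0 : 0 ≤ r := Real.sqrt_nonneg _
  have hr2 : r ^ 2 = (D₁ + D₂) * q := Real.sq_sqrt (by positivity)
  have h3 : √(D₁ * q) ^ 2 = D₁ * q := Real.sq_sqrt (by positivity)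
  have h4 : √(D₂ * q) ^ 2 = D₂ * q := Real.sq_sqrt (by positivity)
  have h5 : D₁ + D₂ ≤ r := Real.le_sqrt_of_sq_le (by nlinarith)
  have h6 : √(D₁ * q) + √(D₂ * q) ≤ 3 / 2 * r := by
    apply le_of_sq_le_sq _ (by positivity)
    nlinarith [sq_nonneg (√(D₁ * q) - √(D₂ * q))]
  have h7 : q * f ≤ 8 * r := by linarith
  have h8 : (q * f) ^ 2 ≤ (8 * r) ^ 2 := pow_le_pow_left₀ (by positivity) h7 2
  rw [mul_pow 8, hr2] at h8
  have h9 : q * (q * f ^ 2) ≤ q * (64 * (D₁ + D₂)) := by nlinarith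
  exact le_of_mul_le_mul_left h9 hq0

end Hellinger

/-! ### Transferring latent laws between models through the future decoder -/

section Transfer

variable {L : ℕ} {S A : Type*} [Fintype S] [Fintype A]

/-- The law of the future decoder of `θ` in the instance `m` of `θs`. -/
def crossDec (θ θs : LMDP L S A) (κ : ActionKernel S A) (s : S) (k : ℕ) (l m : Fin L) : ℝ :=
  ∑ y : Fin k → S × A, ∑ t, actWeight κ k y *
    (if θ.futDec s k y t = l then θs.fut m s k y t else 0)

/-- The law of the future decoder, corrected by the inverse of the confusion matrix. -/
def transfer (θ θs : LMDP L S A) (κ : ActionKernel S A) (s : S) (k : ℕ) (l m : Fin L) : ℝ :=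
  ∑ i, (θ.confusion κ s k)⁻¹ l i * crossDec θ θs κ s k i m

/-- The difference between the latent law under `θ` and the transferred latent law under `θs`. -/
def latentDiff (θ θs : LMDP L S A) (κ : ActionKernel S A) (j : ℕ) (τ : Fin j → S × A) (s : S)
    (k : ℕ) (l : Fin L) : ℝ :=
  θ.pre j τ s l - ∑ m, θs.pre j τ s m * transfer θ θs κ s k l m

/-- The `ℓ¹` distance of the laws of the futures of a given history. -/
def futDist (θ θs : LMDP L S A) (κ : ActionKernel S A) (j : ℕ) (τ : Fin j → S × A) (s : S)
    (k : ℕ) : ℝ :=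
  ∑ y : Fin k → S × A, ∑ t, actWeight κ k y * |θ.preFut j τ s k y t - θs.preFut j τ s k y t|

/-- The coefficients of the one-step error of the transferred latent law. -/
def stepCoeff (θ θs : LMDP L S A) (κ : ActionKernel S A) (s : S) (a : A) (k : ℕ) (t : S)
    (l m : Fin L) : ℝ :=
  transfer θ θs κ s (k + 1) l m * θ.ker l s a t - θs.ker m s a t * transfer θ θs κ t k l m

/-- The `ℓ¹` norm of the one-step error of the transferred latent law. -/
def stepErr (θ θs : LMDP L S A) (κ : ActionKernel S A) (s : S) (a : A) (k : ℕ)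
    (x : Fin L → ℝ) : ℝ :=
  ∑ s', ∑ l, |∑ m, x m * stepCoeff θ θs κ s a k s' l m|

variable {κ : ActionKernel S A} {θ θs : LMDP L S A} {δ : ℝ}

theorem crossDec_nonneg (hκ : κ.IsProb) (s : S) (k : ℕ) (l m : Fin L) :
    0 ≤ crossDec θ θs κ s k l m := by
  refine Finset.sum_nonneg fun _ _ => Finset.sum_nonneg fun _ _ =>
    mul_nonneg (actWeight_nonneg hκ _ _) ?_
  split_ifs
  · exact θs.fut_nonneg _ _ _ _ _
  · exact le_rfl

theorem sum_crossDec (hκ : κ.IsProb) (s : S) (k : ℕ) (m : Fin L) :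
    ∑ l, crossDec θ θs κ s k l m = 1 := by
  unfold crossDec
  rw [← Finset.sum_comm_cycle, ← θs.sum_fut hκ m s k]
  refine Finset.sum_congr rfl fun y _ => Finset.sum_congr rfl fun s' _ => ?_
  simp

theorem sum_futDec_preFut_self (κ : ActionKernel S A) (j : ℕ) (τ : Fin j → S × A) (s : S) (k : ℕ)
    (l : Fin L) :
    ∑ y : Fin k → S × A, ∑ s', actWeight κ k y * (if θ.futDec s k y s' = l then
      θ.preFut j τ s k y s' else 0) = ∑ l', θ.confusion κ s k l l' * θ.pre j τ s l' := by
  calc _ = ∑ y : Fin k → S × A, ∑ s', ∑ m, actWeight κ k y *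
          (if θ.futDec s k y s' = l then θ.fut m s k y s' else 0) * θ.pre j τ s m := by
        refine Finset.sum_congr rfl fun y _ => Finset.sum_congr rfl fun s' _ => ?_
        split_ifs
        · rw [LMDP.preFut, Finset.mul_sum]
          exact Finset.sum_congr rfl fun m _ => by ring
        · simp
    _ = _ := by
        rw [Finset.sum_comm_cycle]
        refine Finset.sum_congr rfl fun m _ => ?_
        by_cases hm : 0 < θ.mix m
        · simp only [LMDP.confusion, hm, if_true, Finset.sum_mul]
        · simp [θ.pre_eq_zero (le_antisymm (not_lt.1 hm) (stdSimplex.zero_le _ _))]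

theorem sum_futDec_preFut (κ : ActionKernel S A) (j : ℕ) (τ : Fin j → S × A) (s : S) (k : ℕ)
    (l : Fin L) :
    ∑ y : Fin k → S × A, ∑ s', actWeight κ k y * (if θ.futDec s k y s' = l then
      θs.preFut j τ s k y s' else 0) = ∑ m, θs.pre j τ s m * crossDec θ θs κ s k l m := by
  simp only [crossDec, Finset.mul_sum]
  rw [← Finset.sum_comm_cycle]
  refine Finset.sum_congr rfl fun y _ => Finset.sum_congr rfl fun s' _ => ?_
  split_ifs
  · rw [LMDP.preFut, Finset.mul_sum]
    exact Finset.sum_congr rfl fun m _ => by ring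
  · simp

/-- Under θ, the inverse confusion matrix takes the law of the decoder back to the latent law; under
θs, it gives the transferred law. So the difference is the inverse matrix applied to a difference of
two observable laws. -/
theorem latentDiff_eq (hδ : 0 ≤ δ) (hθ : θ.StronglySeparated δ) (hκ : κ.IsProb) (j : ℕ)
    (τ : Fin j → S × A) (s : S) (k : ℕ) (hη : L * Real.exp (-(δ ^ 2 / 2)) ^ k ≤ 1 / 4)
    (l : Fin L) :
    latentDiff θ θs κ j τ s k l = ∑ l', (θ.confusion κ s k)⁻¹ l l' *
      ∑ y : Fin k → S × A, ∑ s', actWeight κ k y * (if θ.futDec s k y s' = l' then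
        θ.preFut j τ s k y s' - θs.preFut j τ s k y s' else 0) := by
  have hu := (Matrix.isUnit_iff_isUnit_det _).1 (isUnit_confusion hδ hθ hκ s k hη)
  have h1 := sum_futDec_preFut_self (θ := θ) κ j τ s k
  have h2 := sum_futDec_preFut (θ := θ) (θs := θs) κ j τ s k
  have h3 : ∀ l', ∑ y : Fin k → S × A, ∑ s', actWeight κ k y * (if θ.futDec s k y s' = l' then
        θ.preFut j τ s k y s' - θs.preFut j τ s k y s' else 0) =
      (∑ l'', θ.confusion κ s k l' l'' * θ.pre j τ s l'') -
        ∑ m, θs.pre j τ s m * crossDec θ θs κ s k l' m := by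
    intro l'
    rw [← h1, ← h2]
    simp only [← Finset.sum_sub_distrib, ← mul_sub]
    refine Finset.sum_congr rfl fun y _ => Finset.sum_congr rfl fun s' _ => ?_
    split_ifs <;> simp
  simp only [h3, mul_sub, Finset.sum_sub_distrib]
  rw [latentDiff]
  congr 1
  · have : ((θ.confusion κ s k)⁻¹.mulVec ((θ.confusion κ s k).mulVec (θ.pre j τ s))) l =
        θ.pre j τ s l := by
      rw [Matrix.mulVec_mulVec, Matrix.nonsing_inv_mul _ hu, Matrix.one_mulVec]
    exact this.symm
  · simp only [transfer, Finset.mul_sum]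
    rw [Finset.sum_comm]
    exact Finset.sum_congr rfl fun l' _ => Finset.sum_congr rfl fun m _ => by ring

theorem sum_abs_latentDiff_le (hδ : 0 ≤ δ) (hθ : θ.StronglySeparated δ) (hκ : κ.IsProb) (j : ℕ)
    (τ : Fin j → S × A) (s : S) (k : ℕ) (hη : L * Real.exp (-(δ ^ 2 / 2)) ^ k ≤ 1 / 4) :
    ∑ l, |latentDiff θ θs κ j τ s k l| ≤ 2 * futDist θ θs κ j τ s k := by
  set D : Fin L → ℝ := fun l' => ∑ y : Fin k → S × A, ∑ s', actWeight κ k y *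
    (if θ.futDec s k y s' = l' then θ.preFut j τ s k y s' - θs.preFut j τ s k y s' else 0) with hD
  have hsum : ∑ l', |D l'| ≤ futDist θ θs κ j τ s k := by
    calc _ ≤ ∑ l', ∑ y : Fin k → S × A, ∑ s', actWeight κ k y *
          (if θ.futDec s k y s' = l' then |θ.preFut j τ s k y s' - θs.preFut j τ s k y s'| else 0) := by
          refine Finset.sum_le_sum fun l' _ => (Finset.abs_sum_le_sum_abs _ _).trans
            (Finset.sum_le_sum fun y _ => (Finset.abs_sum_le_sum_abs _ _).trans
              (Finset.sum_le_sum fun s' _ => le_of_eq ?_))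
          rw [abs_mul, abs_of_nonneg (actWeight_nonneg hκ _ _), apply_ite abs, abs_zero]
      _ = _ := by
          rw [← Finset.sum_comm_cycle]
          refine Finset.sum_congr rfl fun y _ => Finset.sum_congr rfl fun s' _ => ?_
          simp
  calc _ = ∑ l, |∑ l', (θ.confusion κ s k)⁻¹ l l' * D l'| :=
        Finset.sum_congr rfl fun l _ => by rw [latentDiff_eq hδ hθ hκ j τ s k hη l]
    _ ≤ ∑ l, ∑ l', |(θ.confusion κ s k)⁻¹ l l'| * |D l'| :=
        Finset.sum_le_sum fun l _ => (Finset.abs_sum_le_sum_abs _ _).trans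
          (le_of_eq (Finset.sum_congr rfl fun l' _ => abs_mul _ _))
    _ = ∑ l', (∑ l, |(θ.confusion κ s k)⁻¹ l l'|) * |D l'| := by
        rw [Finset.sum_comm]
        exact Finset.sum_congr rfl fun l' _ => (Finset.sum_mul _ _ _).symm
    _ ≤ ∑ l', 2 * |D l'| := by
        gcongr with l' _
        exact sum_abs_confusion_inv_le hδ hθ hκ s k hη l'
    _ ≤ _ := by rw [← Finset.mul_sum]; gcongr

theorem sum_abs_transfer_le (hδ : 0 ≤ δ) (hθ : θ.StronglySeparated δ) (hκ : κ.IsProb)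
    (s : S) (k : ℕ) (hη : L * Real.exp (-(δ ^ 2 / 2)) ^ k ≤ 1 / 4) (m : Fin L) :
    ∑ l, |transfer θ θs κ s k l m| ≤ 2 := by
  calc _ ≤ ∑ l, ∑ l', |(θ.confusion κ s k)⁻¹ l l'| * crossDec θ θs κ s k l' m := by
        refine Finset.sum_le_sum fun l _ => (Finset.abs_sum_le_sum_abs _ _).trans
          (le_of_eq (Finset.sum_congr rfl fun l' _ => ?_))
        rw [abs_mul, abs_of_nonneg (crossDec_nonneg hκ _ _ _ _)]
    _ = ∑ l', (∑ l, |(θ.confusion κ s k)⁻¹ l l'|) * crossDec θ θs κ s k l' m := by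
        rw [Finset.sum_comm]
        exact Finset.sum_congr rfl fun l' _ => (Finset.sum_mul _ _ _).symm
    _ ≤ ∑ l', 2 * crossDec θ θs κ s k l' m := by
        gcongr with l' _
        · exact crossDec_nonneg hκ _ _ _ _
        · exact sum_abs_confusion_inv_le hδ hθ hκ s k hη l'
    _ = 2 := by rw [← Finset.mul_sum, sum_crossDec hκ, mul_one]

/-- The old difference is propagated by the kernels of θ. The new error is linear in the latent law
of θs, with coefficients that depend on the history only through its current state; this is what
confines the learning problem to dimension L S. -/
theorem latentDiff_snoc (j : ℕ) (τ : Fin j → S × A) (s : S) (a : A) (s' : S) (k : ℕ) (l : Fin L) :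
    latentDiff θ θs κ (j + 1) (Fin.snoc τ (s, a)) s' k l =
      latentDiff θ θs κ j τ s (k + 1) l * θ.ker l s a s' +
        ∑ m, θs.pre j τ s m * stepCoeff θ θs κ s a k s' l m := by
  simp only [latentDiff, stepCoeff, LMDP.pre_snoc, sub_mul, Finset.sum_mul, mul_sub,
    Finset.sum_sub_distrib]
  have e1 : ∀ m, θs.pre j τ s m * θs.ker m s a s' * transfer θ θs κ s' k l m =
    θs.pre j τ s m * (θs.ker m s a s' * transfer θ θs κ s' k l m) := fun m => by ring
  have e2 : ∀ m, θs.pre j τ s m * transfer θ θs κ s (k + 1) l m * θ.ker l s a s' =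
    θs.pre j τ s m * (transfer θ θs κ s (k + 1) l m * θ.ker l s a s') := fun m => by ring
  simp only [e1, e2]
  ring

theorem sum_abs_latentDiff_mul_ker (j : ℕ) (τ : Fin j → S × A) (s : S) (a : A) (k : ℕ) :
    ∑ s', ∑ l, |latentDiff θ θs κ j τ s k l * θ.ker l s a s'| =
      ∑ l, |latentDiff θ θs κ j τ s k l| := by
  rw [Finset.sum_comm]
  refine Finset.sum_congr rfl fun l _ => ?_
  simp only [abs_mul, abs_of_nonneg (θ.ker_nonneg _ _ _ _)]
  rw [← Finset.mul_sum, θ.sum_ker, mul_one]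

theorem sum_abs_latentDiff_snoc_le (j : ℕ) (τ : Fin j → S × A) (s : S) (a : A) (k : ℕ) :
    ∑ s', ∑ l, |latentDiff θ θs κ (j + 1) (Fin.snoc τ (s, a)) s' k l| ≤
      (∑ l, |latentDiff θ θs κ j τ s (k + 1) l|) + stepErr θ θs κ s a k (θs.pre j τ s) := by
  rw [← sum_abs_latentDiff_mul_ker (θ := θ) (θs := θs) (κ := κ) j τ s a, stepErr]
  simp only [← Finset.sum_add_distrib]
  refine Finset.sum_le_sum fun s' _ => Finset.sum_le_sum fun l _ => ?_
  rw [latentDiff_snoc]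
  exact abs_add_le _ _

/-- `latentDiff_snoc` read backwards: the one-step error is a combination of two latent differences,
and both are controlled by laws of futures. -/
theorem stepErr_pre_le (hδ : 0 ≤ δ) (hθ : θ.StronglySeparated δ) (hκ : κ.IsProb) (j : ℕ)
    (τ : Fin j → S × A) (s : S) (a : A) (k : ℕ)
    (hη : L * Real.exp (-(δ ^ 2 / 2)) ^ k ≤ 1 / 4)
    (hη' : L * Real.exp (-(δ ^ 2 / 2)) ^ (k + 1) ≤ 1 / 4) :
    stepErr θ θs κ s a k (θs.pre j τ s) ≤ 2 * futDist θ θs κ j τ s (k + 1) +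
      2 * ∑ s', futDist θ θs κ (j + 1) (Fin.snoc τ (s, a)) s' k := by
  calc _ ≤ (∑ s', ∑ l, |latentDiff θ θs κ j τ s (k + 1) l * θ.ker l s a s'|) +
        ∑ s', ∑ l, |latentDiff θ θs κ (j + 1) (Fin.snoc τ (s, a)) s' k l| := by
        rw [stepErr]
        simp only [← Finset.sum_add_distrib]
        refine Finset.sum_le_sum fun s' _ => Finset.sum_le_sum fun l _ => ?_
        rw [← sub_eq_iff_eq_add'.2 (latentDiff_snoc (θ := θ) (θs := θs) (κ := κ) j τ s a s' k l),
          add_comm |latentDiff θ θs κ j τ s (k + 1) l * θ.ker l s a s'|]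
        exact abs_sub _ _
    _ ≤ _ := by
        rw [sum_abs_latentDiff_mul_ker, Finset.mul_sum]
        exact add_le_add (sum_abs_latentDiff_le hδ hθ hκ j τ s _ hη')
          (Finset.sum_le_sum fun s' _ => sum_abs_latentDiff_le hδ hθ hκ _ _ s' _ hη)

theorem sum_abs_stepCoeff_le (hδ : 0 ≤ δ) (hθ : θ.StronglySeparated δ) (hκ : κ.IsProb)
    (s : S) (a : A) (k : ℕ) (hη : L * Real.exp (-(δ ^ 2 / 2)) ^ k ≤ 1 / 4)
    (hη' : L * Real.exp (-(δ ^ 2 / 2)) ^ (k + 1) ≤ 1 / 4) (m : Fin L) :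
    ∑ s', ∑ l, |stepCoeff θ θs κ s a k s' l m| ≤ 4 := by
  calc _ ≤ ∑ s', ∑ l, (|transfer θ θs κ s (k + 1) l m| * θ.ker l s a s' +
          θs.ker m s a s' * |transfer θ θs κ s' k l m|) := by
        refine Finset.sum_le_sum fun s' _ => Finset.sum_le_sum fun l _ => ?_
        refine (abs_sub _ _).trans (le_of_eq ?_)
        rw [abs_mul, abs_mul, abs_of_nonneg (θ.ker_nonneg _ _ _ _),
          abs_of_nonneg (θs.ker_nonneg _ _ _ _)]
    _ = (∑ l, |transfer θ θs κ s (k + 1) l m|) +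
          ∑ s', θs.ker m s a s' * ∑ l, |transfer θ θs κ s' k l m| := by
        simp only [Finset.sum_add_distrib, Finset.mul_sum]
        congr 1
        rw [Finset.sum_comm]
        exact Finset.sum_congr rfl fun l _ => by rw [← Finset.mul_sum, θ.sum_ker, mul_one]
    _ ≤ 2 + ∑ s', θs.ker m s a s' * 2 := by
        refine add_le_add (sum_abs_transfer_le hδ hθ hκ s _ hη' m)
          (Finset.sum_le_sum fun s' _ => ?_)
        exact mul_le_mul_of_nonneg_left (sum_abs_transfer_le hδ hθ hκ s' _ hη m)
          (θs.ker_nonneg _ _ _ _)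
    _ = 4 := by rw [← Finset.sum_mul, θs.sum_ker]; norm_num

theorem futDist_le_hell (hκ : κ.IsProb) (j : ℕ) (τ : Fin j → S × A) (s : S) (k : ℕ) :
    futDist θ θs κ j τ s k ≤ hellFut κ θ θs j τ s k +
      2 * √(hellFut κ θ θs j τ s k * θs.obs j τ s) := by
  have h := sum_abs_sub_le_hell (ι := (Fin k → S × A) × S) (ω := fun x => actWeight κ k x.1)
    (a := fun x => θ.preFut j τ s k x.1 x.2) (b := fun x => θs.preFut j τ s k x.1 x.2)
    (fun x => actWeight_nonneg hκ _ _) (fun x => θ.preFut_nonneg _ _ _ _ _ _)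
    (fun x => θs.preFut_nonneg _ _ _ _ _ _)
  simp only [Fintype.sum_prod_type, θs.sum_preFut hκ] at h
  exact h

theorem sum_futDist_snoc_le_hell (hκ : κ.IsProb) (j : ℕ) (τ : Fin j → S × A) (s : S) (a : A)
    (k : ℕ) :
    ∑ s', futDist θ θs κ (j + 1) (Fin.snoc τ (s, a)) s' k ≤
      (∑ s', hellFut κ θ θs (j + 1) (Fin.snoc τ (s, a)) s' k) +
        2 * √((∑ s', hellFut κ θ θs (j + 1) (Fin.snoc τ (s, a)) s' k) * θs.obs j τ s) := by
  have h := sum_abs_sub_le_hell (ι := S × (Fin k → S × A) × S) (ω := fun x => actWeight κ k x.2.1)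
    (a := fun x => θ.preFut (j + 1) (Fin.snoc τ (s, a)) x.1 k x.2.1 x.2.2)
    (b := fun x => θs.preFut (j + 1) (Fin.snoc τ (s, a)) x.1 k x.2.1 x.2.2)
    (fun x => actWeight_nonneg hκ _ _) (fun x => θ.preFut_nonneg _ _ _ _ _ _)
    (fun x => θs.preFut_nonneg _ _ _ _ _ _)
  simp only [Fintype.sum_prod_type, θs.sum_preFut hκ, θs.sum_obs_snoc] at h
  exact h

end Transfer

/-! ### Learning the one-step errors -/

section Posterior

variable {L n : ℕ} {S A : Type*} [Fintype S]

/-- The posterior distribution of the latent index given a history. -/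
def LMDP.post (θ : LMDP L S A) (j : ℕ) (τ : Fin j → S × A) (s : S) (m : Fin L) : ℝ :=
  θ.pre j τ s m / θ.obs j τ s

theorem LMDP.post_nonneg (θ : LMDP L S A) (j : ℕ) (τ : Fin j → S × A) (s : S) (m : Fin L) :
    0 ≤ θ.post j τ s m := div_nonneg (θ.pre_nonneg _ _ _ _) (θ.obs_nonneg _ _ _)

theorem LMDP.post_le_one (θ : LMDP L S A) (j : ℕ) (τ : Fin j → S × A) (s : S) (m : Fin L) :
    θ.post j τ s m ≤ 1 := div_le_one_of_le₀ (θ.pre_le_obs _ _ _ _) (θ.obs_nonneg _ _ _)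

theorem LMDP.sum_post_le_one (θ : LMDP L S A) (j : ℕ) (τ : Fin j → S × A) (s : S) :
    ∑ m, θ.post j τ s m ≤ 1 := by
  simp only [LMDP.post, ← Finset.sum_div]
  exact div_self_le_one _

theorem LMDP.obs_mul_post (θ : LMDP L S A) (j : ℕ) (τ : Fin j → S × A) (s : S) (m : Fin L) :
    θ.obs j τ s * θ.post j τ s m = θ.pre j τ s m := by
  by_cases h : θ.obs j τ s = 0
  · rw [h, zero_mul]
    exact le_antisymm (θ.pre_nonneg _ _ _ _) (h ▸ θ.pre_le_obs _ _ _ _)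
  · exact mul_div_cancel₀ _ h

variable [Fintype A] {κ : ActionKernel S A} {θ θs : LMDP L S A}

theorem stepErr_nonneg (s : S) (a : A) (k : ℕ) (x : Fin L → ℝ) :
    0 ≤ stepErr θ θs κ s a k x :=
  Finset.sum_nonneg fun _ _ => Finset.sum_nonneg fun _ _ => abs_nonneg _

theorem stepErr_pre (j : ℕ) (τ : Fin j → S × A) (s : S) (a : A) (k : ℕ) :
    stepErr θ θs κ s a k (θs.pre j τ s) =
      θs.obs j τ s * stepErr θ θs κ s a k (θs.post j τ s) := by
  simp only [stepErr, Finset.mul_sum]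
  refine Finset.sum_congr rfl fun s' _ => Finset.sum_congr rfl fun l _ => ?_
  have h : ∑ m, θs.pre j τ s m * stepCoeff θ θs κ s a k s' l m =
      θs.obs j τ s * ∑ m, θs.post j τ s m * stepCoeff θ θs κ s a k s' l m := by
    simp only [Finset.mul_sum, ← mul_assoc, LMDP.obs_mul_post]
  rw [h, abs_mul, abs_of_nonneg (θs.obs_nonneg j τ s)]

theorem ActionKernel.IsProb.le_one (hκ : κ.IsProb) (n : ℕ) (τ : Fin n → S × A) (s : S) (a : A) :
    κ n τ s a ≤ 1 := by
  rw [← hκ.sum_eq_one n τ s]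
  exact Finset.single_le_sum (f := fun a => κ n τ s a) (fun a _ => hκ.nonneg _ _ _ _)
    (Finset.mem_univ a)

variable [Nonempty A]

theorem sum_hellFut_snoc_eq (πexp π : Policy (n + 1) S A) {j k : ℕ} (hn : j + 1 + k = n)
    (θ θ' : LMDP L S A) :
    ∑ τ : Fin j → S × A, ∑ s, actWeight π.ext j τ *
        ∑ a, ∑ s', hellFut πexp.ext θ θ' (j + 1) (Fin.snoc τ (s, a)) s' k =
      Fintype.card A * hellSq (Policy.phi πexp (j + 1) π).ext n θ θ' := by
  rw [hellSq_phi_succ πexp π hn, ← mul_assoc, mul_one_div_cancel, one_mul]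
  simp

/-- The data have a uniform action just before the future starts, here it is an action of `π`.
Bounding its probability by 1 costs the factor `|A|`. -/
theorem sum_hellFut_le (πexp π : Policy (n + 1) S A) {j k : ℕ} (hn : j + k = n)
    (θ θ' : LMDP L S A) :
    ∑ τ : Fin j → S × A, ∑ s, actWeight π.ext j τ * hellFut πexp.ext θ θ' j τ s k ≤
      Fintype.card A * hellSq (Policy.phi πexp j π).ext n θ θ' := by
  have hA : (1 : ℝ) ≤ Fintype.card A := by exact_mod_cast Fintype.card_pos
  cases j with
  | zero =>
    obtain rfl : k = n := by omega
    rw [hellSq_phi_zero, Fintype.sum_unique]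
    simp only [actWeight_zero, one_mul]
    rw [Subsingleton.elim (default : Fin 0 → S × A) Fin.elim0]
    refine le_mul_of_one_le_left (Finset.sum_nonneg fun s _ => ?_) hA
    exact hellFut_nonneg πexp.ext_isProb _ _ _ _ _ _
  | succ j =>
    rw [← sum_hellFut_snoc_eq πexp π hn, sum_snoc]
    refine Finset.sum_le_sum fun τ _ => Finset.sum_le_sum fun s _ => ?_
    simp only [Finset.mul_sum]
    refine Finset.sum_le_sum fun a _ => Finset.sum_le_sum fun s' _ => ?_
    rw [actWeight_snoc]
    refine mul_le_mul_of_nonneg_right ?_ (hellFut_nonneg πexp.ext_isProb _ _ _ _ _ _)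
    exact mul_le_of_le_one_right (actWeight_nonneg π.ext_isProb _ _)
      (π.ext_isProb.le_one _ _ _ _)

/-- Passing to the posterior separates the probability of the history from the error. The squared
error, weighted by this probability, is then of first order in the squared Hellinger terms: the
in-sample bound that the potential lemma asks for. -/
theorem obs_mul_stepErr_sq_le {δ : ℝ} (hδ : 0 ≤ δ) (hθ : θ.StronglySeparated δ) (hκ : κ.IsProb)
    (j : ℕ) (τ : Fin j → S × A) (s : S) (a : A) (k : ℕ)
    (hη : L * Real.exp (-(δ ^ 2 / 2)) ^ k ≤ 1 / 4)
    (hη' : L * Real.exp (-(δ ^ 2 / 2)) ^ (k + 1) ≤ 1 / 4) :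
    θs.obs j τ s * stepErr θ θs κ s a k (θs.post j τ s) ^ 2 ≤
      64 * (hellFut κ θ θs j τ s (k + 1) +
        ∑ s', hellFut κ θ θs (j + 1) (Fin.snoc τ (s, a)) s' k) := by
  refine mul_sq_le_of_hell (θs.obs_nonneg _ _ _) (stepErr_nonneg _ _ _ _) ?_
    (hellFut_nonneg hκ _ _ _ _ _ _) (Finset.sum_nonneg fun s' _ => hellFut_nonneg hκ _ _ _ _ _ _) ?_
  · calc _ ≤ ∑ s', ∑ l, ∑ m, θs.post j τ s m * |stepCoeff θ θs κ s a k s' l m| := by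
          refine Finset.sum_le_sum fun s' _ => Finset.sum_le_sum fun l _ =>
            (Finset.abs_sum_le_sum_abs _ _).trans (le_of_eq ?_)
          refine Finset.sum_congr rfl fun m _ => ?_
          rw [abs_mul, abs_of_nonneg (θs.post_nonneg _ _ _ _)]
      _ = ∑ m, θs.post j τ s m * ∑ s', ∑ l, |stepCoeff θ θs κ s a k s' l m| := by
          rw [Finset.sum_comm_cycle]
          simp only [Finset.mul_sum]
      _ ≤ ∑ m, θs.post j τ s m * 4 := by
          refine Finset.sum_le_sum fun m _ => mul_le_mul_of_nonneg_left ?_ (θs.post_nonneg _ _ _ _)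
          exact sum_abs_stepCoeff_le hδ hθ hκ s a k hη hη' m
      _ ≤ 4 := by
          rw [← Finset.sum_mul]
          linarith [θs.sum_post_le_one j τ s]
  · rw [← stepErr_pre]
    refine (stepErr_pre_le hδ hθ hκ j τ s a k hη hη').trans ?_
    gcongr
    · exact futDist_le_hell hκ j τ s (k + 1)
    · exact sum_futDist_snoc_le_hell hκ j τ s a k

theorem sum_sign_mul {ι : Type*} (t : Finset ι) (x : ι → ℝ) :
    ∑ i ∈ t, (SignType.sign (x i) : ℝ) * x i = ∑ i ∈ t, |x i| :=
  Finset.sum_congr rfl fun i _ => sign_mul_self (x i)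

/-- The one-step errors of the transferred latent laws are learned. -/
theorem sum_stepErr_le (πexp : Policy (n + 1) S A) (π : ℕ → Policy (n + 1) S A)
    (θ : ℕ → LMDP L S A) (θs : LMDP L S A) {δ : ℝ} (hδ : 0 ≤ δ)
    (hθ : ∀ r, (θ r).StronglySeparated δ) {j k K : ℕ} (hn : j + 1 + k = n)
    (hη : L * Real.exp (-(δ ^ 2 / 2)) ^ k ≤ 1 / 4)
    (hη' : L * Real.exp (-(δ ^ 2 / 2)) ^ (k + 1) ≤ 1 / 4) {h₀ : ℝ} (h₀0 : 0 ≤ h₀)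
    (hh : ∀ r < K, ∀ i ≤ n,
      ∑ t ∈ Finset.range r, hellSq (Policy.phi πexp i (π t)).ext n (θ r) θs ≤ h₀) :
    ∑ r ∈ Finset.range K, ∑ τ : Fin j → S × A, ∑ s, actWeight (π r).ext j τ *
        ∑ a, (π r).ext j τ s a * stepErr (θ r) θs πexp.ext s a k (θs.pre j τ s) ≤
      √(K * ((16 * L + 128 * Fintype.card A * h₀) * (2 * ((L * Fintype.card S) *
        Real.log (L * Fintype.card S + K))))) := by
  classical
  have hκ := πexp.ext_isProb
  set E : ℕ → (Fin j → S × A) × S → A → (Fin L → ℝ) → ℝ :=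
    fun r i a x => stepErr (θ r) θs πexp.ext i.2 a k x with hE
  -- The worst action makes the error dominate its average under `π`. It also guarantees that the
  -- action chosen at one history is no worse than the maximizer at another.
  have hact : ∀ r (i : (Fin j → S × A) × S), ∃ a, ∀ b,
      E r i b (θs.post j i.1 i.2) ≤ E r i a (θs.post j i.1 i.2) := fun r i => Finite.exists_max _
  choose act hact using hact
  set F : ℕ → (Fin j → S × A) × S → ℝ := fun r i => E r i (act r i) (θs.post j i.1 i.2) with hFdef
  set q : ℕ → (Fin j → S × A) × S → ℝ :=
    fun r i => actWeight (π r).ext j i.1 * θs.obs j i.1 i.2 with hqdef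
  -- The posterior is placed in the block of the current state, hence the dimension L S.
  set v : (Fin j → S × A) × S → Fin L × S → ℝ :=
    fun i x => if x.2 = i.2 then θs.post j i.1 i.2 x.1 else 0 with hvdef
  -- The signs linearize the ℓ¹ norm at the history `i`. At any other history with the same state
  -- the same functional is bounded by the error there, since the signs are at most 1 and the action
  -- there is the worst one.
  set sgn : ℕ → (Fin j → S × A) × S → S → Fin L → ℝ := fun r i s' l =>
    (SignType.sign (∑ m, θs.post j i.1 i.2 m *
      stepCoeff (θ r) θs πexp.ext i.2 (act r i) k s' l m) : ℝ) with hsgn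
  set g : ℕ → (Fin j → S × A) × S → Fin L × S → ℝ :=
    fun r i x => if x.2 = i.2 then ∑ s', ∑ l, sgn r i s' l *
      stepCoeff (θ r) θs πexp.ext i.2 (act r i) k s' l x.1 else 0 with hgdef
  have hsgn1 : ∀ r i s' l, |sgn r i s' l| ≤ 1 := fun r i s' l => by
    simp only [hsgn]
    rcases SignType.sign (∑ m, θs.post j i.1 i.2 m *
      stepCoeff (θ r) θs πexp.ext i.2 (act r i) k s' l m) with _ | _ | _ <;> simp
  have hdot : ∀ r i i', g r i ⬝ᵥ v i' = if i'.2 = i.2 then ∑ s', ∑ l, sgn r i s' l *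
      ∑ m, θs.post j i'.1 i'.2 m * stepCoeff (θ r) θs πexp.ext i.2 (act r i) k s' l m else 0 := by
    intro r i i'
    simp only [dotProduct, hgdef, hvdef, Fintype.sum_prod_type, ite_mul, zero_mul, mul_ite,
      mul_zero]
    split_ifs with h
    · simp only [h, Finset.sum_ite_eq', Finset.mem_univ, if_true, Finset.sum_mul, Finset.mul_sum]
      rw [← Finset.sum_comm_cycle]
      refine Finset.sum_congr rfl fun s' _ => Finset.sum_congr rfl fun l _ =>
        Finset.sum_congr rfl fun m _ => ?_
      ring
    · refine Finset.sum_eq_zero fun m _ => Finset.sum_eq_zero fun s' _ => ?_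
      split_ifs with h1 h2
      · exact absurd (h1.symm.trans h2) h
      · rfl
      · rfl
  have hq1 : ∀ r, ∑ i, q r i ≤ 1 := fun r => by
    rw [Fintype.sum_prod_type]
    exact (θs.sum_obs (π r).ext_isProb j).le
  have hq0 : ∀ r i, 0 ≤ q r i := fun r i =>
    mul_nonneg (actWeight_nonneg (π r).ext_isProb _ _) (θs.obs_nonneg _ _ _)
  have key := sum_le_of_eluder (K := K) hq0 hq1 (v := v) (fun i => ?_) (g := g) (F := F)
    (G := 16 * L) (B := 128 * Fintype.card A * h₀) (fun r i => ?_) (fun r i => ?_)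
    (fun r i i' => ?_) (fun r hr => ?_) (by positivity)
  · simp only [Fintype.card_prod, Fintype.card_fin, Nat.cast_mul] at key
    refine le_trans (Finset.sum_le_sum fun r _ => ?_) key
    rw [Fintype.sum_prod_type]
    refine Finset.sum_le_sum fun τ _ => Finset.sum_le_sum fun s _ => ?_
    simp only [hqdef, mul_assoc]
    refine mul_le_mul_of_nonneg_left ?_ (actWeight_nonneg (π r).ext_isProb _ _)
    calc _ ≤ ∑ a, (π r).ext j τ s a * (θs.obs j τ s * F r (τ, s)) := by
          refine Finset.sum_le_sum fun a _ => mul_le_mul_of_nonneg_left ?_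
            ((π r).ext_isProb.nonneg _ _ _ _)
          rw [stepErr_pre]
          exact mul_le_mul_of_nonneg_left (hact r (τ, s) a) (θs.obs_nonneg _ _ _)
      _ = _ := by rw [← Finset.sum_mul, (π r).ext_isProb.sum_eq_one, one_mul]
  · simp only [dotProduct, hvdef, Fintype.sum_prod_type, ite_mul, zero_mul, mul_ite, mul_zero]
    refine le_trans (Finset.sum_le_sum fun m _ => ?_) (θs.sum_post_le_one j i.1 i.2)
    rw [Finset.sum_eq_single i.2]
    · simp only [if_true]
      exact mul_le_of_le_one_right (θs.post_nonneg _ _ _ _) (θs.post_le_one _ _ _ _)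
    · intro b _ hb; simp [hb]
    · simp
  · have hb : ∀ m, |∑ s', ∑ l, sgn r i s' l *
        stepCoeff (θ r) θs πexp.ext i.2 (act r i) k s' l m| ≤ 4 := fun m => by
      refine le_trans ?_ (sum_abs_stepCoeff_le (θs := θs) hδ (hθ r) hκ i.2 (act r i) k hη hη' m)
      refine (Finset.abs_sum_le_sum_abs _ _).trans (Finset.sum_le_sum fun s' _ =>
        (Finset.abs_sum_le_sum_abs _ _).trans (Finset.sum_le_sum fun l _ => ?_))
      rw [abs_mul]
      exact mul_le_of_le_one_left (abs_nonneg _) (hsgn1 r i s' l)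
    simp only [dotProduct, hgdef, Fintype.sum_prod_type, ite_mul, zero_mul, mul_ite, mul_zero]
    calc _ ≤ ∑ _m : Fin L, (16 : ℝ) := Finset.sum_le_sum fun m _ => by
          rw [Finset.sum_eq_single i.2]
          · simp only [if_true]
            nlinarith [abs_le.1 (hb m)]
          · intro b _ hb; simp [hb]
          · simp
      _ = 16 * L := by simp [mul_comm]
  · rw [hdot, if_pos rfl]
    simp only [hsgn, sum_sign_mul]
    rfl
  · rw [hdot]
    split_ifs with h
    · refine le_trans ?_ (hact r i' (act r i))
      simp only [hE, stepErr, h]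
      refine (Finset.abs_sum_le_sum_abs _ _).trans (Finset.sum_le_sum fun s' _ =>
        (Finset.abs_sum_le_sum_abs _ _).trans (Finset.sum_le_sum fun l _ => ?_))
      rw [abs_mul]
      exact mul_le_of_le_one_left (abs_nonneg _) (hsgn1 r i s' l)
    · rw [abs_zero]
      exact stepErr_nonneg _ _ _ _
  -- A term for a single worst action is bounded by the sum over all actions, which the uniform
  -- action of φ_(j+1) observes.
  · have hone : ∀ t, ∑ i, q t i * F r i ^ 2 ≤ 64 * Fintype.card A *
        (hellSq (Policy.phi πexp j (π t)).ext n (θ r) θs +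
          hellSq (Policy.phi πexp (j + 1) (π t)).ext n (θ r) θs) := fun t => by
      have h1 := sum_hellFut_le πexp (π t) (show j + (k + 1) = n by omega) (θ r) θs
      have h2 := sum_hellFut_snoc_eq πexp (π t) hn (θ r) θs
      calc _ ≤ ∑ τ : Fin j → S × A, ∑ s, (64 * (actWeight (π t).ext j τ *
              hellFut πexp.ext (θ r) θs j τ s (k + 1)) + 64 * (actWeight (π t).ext j τ *
              ∑ a, ∑ s', hellFut πexp.ext (θ r) θs (j + 1) (Fin.snoc τ (s, a)) s' k)) := by
            rw [Fintype.sum_prod_type]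
            refine Finset.sum_le_sum fun τ _ => Finset.sum_le_sum fun s _ => ?_
            have h3 := obs_mul_stepErr_sq_le (θs := θs) hδ (hθ r) hκ j τ s (act r (τ, s)) k hη hη'
            have h4 := Finset.single_le_sum (f := fun a => ∑ s',
              hellFut πexp.ext (θ r) θs (j + 1) (Fin.snoc τ (s, a)) s' k)
              (fun a _ => Finset.sum_nonneg fun s' _ => hellFut_nonneg hκ _ _ _ _ _ _)
              (Finset.mem_univ (act r (τ, s)))
            have h5 : θs.obs j τ s * F r (τ, s) ^ 2 ≤
                64 * hellFut πexp.ext (θ r) θs j τ s (k + 1) + 64 * ∑ a, ∑ s',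
                  hellFut πexp.ext (θ r) θs (j + 1) (Fin.snoc τ (s, a)) s' k := by
              refine h3.trans ?_
              linarith
            have h6 := mul_le_mul_of_nonneg_left h5 (actWeight_nonneg (π t).ext_isProb j τ)
            simp only [hqdef]
            rw [mul_assoc]
            refine h6.trans (le_of_eq ?_)
            ring
        _ = 64 * (∑ τ : Fin j → S × A, ∑ s, actWeight (π t).ext j τ *
              hellFut πexp.ext (θ r) θs j τ s (k + 1)) +
              64 * ∑ τ : Fin j → S × A, ∑ s, actWeight (π t).ext j τ *
              ∑ a, ∑ s', hellFut πexp.ext (θ r) θs (j + 1) (Fin.snoc τ (s, a)) s' k := by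
            simp only [Finset.sum_add_distrib, ← Finset.mul_sum]
        _ ≤ _ := by rw [h2]; linarith
    refine (Finset.sum_le_sum fun t _ => hone t).trans ?_
    rw [← Finset.mul_sum, Finset.sum_add_distrib]
    have h1 := hh r hr j (by omega)
    have h2 := hh r hr (j + 1) (by omega)
    have hA : (0 : ℝ) ≤ Fintype.card A := by positivity
    nlinarith

end Posterior

/-! ### Accumulating the latent error over the first steps -/

section LatentError

variable {L n : ℕ} {S A : Type*} [Fintype S] [Fintype A]

/-- The expected `ℓ¹` norm of `latentDiff`. -/
def latErr (θ θs : LMDP L S A) (κe κ : ActionKernel S A) (j k : ℕ) : ℝ :=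
  ∑ τ : Fin j → S × A, ∑ s, actWeight κ j τ * ∑ l, |latentDiff θ θs κe j τ s k l|

variable {κe κ : ActionKernel S A} {θ θs : LMDP L S A} {δ : ℝ}

theorem latErr_nonneg (hκ : κ.IsProb) (j k : ℕ) : 0 ≤ latErr θ θs κe κ j k :=
  Finset.sum_nonneg fun _ _ => Finset.sum_nonneg fun _ _ =>
    mul_nonneg (actWeight_nonneg hκ _ _) (Finset.sum_nonneg fun _ _ => abs_nonneg _)

theorem latErr_succ_le (hκ : κ.IsProb) (j k : ℕ) :
    latErr θ θs κe κ (j + 1) k ≤ latErr θ θs κe κ j (k + 1) +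
      ∑ τ : Fin j → S × A, ∑ s, actWeight κ j τ *
        ∑ a, κ j τ s a * stepErr θ θs κe s a k (θs.pre j τ s) := by
  unfold latErr
  rw [sum_snoc]
  simp only [← Finset.sum_add_distrib]
  refine Finset.sum_le_sum fun τ _ => Finset.sum_le_sum fun s _ => ?_
  calc _ = actWeight κ j τ * ∑ a, κ j τ s a *
          ∑ s', ∑ l, |latentDiff θ θs κe (j + 1) (Fin.snoc τ (s, a)) s' k l| := by
        rw [Finset.mul_sum]
        refine Finset.sum_congr rfl fun a _ => ?_
        rw [← Finset.mul_sum, actWeight_snoc, mul_assoc]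
    _ ≤ actWeight κ j τ * ∑ a, κ j τ s a * ((∑ l, |latentDiff θ θs κe j τ s (k + 1) l|) +
          stepErr θ θs κe s a k (θs.pre j τ s)) := by
        refine mul_le_mul_of_nonneg_left (Finset.sum_le_sum fun a _ => ?_)
          (actWeight_nonneg hκ _ _)
        exact mul_le_mul_of_nonneg_left (sum_abs_latentDiff_snoc_le j τ s a k)
          (hκ.nonneg _ _ _ _)
    _ = _ := by
        simp only [mul_add, Finset.sum_add_distrib, ← Finset.sum_mul, hκ.sum_eq_one, one_mul]

/-- With an empty history the expectation over actions is trivial, and the error is one number per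
round that φ_0 observes directly. -/
theorem latErr_zero_sq_le (hδ : 0 ≤ δ) (hθ : θ.StronglySeparated δ) (hκe : κe.IsProb)
    (hη : L * Real.exp (-(δ ^ 2 / 2)) ^ n ≤ 1 / 4) :
    latErr θ θs κe κ 0 n ≤ 4 ∧ latErr θ θs κe κ 0 n ^ 2 ≤
      64 * ∑ s, hellFut κe θ θs 0 Fin.elim0 s n := by
  have e : latErr θ θs κe κ 0 n = ∑ s, ∑ l, |latentDiff θ θs κe 0 Fin.elim0 s n l| := by
    rw [latErr, Fintype.sum_unique]
    simp only [actWeight_zero, one_mul]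
    rw [Subsingleton.elim (default : Fin 0 → S × A) Fin.elim0]
  have h1 : latErr θ θs κe κ 0 n ≤ 2 * ∑ s, futDist θ θs κe 0 Fin.elim0 s n := by
    rw [e, Finset.mul_sum]
    exact Finset.sum_le_sum fun s _ => sum_abs_latentDiff_le hδ hθ hκe _ _ s n hη
  have hobs : ∀ η : LMDP L S A, ∑ s, η.obs 0 Fin.elim0 s = 1 := fun η => by
    have := η.sum_obs hκe 0
    rw [Fintype.sum_unique] at this
    simp only [actWeight_zero, one_mul] at this
    rwa [Subsingleton.elim (default : Fin 0 → S × A) Fin.elim0] at this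
  have h2 : ∑ s, futDist θ θs κe 0 Fin.elim0 s n ≤ 2 := by
    calc _ ≤ ∑ s, (θ.obs 0 Fin.elim0 s + θs.obs 0 Fin.elim0 s) := by
          refine Finset.sum_le_sum fun s _ => ?_
          rw [← θ.sum_preFut hκe 0 Fin.elim0 s n, ← θs.sum_preFut hκe 0 Fin.elim0 s n, futDist]
          simp only [← Finset.sum_add_distrib]
          refine Finset.sum_le_sum fun y _ => Finset.sum_le_sum fun s' _ => ?_
          rw [← mul_add]
          refine mul_le_mul_of_nonneg_left ?_ (actWeight_nonneg hκe _ _)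
          refine (abs_sub _ _).trans (le_of_eq ?_)
          rw [abs_of_nonneg (θ.preFut_nonneg _ _ _ _ _ _),
            abs_of_nonneg (θs.preFut_nonneg _ _ _ _ _ _)]
      _ = 2 := by rw [Finset.sum_add_distrib, hobs, hobs]; norm_num
  have h3 : ∑ s, futDist θ θs κe 0 Fin.elim0 s n ≤
      (∑ s, hellFut κe θ θs 0 Fin.elim0 s n) + 2 * √((∑ s, hellFut κe θ θs 0 Fin.elim0 s n) * 1) := by
    have h := sum_abs_sub_le_hell (ι := S × (Fin n → S × A) × S)
      (ω := fun x => actWeight κe n x.2.1)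
      (a := fun x => θ.preFut 0 Fin.elim0 x.1 n x.2.1 x.2.2)
      (b := fun x => θs.preFut 0 Fin.elim0 x.1 n x.2.1 x.2.2)
      (fun x => actWeight_nonneg hκe _ _) (fun x => θ.preFut_nonneg _ _ _ _ _ _)
      (fun x => θs.preFut_nonneg _ _ _ _ _ _)
    simp only [Fintype.sum_prod_type, θs.sum_preFut hκe, hobs] at h
    exact h
  have h4 : latErr θ θs κe κ 0 n ≤ 4 := by linarith
  refine ⟨h4, ?_⟩
  have h5 : 0 ≤ latErr θ θs κe κ 0 n := by
    rw [e]; exact Finset.sum_nonneg fun _ _ => Finset.sum_nonneg fun _ _ => abs_nonneg _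
  have := mul_sq_le_of_hell (q := 1) (D₂ := 0) zero_le_one h5 h4
    (Finset.sum_nonneg fun s _ => hellFut_nonneg hκe θ θs 0 Fin.elim0 s n) le_rfl
    (by simp only [zero_mul, Real.sqrt_zero]; linarith)
  linarith

/-- The learning rate of the latent error at a single step. -/
def stepRate (L S A K : ℕ) (h₀ : ℝ) : ℝ :=
  √(K * ((16 * L + 128 * A * h₀) * (2 * ((L * S) * Real.log (L * S + K)))))

variable [Nonempty S] [Nonempty A]

/-- The potential lemma in dimension one with a constant vector. The outcome is weakened to
`stepRate`, so that the induction over the steps has a single rate. -/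
theorem sum_latErr_zero_le (πexp : Policy (n + 1) S A) (π : ℕ → Policy (n + 1) S A)
    (θ : ℕ → LMDP L S A) (θs : LMDP L S A) (hδ : 0 ≤ δ)
    (hθ : ∀ r, (θ r).StronglySeparated δ) {K : ℕ}
    (hη : L * Real.exp (-(δ ^ 2 / 2)) ^ n ≤ 1 / 4) {h₀ : ℝ} (h₀0 : 0 ≤ h₀)
    (hh : ∀ r < K, ∀ i ≤ n,
      ∑ t ∈ Finset.range r, hellSq (Policy.phi πexp i (π t)).ext n (θ r) θs ≤ h₀) :
    ∑ r ∈ Finset.range K, latErr (θ r) θs πexp.ext (π r).ext 0 n ≤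
      stepRate L (Fintype.card S) (Fintype.card A) K h₀ := by
  have hF : ∀ r, latErr (θ r) θs πexp.ext (π r).ext 0 n ≤ 4 ∧ _ := fun r =>
    latErr_zero_sq_le (κ := (π r).ext) hδ (hθ r) πexp.ext_isProb hη
  have hF0 : ∀ r, 0 ≤ latErr (θ r) θs πexp.ext (π r).ext 0 n := fun r =>
    latErr_nonneg (π r).ext_isProb _ _
  have key := sum_le_of_eluder (K := K) (ι := Unit) (d := Unit) (q := fun _ _ => 1)
    (v := fun _ _ => 1) (g := fun r _ _ => latErr (θ r) θs πexp.ext (π r).ext 0 n)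
    (F := fun r _ => latErr (θ r) θs πexp.ext (π r).ext 0 n) (G := 16) (B := 64 * h₀)
    (by simp) (by simp) (by simp) (fun r _ => ?_) (by simp) (fun r _ _ => ?_) (fun r hr => ?_)
    (by positivity)
  · simp only [Finset.univ_unique, Finset.sum_const, Finset.card_singleton, one_smul, one_mul,
      Fintype.card_unit, Nat.cast_one] at key
    refine key.trans (Real.sqrt_le_sqrt ?_)
    have hL : (1 : ℝ) ≤ L := by
      have : 0 < L := Fin.pos θs.exists_mix_pos.choose
      exact_mod_cast this
    have hS : (1 : ℝ) ≤ Fintype.card S := by exact_mod_cast Fintype.card_pos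
    have hA : (1 : ℝ) ≤ Fintype.card A := by exact_mod_cast Fintype.card_pos
    have hLS : (1 : ℝ) ≤ L * Fintype.card S := by nlinarith
    have hK : (0 : ℝ) ≤ K := by positivity
    have hlog : Real.log (1 + K) ≤ L * Fintype.card S * Real.log (L * Fintype.card S + K) :=
      calc Real.log (1 + K) ≤ Real.log (L * Fintype.card S + K) :=
            Real.log_le_log (by positivity) (by linarith)
        _ ≤ _ := le_mul_of_one_le_left (Real.log_nonneg (by linarith)) hLS
    have hlog0 : 0 ≤ Real.log (1 + (K : ℝ)) := Real.log_nonneg (by linarith)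
    refine mul_le_mul_of_nonneg_left (mul_le_mul ?_ (by linarith) (by linarith) (by positivity)) hK
    nlinarith
  · simp only [dotProduct, Finset.univ_unique, Finset.sum_const, Finset.card_singleton, one_smul]
    nlinarith [hF r, hF0 r]
  · simp [abs_of_nonneg (hF0 r)]
  · have h1 := hh r hr 0 (by omega)
    simp only [hellSq_phi_zero, Finset.sum_const, Finset.card_range, nsmul_eq_mul] at h1
    simp only [Finset.univ_unique, Finset.sum_const, Finset.card_singleton, one_smul, one_mul,
      Finset.card_range, nsmul_eq_mul]
    have h2 := (hF r).2
    have hr0 : (0 : ℝ) ≤ r := by positivity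
    nlinarith

theorem exp_pow_le_of_le {x : ℝ} (hx : 0 ≤ x) {k k' : ℕ} (h : k ≤ k') :
    Real.exp (-x) ^ k' ≤ Real.exp (-x) ^ k :=
  pow_le_pow_of_le_one (Real.exp_pos _).le (Real.exp_le_one_iff.2 (by linarith)) h

/-- One unit of `stepRate` for the initial law and one for each of the `j` steps. Only the shortest
future has to be informative, because longer ones decode better. -/
theorem sum_latErr_le (πexp : Policy (n + 1) S A) (π : ℕ → Policy (n + 1) S A)
    (θ : ℕ → LMDP L S A) (θs : LMDP L S A) (hδ : 0 ≤ δ)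
    (hθ : ∀ r, (θ r).StronglySeparated δ) {j k K : ℕ} (hn : j + k = n)
    (hη : L * Real.exp (-(δ ^ 2 / 2)) ^ k ≤ 1 / 4) {h₀ : ℝ} (h₀0 : 0 ≤ h₀)
    (hh : ∀ r < K, ∀ i ≤ n,
      ∑ t ∈ Finset.range r, hellSq (Policy.phi πexp i (π t)).ext n (θ r) θs ≤ h₀) :
    ∑ r ∈ Finset.range K, latErr (θ r) θs πexp.ext (π r).ext j k ≤
      (j + 1) * stepRate L (Fintype.card S) (Fintype.card A) K h₀ := by
  induction j generalizing k with
  | zero =>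
    obtain rfl : k = n := by omega
    simpa using sum_latErr_zero_le πexp π θ θs hδ hθ hη h₀0 hh
  | succ j ih =>
    have hη' : L * Real.exp (-(δ ^ 2 / 2)) ^ (k + 1) ≤ 1 / 4 :=
      le_trans (mul_le_mul_of_nonneg_left (exp_pow_le_of_le (by positivity) (by omega))
        (by positivity)) hη
    have h1 := ih (k := k + 1) (by omega) hη'
    have h2 := sum_stepErr_le πexp π θ θs hδ hθ hn hη hη' h₀0 hh
    refine (Finset.sum_le_sum fun r _ => latErr_succ_le (π r).ext_isProb j k).trans ?_
    rw [Finset.sum_add_distrib]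
    push_cast
    refine (add_le_add h1 h2).trans (le_of_eq ?_)
    rw [stepRate]
    ring

end LatentError

/-! ### Agreement of past and future decoders; matching the instances of two models -/

section Mismatch

variable {L n : ℕ} {S A : Type*} [Fintype S] [Fintype A]
  {κe κ : ActionKernel S A} {θ θs : LMDP L S A} {δ : ℝ}

theorem sum_confusion_mul_transfer (hδ : 0 ≤ δ) (hθ : θ.StronglySeparated δ) (hκe : κe.IsProb)
    (s : S) (k : ℕ) (hη : L * Real.exp (-(δ ^ 2 / 2)) ^ k ≤ 1 / 4) (l m : Fin L) :
    ∑ l', θ.confusion κe s k l l' * transfer θ θs κe s k l' m = crossDec θ θs κe s k l m := by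
  have hu := (Matrix.isUnit_iff_isUnit_det _).1 (isUnit_confusion hδ hθ hκe s k hη)
  have : ((θ.confusion κe s k).mulVec ((θ.confusion κe s k)⁻¹.mulVec
      fun l => crossDec θ θs κe s k l m)) l = crossDec θ θs κe s k l m := by
    rw [Matrix.mulVec_mulVec, Matrix.mul_nonsing_inv _ hu, Matrix.one_mulVec]
  exact this

theorem sum_transfer (hδ : 0 ≤ δ) (hθ : θ.StronglySeparated δ) (hκe : κe.IsProb)
    (s : S) (k : ℕ) (hη : L * Real.exp (-(δ ^ 2 / 2)) ^ k ≤ 1 / 4) (m : Fin L) :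
    ∑ l, transfer θ θs κe s k l m = 1 := by
  rw [← sum_crossDec (θ := θ) (θs := θs) hκe s k m]
  simp only [← sum_confusion_mul_transfer (θs := θs) hδ hθ hκe s k hη]
  rw [Finset.sum_comm]
  simp only [← Finset.sum_mul, sum_confusion hκe, one_mul]

/-- The columns of `transfer` sum to one, so the transferred law keeps its total mass and summing
the latent difference over the index gives the difference of the observable laws. -/
theorem abs_obs_sub_obs_le (hδ : 0 ≤ δ) (hθ : θ.StronglySeparated δ) (hκe : κe.IsProb) (j : ℕ)
    (τ : Fin j → S × A) (s : S) (k : ℕ) (hη : L * Real.exp (-(δ ^ 2 / 2)) ^ k ≤ 1 / 4) :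
    |θ.obs j τ s - θs.obs j τ s| ≤ ∑ l, |latentDiff θ θs κe j τ s k l| := by
  have : θ.obs j τ s - θs.obs j τ s = ∑ l, latentDiff θ θs κe j τ s k l := by
    simp only [latentDiff, Finset.sum_sub_distrib, LMDP.obs]
    congr 1
    rw [Finset.sum_comm]
    simp only [← Finset.mul_sum, sum_transfer hδ hθ hκe s k hη, mul_one]
  rw [this]
  exact Finset.abs_sum_le_sum_abs _ _

/-- The mass that `θ` gives to the event that the past and the future decoders disagree. -/
def selfMismatch (θ : LMDP L S A) (κe : ActionKernel S A) (j : ℕ) (τ : Fin j → S × A) (s : S)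
    (k : ℕ) : ℝ :=
  ∑ l, if θ.pastDec j τ s ≠ l then ∑ l', θ.confusion κe s k l l' * θ.pre j τ s l' else 0

/-- If the decoders disagree, one of them is wrong: the past decoder costs the first term, the
future decoder, in the instance named by the past, the second. -/
theorem sum_selfMismatch_le (hδ : 0 ≤ δ) (hθ : θ.StronglySeparated δ) (hκe : κe.IsProb)
    (hκ : κ.IsProb) (j k : ℕ) :
    ∑ τ : Fin j → S × A, ∑ s, actWeight κ j τ * selfMismatch θ κe j τ s k ≤
      L * Real.exp (-(δ ^ 2 / 2)) ^ j + L * Real.exp (-(δ ^ 2 / 2)) ^ k := by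
  have hpt : ∀ (τ : Fin j → S × A) (s : S), selfMismatch θ κe j τ s k ≤
      (∑ m, if θ.pastDec j τ s ≠ m then θ.pre j τ s m else 0) +
        L * Real.exp (-(δ ^ 2 / 2)) ^ k * θ.obs j τ s := by
    intro τ s
    set d := θ.pastDec j τ s with hd
    calc selfMismatch θ κe j τ s k = ∑ l', (∑ l, if d ≠ l then θ.confusion κe s k l l' else 0) *
            θ.pre j τ s l' := by
          simp only [selfMismatch, Finset.sum_mul]
          rw [Finset.sum_comm]
          refine Finset.sum_congr rfl fun l _ => ?_
          split_ifs <;> simp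
      _ = ∑ l', (1 - θ.confusion κe s k d l') * θ.pre j τ s l' := by
          refine Finset.sum_congr rfl fun l' _ => ?_
          congr 1
          rw [← sum_confusion (θ := θ) hκe s k l', eq_sub_iff_add_eq]
          have : θ.confusion κe s k d l' =
              ∑ l, if d ≠ l then 0 else θ.confusion κe s k l l' := by simp
          rw [this, ← Finset.sum_add_distrib]
          exact Finset.sum_congr rfl fun l _ => by split_ifs <;> simp
      _ ≤ ∑ l', ((if d ≠ l' then θ.pre j τ s l' else 0) +
            L * Real.exp (-(δ ^ 2 / 2)) ^ k * θ.pre j τ s l') := by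
          refine Finset.sum_le_sum fun l' _ => ?_
          have hp := θ.pre_nonneg j τ s l'
          split_ifs with h
          · have h1 := confusion_nonneg (θ := θ) hκe s k d l'
            have h2 : 0 ≤ (L : ℝ) * Real.exp (-(δ ^ 2 / 2)) ^ k := by positivity
            nlinarith [mul_nonneg h1 hp, mul_nonneg h2 hp]
          · obtain rfl : d = l' := not_not.1 h
            have h1 := confusion_diag_ge hδ hθ hκe s k d
            rw [zero_add]
            exact mul_le_mul_of_nonneg_right (by linarith) hp
      _ = _ := by rw [Finset.sum_add_distrib, ← Finset.mul_sum, LMDP.obs]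
  calc _ ≤ ∑ τ : Fin j → S × A, ∑ s, (actWeight κ j τ *
          (∑ m, if θ.pastDec j τ s ≠ m then θ.pre j τ s m else 0) +
          L * Real.exp (-(δ ^ 2 / 2)) ^ k * (actWeight κ j τ * θ.obs j τ s)) := by
        refine Finset.sum_le_sum fun τ _ => Finset.sum_le_sum fun s _ => ?_
        refine (mul_le_mul_of_nonneg_left (hpt τ s) (actWeight_nonneg hκ _ _)).trans
          (le_of_eq (by ring))
    _ ≤ _ := by
        have e : ∑ τ : Fin j → S × A, ∑ s, L * Real.exp (-(δ ^ 2 / 2)) ^ k *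
            (actWeight κ j τ * θ.obs j τ s) = L * Real.exp (-(δ ^ 2 / 2)) ^ k := by
          have := θ.sum_obs hκ j
          calc _ = L * Real.exp (-(δ ^ 2 / 2)) ^ k *
                ∑ τ : Fin j → S × A, ∑ s, actWeight κ j τ * θ.obs j τ s := by
                simp only [Finset.mul_sum]
            _ = _ := by rw [this, mul_one]
        simp only [Finset.sum_add_distrib]
        rw [e]
        exact add_le_add (pastDec_error_le hδ hθ hκ j) le_rfl

/-- The mass that `θs` gives to the event that the past and the future decoders of `θ` disagree. -/
def crossMismatch (θ θs : LMDP L S A) (κe : ActionKernel S A) (j : ℕ) (τ : Fin j → S × A) (s : S)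
    (k : ℕ) : ℝ :=
  ∑ l, if θ.pastDec j τ s ≠ l then ∑ m, θs.pre j τ s m * crossDec θ θs κe s k l m else 0

/-- The law of the future decoder under θs is the confusion matrix applied to the latent law of θ
minus the latent difference, and stochastic columns do not increase ℓ¹ norms. This version serves
the prediction error of the current round. -/
theorem crossMismatch_le_latentDiff (hδ : 0 ≤ δ) (hθ : θ.StronglySeparated δ) (hκe : κe.IsProb)
    (j : ℕ) (τ : Fin j → S × A) (s : S) (k : ℕ)
    (hη : L * Real.exp (-(δ ^ 2 / 2)) ^ k ≤ 1 / 4) :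
    crossMismatch θ θs κe j τ s k ≤ selfMismatch θ κe j τ s k +
      ∑ l, |latentDiff θ θs κe j τ s k l| := by
  have h1 : ∀ l, ∑ m, θs.pre j τ s m * crossDec θ θs κe s k l m =
      ∑ l', θ.confusion κe s k l l' * (θ.pre j τ s l' - latentDiff θ θs κe j τ s k l') := by
    intro l
    simp only [latentDiff, sub_sub_cancel, ← sum_confusion_mul_transfer (θs := θs) hδ hθ hκe s k hη,
      Finset.mul_sum]
    rw [Finset.sum_comm]
    exact Finset.sum_congr rfl fun l' _ => Finset.sum_congr rfl fun m _ => by ring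
  calc crossMismatch θ θs κe j τ s k ≤ ∑ l, ((if θ.pastDec j τ s ≠ l then
          ∑ l', θ.confusion κe s k l l' * θ.pre j τ s l' else 0) +
          ∑ l', θ.confusion κe s k l l' * |latentDiff θ θs κe j τ s k l'|) := by
        refine Finset.sum_le_sum fun l _ => ?_
        have h0 : 0 ≤ ∑ l', θ.confusion κe s k l l' * |latentDiff θ θs κe j τ s k l'| :=
          Finset.sum_nonneg fun l' _ => mul_nonneg (confusion_nonneg hκe _ _ _ _) (abs_nonneg _)
        split_ifs with h
        · rw [h1, ← Finset.sum_add_distrib]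
          refine Finset.sum_le_sum fun l' _ => ?_
          rw [← mul_add]
          refine mul_le_mul_of_nonneg_left ?_ (confusion_nonneg hκe _ _ _ _)
          linarith [neg_abs_le (latentDiff θ θs κe j τ s k l')]
        · linarith
    _ = _ := by
        rw [Finset.sum_add_distrib, selfMismatch]
        congr 1
        rw [Finset.sum_comm]
        simp only [← Finset.sum_mul, sum_confusion hκe, one_mul]

/-- Disagreement is an event of history and future, so `le_two_mul_add_hell` applies term by term.
This version serves the in-sample bound, where a square root of the Hellinger term would be too
costly. -/
theorem crossMismatch_le_hellFut (hκe : κe.IsProb) (j : ℕ) (τ : Fin j → S × A) (s : S) (k : ℕ) :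
    crossMismatch θ θs κe j τ s k ≤ 2 * selfMismatch θ κe j τ s k +
      2 * hellFut κe θ θs j τ s k := by
  have h1 : ∀ l, ∑ y : Fin k → S × A, ∑ s', actWeight κe k y * (if θ.futDec s k y s' = l then
        θ.preFut j τ s k y s' else 0) = ∑ l', θ.confusion κe s k l l' * θ.pre j τ s l' :=
    fun l => sum_futDec_preFut_self κe j τ s k l
  have h2 : ∀ l, ∑ y : Fin k → S × A, ∑ s', actWeight κe k y * (if θ.futDec s k y s' = l then
        θs.preFut j τ s k y s' else 0) = ∑ m, θs.pre j τ s m * crossDec θ θs κe s k l m :=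
    fun l => sum_futDec_preFut κe j τ s k l
  set d := θ.pastDec j τ s with hd
  have h3 : ∀ f : (Fin k → S × A) → S → ℝ,
      (∑ l, if d ≠ l then ∑ y : Fin k → S × A, ∑ s', actWeight κe k y *
        (if θ.futDec s k y s' = l then f y s' else 0) else 0) =
      ∑ y : Fin k → S × A, ∑ s', actWeight κe k y *
        (if d ≠ θ.futDec s k y s' then f y s' else 0) := by
    intro f
    have : ∀ y s', (if d ≠ θ.futDec s k y s' then f y s' else 0) =
        ∑ l, if d ≠ l then (if θ.futDec s k y s' = l then f y s' else 0) else 0 := by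
      intro y s'
      rw [Finset.sum_eq_single (θ.futDec s k y s')]
      · simp
      · intro b _ hb; simp [hb.symm]
      · simp
    simp only [this, Finset.mul_sum]
    rw [Finset.sum_comm_cycle]
    refine Finset.sum_congr rfl fun l _ => ?_
    split_ifs <;> simp
  rw [crossMismatch, selfMismatch]
  simp only [← h1, ← h2]
  rw [h3 (fun y s' => θs.preFut j τ s k y s'), h3 (fun y s' => θ.preFut j τ s k y s'), hellFut]
  simp only [Finset.mul_sum, ← Finset.sum_add_distrib]
  refine Finset.sum_le_sum fun y _ => Finset.sum_le_sum fun s' _ => ?_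
  have hw := actWeight_nonneg hκe k y
  have h4 := le_two_mul_add_hell (θ.preFut_nonneg j τ s k y s') (θs.preFut_nonneg j τ s k y s')
  split_ifs
  · nlinarith
  · have := mul_nonneg hw (sq_nonneg (√(θ.preFut j τ s k y s') - √(θs.preFut j τ s k y s')))
    simp only [mul_zero, zero_add]
    linarith

theorem exists_isMax_crossDec (θ θs : LMDP L S A) (κe : ActionKernel S A) (s : S) (k : ℕ)
    (m : Fin L) : ∃ d, ∀ l, crossDec θ θs κe s k l m ≤ crossDec θ θs κe s k d m :=
  have : Nonempty (Fin L) := ⟨m⟩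
  Finite.exists_max _

/-- The instance of `θ` that the future decoder of `θ` assigns to the instance `m` of `θs`. -/
def matching (θ θs : LMDP L S A) (κe : ActionKernel S A) (s : S) (k : ℕ) (m : Fin L) : Fin L :=
  (exists_isMax_crossDec θ θs κe s k m).choose

/-- The mass of the event that the past decoder of `θ` differs from the matched instance. -/
def badMass (θ θs : LMDP L S A) (κe : ActionKernel S A) (j : ℕ) (τ : Fin j → S × A) (s : S)
    (k : ℕ) : ℝ :=
  ∑ m, if θ.pastDec j τ s ≠ matching θ θs κe s k m then θs.pre j τ s m else 0

/-- If the past decoder's value d is not the likeliest output of the future decoder in the instance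
m, then P(d) ≤ P(matched) ≤ P(≠ d). So the decoders disagree with probability at least 1/2. -/
theorem badMass_le (hκe : κe.IsProb) (j : ℕ) (τ : Fin j → S × A) (s : S) (k : ℕ) :
    badMass θ θs κe j τ s k ≤ 2 * crossMismatch θ θs κe j τ s k := by
  set d := θ.pastDec j τ s with hd
  have h1 : crossMismatch θ θs κe j τ s k = ∑ m, θs.pre j τ s m *
      ∑ l, if d ≠ l then crossDec θ θs κe s k l m else 0 := by
    simp only [crossMismatch, Finset.mul_sum]
    rw [Finset.sum_comm]
    refine Finset.sum_congr rfl fun l _ => ?_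
    split_ifs <;> simp
  rw [h1, Finset.mul_sum, badMass]
  refine Finset.sum_le_sum fun m _ => ?_
  have hp := θs.pre_nonneg j τ s m
  have hc : ∀ l, 0 ≤ if d ≠ l then crossDec θ θs κe s k l m else 0 := fun l => by
    split_ifs
    · exact crossDec_nonneg hκe _ _ _ _
    · exact le_rfl
  split_ifs with h
  · have hs := sum_crossDec (θ := θ) (θs := θs) hκe s k m
    have h2 : (∑ l, if d ≠ l then crossDec θ θs κe s k l m else 0) +
        crossDec θ θs κe s k d m = 1 := by
      have : crossDec θ θs κe s k d m =
          ∑ l, if d ≠ l then 0 else crossDec θ θs κe s k l m := by simp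
      rw [this, ← hs, ← Finset.sum_add_distrib]
      exact Finset.sum_congr rfl fun l _ => by split_ifs <;> simp
    have h3 := (exists_isMax_crossDec θ θs κe s k m).choose_spec d
    have h4 : crossDec θ θs κe s k (matching θ θs κe s k m) m ≤
        ∑ l, if d ≠ l then crossDec θ θs κe s k l m else 0 := by
      have := Finset.single_le_sum (f := fun l => if d ≠ l then crossDec θ θs κe s k l m else 0)
        (fun l _ => hc l) (Finset.mem_univ (matching θ θs κe s k m))
      rwa [if_pos h] at this
    have h5 : 1 / 2 ≤ ∑ l, if d ≠ l then crossDec θ θs κe s k l m else 0 := by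
      unfold matching at h4
      linarith
    nlinarith
  · exact mul_nonneg zero_le_two (mul_nonneg hp (Finset.sum_nonneg fun l _ => hc l))

/-- The latent law of `θ` is close to the law of the matched index. -/
theorem sum_abs_pre_sub_matching_le (j : ℕ) (τ : Fin j → S × A) (s : S) (k : ℕ) :
    ∑ l, |θ.pre j τ s l - ∑ m, if matching θ θs κe s k m = l then θs.pre j τ s m else 0| ≤
      2 * (∑ m, if θ.pastDec j τ s ≠ m then θ.pre j τ s m else 0) +
        |θ.obs j τ s - θs.obs j τ s| + 2 * badMass θ θs κe j τ s k := by
  set d := θ.pastDec j τ s with hd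
  -- Both latent laws are compared with point masses at `d` that carry their own total mass; the
  -- distance is twice the mass elsewhere.
  have hA : ∀ x : Fin L → ℝ, (∀ l, 0 ≤ x l) →
      ∑ l, |x l - if d = l then ∑ m, x m else 0| ≤ 2 * ∑ m, if d ≠ m then x m else 0 := by
    intro x hx
    have h1 : ∑ m, x m = x d + ∑ m, if d ≠ m then x m else 0 := by
      have : x d = ∑ m, if d ≠ m then 0 else x m := by simp
      rw [this, ← Finset.sum_add_distrib]
      exact Finset.sum_congr rfl fun l _ => by split_ifs <;> simp
    have h0 : 0 ≤ ∑ m, if d ≠ m then x m else 0 :=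
      Finset.sum_nonneg fun m _ => by split_ifs <;> simp [hx m]
    refine le_of_eq ?_
    calc _ = ∑ l, ((if d ≠ l then x l else 0) +
          if d = l then ∑ m, (if d ≠ m then x m else 0) else 0) := by
          refine Finset.sum_congr rfl fun l _ => ?_
          by_cases h : d = l
          · subst h
            simp only [if_true, ne_eq, not_true_eq_false, if_false, zero_add]
            rw [h1, sub_add_cancel_left, abs_neg, abs_of_nonneg h0]
          · simp [h, abs_of_nonneg (hx l)]
      _ = _ := by
          rw [Finset.sum_add_distrib, Finset.sum_ite_eq, if_pos (Finset.mem_univ _), two_mul]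
  set y : Fin L → ℝ := fun l => ∑ m, if matching θ θs κe s k m = l then θs.pre j τ s m else 0
    with hy
  have hy0 : ∀ l, 0 ≤ y l := fun l => Finset.sum_nonneg fun m _ => by
    split_ifs
    · exact θs.pre_nonneg _ _ _ _
    · exact le_rfl
  have hysum : ∑ l, y l = θs.obs j τ s := by
    simp only [hy, LMDP.obs]
    rw [Finset.sum_comm]
    simp
  have hybad : (∑ l, if d ≠ l then y l else 0) = badMass θ θs κe j τ s k := by
    simp only [hy, badMass, ← hd]
    calc _ = ∑ l, ∑ m, if matching θ θs κe s k m = l then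
            (if d ≠ matching θ θs κe s k m then θs.pre j τ s m else 0) else 0 := by
          refine Finset.sum_congr rfl fun l _ => ?_
          by_cases h : d = l
          · rw [if_neg (not_not.2 h)]
            refine (Finset.sum_eq_zero fun m _ => ?_).symm
            by_cases h1 : matching θ θs κe s k m = l
            · simp [h1, h]
            · simp [h1]
          · simp only [ne_eq, h, not_false_eq_true, if_true]
            refine Finset.sum_congr rfl fun m _ => ?_
            by_cases h1 : matching θ θs κe s k m = l
            · simp [h1, h]
            · simp [h1]
      _ = _ := by rw [Finset.sum_comm]; simp
  have h1 := hA (θ.pre j τ s) (θ.pre_nonneg j τ s)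
  have h2 := hA y hy0
  rw [hysum, hybad] at h2
  have h3 : ∑ l, |(if d = l then ∑ m, θ.pre j τ s m else 0) -
      if d = l then θs.obs j τ s else 0| = |θ.obs j τ s - θs.obs j τ s| := by
    rw [Finset.sum_eq_single d]
    · simp [LMDP.obs]
    · intro b _ hb; simp [hb.symm]
    · simp
  calc _ ≤ ∑ l, (|θ.pre j τ s l - if d = l then ∑ m, θ.pre j τ s m else 0| +
        |(if d = l then ∑ m, θ.pre j τ s m else 0) - if d = l then θs.obs j τ s else 0| +
        |y l - if d = l then θs.obs j τ s else 0|) := by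
        refine Finset.sum_le_sum fun l _ => ?_
        have e : θ.pre j τ s l - y l = (θ.pre j τ s l - if d = l then ∑ m, θ.pre j τ s m else 0) +
          ((if d = l then ∑ m, θ.pre j τ s m else 0) - if d = l then θs.obs j τ s else 0) -
          (y l - if d = l then θs.obs j τ s else 0) := by ring
        rw [e]
        exact (abs_sub _ _).trans (add_le_add (abs_add_le _ _) le_rfl)
    _ ≤ _ := by
        rw [Finset.sum_add_distrib, Finset.sum_add_distrib, h3]
        linarith

end Mismatch

/-! ### Decoding from the first w steps of a longer history -/

section Prefix

variable {L n : ℕ} {S A : Type*}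

/-- The first `w` steps of a history of length `w + i`, with the state reached at step `w`. -/
def pref (w : ℕ) : (i : ℕ) → (Fin (w + i) → S × A) → S → (Fin w → S × A) × S
  | 0, τ, s => (τ, s)
  | i + 1, τ, _ => pref w i (fun j => τ (Fin.castSucc j)) (τ (Fin.last (w + i))).1

theorem pref_snoc (w i : ℕ) (τ : Fin (w + i) → S × A) (x : S × A) (s' : S) :
    pref w (i + 1) (Fin.snoc τ x : Fin (w + i + 1) → S × A) s' = pref w i τ x.1 := by
  rw [pref]
  simp only [Fin.snoc_castSucc, Fin.snoc_last]

variable [Fintype S] [Fintype A] {κ κe : ActionKernel S A} {θ θs : LMDP L S A} {δ : ℝ}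

/-- The expectation of a function of the index and the prefix is unaffected by later steps. It
carries decoding bounds from step w to step w + i. -/
theorem sum_pre_pref (hκ : κ.IsProb) (θ : LMDP L S A) (w i : ℕ) (m : Fin L)
    (g : (Fin w → S × A) × S → ℝ) :
    ∑ τ : Fin (w + i) → S × A, ∑ s, actWeight κ (w + i) τ *
        (θ.pre (w + i) τ s m * g (pref w i τ s)) =
      ∑ τ : Fin w → S × A, ∑ s, actWeight κ w τ * (θ.pre w τ s m * g (τ, s)) := by
  induction i with
  | zero => rfl
  | succ i ih =>
    rw [← ih]
    refine (sum_snoc (w + i) _).trans ?_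
    refine Finset.sum_congr rfl fun τ _ => Finset.sum_congr rfl fun s _ => ?_
    calc _ = ∑ a, ∑ s', κ (w + i) τ s a * (actWeight κ (w + i) τ *
          (θ.pre (w + i) τ s m * g (pref w i τ s))) * θ.ker m s a s' := by
          refine Finset.sum_congr rfl fun a _ => Finset.sum_congr rfl fun s' _ => ?_
          rw [pref_snoc]
          refine (congrArg₂ (fun x y => x * (y * g (pref w i τ s)))
            (actWeight_snoc κ (w + i) τ (s, a)) (θ.pre_snoc (w + i) τ (s, a) s' m)).trans ?_
          ring
      _ = _ := by
          simp only [← Finset.mul_sum, θ.sum_ker, mul_one, ← Finset.sum_mul, hκ.sum_eq_one,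
            one_mul]

theorem sum_sum_pre_pref (hκ : κ.IsProb) (θ : LMDP L S A) (w i : ℕ)
    (g : Fin L → (Fin w → S × A) × S → ℝ) :
    ∑ τ : Fin (w + i) → S × A, ∑ s, actWeight κ (w + i) τ *
        ∑ m, θ.pre (w + i) τ s m * g m (pref w i τ s) =
      ∑ τ : Fin w → S × A, ∑ s, actWeight κ w τ * ∑ m, θ.pre w τ s m * g m (τ, s) := by
  simp only [Finset.mul_sum]
  rw [Finset.sum_comm_cycle]
  refine Eq.trans ?_ Finset.sum_comm_cycle.symm
  exact Finset.sum_congr rfl fun m _ => sum_pre_pref hκ θ w i m (g m)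

/-- The mass that the decoder `d` of the latent index from the first `w` steps misses. -/
def missed (θ : LMDP L S A) (w i : ℕ) (τ : Fin (w + i) → S × A) (s : S) : ℝ :=
  ∑ m, if θ.pastDec w (pref w i τ s).1 (pref w i τ s).2 ≠ m then θ.pre (w + i) τ s m else 0

theorem missed_nonneg (w i : ℕ) (τ : Fin (w + i) → S × A) (s : S) : 0 ≤ missed θ w i τ s :=
  Finset.sum_nonneg fun m _ => by
    split_ifs
    · exact θ.pre_nonneg _ _ _ _
    · exact le_rfl

theorem sum_missed_le (hδ : 0 ≤ δ) (hθ : θ.StronglySeparated δ) (hκ : κ.IsProb) (w i : ℕ) :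
    ∑ τ : Fin (w + i) → S × A, ∑ s, actWeight κ (w + i) τ * missed θ w i τ s ≤
      L * Real.exp (-(δ ^ 2 / 2)) ^ w := by
  refine le_trans (le_of_eq ?_) (pastDec_error_le hδ hθ hκ w)
  have := sum_sum_pre_pref hκ θ w i fun m x => if θ.pastDec w x.1 x.2 ≠ m then 1 else 0
  simp only [mul_ite, mul_one, mul_zero] at this
  exact this

/-- The mass of the instances that are not matched to the decoded instance of `θ`. -/
def unmatched (θ θs : LMDP L S A) (κe : ActionKernel S A) (k w i : ℕ) (τ : Fin (w + i) → S × A)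
    (s : S) : ℝ :=
  ∑ m, if θ.pastDec w (pref w i τ s).1 (pref w i τ s).2 ≠ matching θ θs κe (pref w i τ s).2 k m then
    θs.pre (w + i) τ s m else 0

theorem unmatched_nonneg (k w i : ℕ) (τ : Fin (w + i) → S × A) (s : S) :
    0 ≤ unmatched θ θs κe k w i τ s :=
  Finset.sum_nonneg fun m _ => by
    split_ifs
    · exact θs.pre_nonneg _ _ _ _
    · exact le_rfl

theorem sum_unmatched (hκ : κ.IsProb) (k w i : ℕ) :
    ∑ τ : Fin (w + i) → S × A, ∑ s, actWeight κ (w + i) τ * unmatched θ θs κe k w i τ s =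
      ∑ τ : Fin w → S × A, ∑ s, actWeight κ w τ * badMass θ θs κe w τ s k := by
  have := sum_sum_pre_pref hκ θs w i fun m x =>
    if θ.pastDec w x.1 x.2 ≠ matching θ θs κe x.2 k m then 1 else 0
  simp only [mul_ite, mul_one, mul_zero] at this
  exact this

variable [Nonempty A]

theorem sum_badMass_le_hellSq (πexp π : Policy (n + 1) S A) (hδ : 0 ≤ δ)
    (hθ : θ.StronglySeparated δ) {w k : ℕ} (hn : w + k = n) :
    ∑ τ : Fin w → S × A, ∑ s, actWeight π.ext w τ * badMass θ θs πexp.ext w τ s k ≤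
      4 * (L * Real.exp (-(δ ^ 2 / 2)) ^ w + L * Real.exp (-(δ ^ 2 / 2)) ^ k) +
        4 * (Fintype.card A * hellSq (Policy.phi πexp w π).ext n θ θs) := by
  have h1 := sum_selfMismatch_le (θ := θ) hδ hθ πexp.ext_isProb π.ext_isProb w k
  have h2 := sum_hellFut_le πexp π hn θ θs
  refine le_trans ?_ (add_le_add (mul_le_mul_of_nonneg_left h1 (by norm_num : (0 : ℝ) ≤ 4))
    (mul_le_mul_of_nonneg_left h2 (by norm_num : (0 : ℝ) ≤ 4)))
  simp only [Finset.mul_sum, ← Finset.sum_add_distrib]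
  refine Finset.sum_le_sum fun τ _ => Finset.sum_le_sum fun s _ => ?_
  have h3 := badMass_le (θ := θ) (θs := θs) πexp.ext_isProb w τ s k
  have h4 := crossMismatch_le_hellFut (θ := θ) (θs := θs) πexp.ext_isProb w τ s k
  have hw := actWeight_nonneg π.ext_isProb w τ
  have := mul_le_mul_of_nonneg_left (h3.trans (mul_le_mul_of_nonneg_left h4 zero_le_two)) hw
  linarith

theorem sum_badMass_le_latErr (πexp π : Policy (n + 1) S A) (hδ : 0 ≤ δ)
    (hθ : θ.StronglySeparated δ) {w k : ℕ} (hη : L * Real.exp (-(δ ^ 2 / 2)) ^ k ≤ 1 / 4) :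
    ∑ τ : Fin w → S × A, ∑ s, actWeight π.ext w τ * badMass θ θs πexp.ext w τ s k ≤
      2 * (L * Real.exp (-(δ ^ 2 / 2)) ^ w + L * Real.exp (-(δ ^ 2 / 2)) ^ k) +
        2 * latErr θ θs πexp.ext π.ext w k := by
  have h1 := sum_selfMismatch_le (θ := θ) hδ hθ πexp.ext_isProb π.ext_isProb w k
  refine le_trans ?_ (add_le_add (mul_le_mul_of_nonneg_left h1 zero_le_two) le_rfl)
  simp only [latErr, Finset.mul_sum _ _ (2 : ℝ), ← Finset.sum_add_distrib]
  refine Finset.sum_le_sum fun τ _ => Finset.sum_le_sum fun s _ => ?_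
  have h3 := badMass_le (θ := θ) (θs := θs) πexp.ext_isProb w τ s k
  have h4 := crossMismatch_le_latentDiff (θs := θs) hδ hθ πexp.ext_isProb w τ s k hη
  have hw := actWeight_nonneg π.ext_isProb w τ
  have := mul_le_mul_of_nonneg_left (h3.trans (mul_le_mul_of_nonneg_left h4 zero_le_two)) hw
  linarith

end Prefix

/-! ### Error propagation through the kernels of matched instances -/

section MatchedKernels

variable {L n : ℕ} {S A : Type*} [Fintype S]

/-- The `ℓ¹` distance of the transition probabilities of two instances. -/
def kerDist (θ θs : LMDP L S A) (l m : Fin L) (s : S) (a : A) : ℝ :=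
  ∑ s', |θ.ker l s a s' - θs.ker m s a s'|

theorem kerDist_nonneg (θ θs : LMDP L S A) (l m : Fin L) (s : S) (a : A) :
    0 ≤ kerDist θ θs l m s a := Finset.sum_nonneg fun _ _ => abs_nonneg _

theorem kerDist_le_two (θ θs : LMDP L S A) (l m : Fin L) (s : S) (a : A) :
    kerDist θ θs l m s a ≤ 2 := by
  calc _ ≤ ∑ s', (θ.ker l s a s' + θs.ker m s a s') := by
        refine Finset.sum_le_sum fun s' _ => (abs_sub _ _).trans (le_of_eq ?_)
        rw [abs_of_nonneg (θ.ker_nonneg _ _ _ _), abs_of_nonneg (θs.ker_nonneg _ _ _ _)]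
    _ = 2 := by rw [Finset.sum_add_distrib, θ.sum_ker, θs.sum_ker]; norm_num

theorem sum_eq_add_sum_ne {ι : Type*} [Fintype ι] [DecidableEq ι] (d : ι) (f : ι → ℝ) :
    ∑ m, f m = f d + ∑ m, if d ≠ m then f m else 0 := by
  have : f d = ∑ m, if d ≠ m then 0 else f m := by simp
  rw [this, ← Finset.sum_add_distrib]
  exact Finset.sum_congr rfl fun l _ => by split_ifs <;> simp

/-- If the latent laws sit mostly on l₀ and m₀, the observable law of the next state is nearly a
multiple of one kernel in each model. The distance of the kernels is then visible in it, up to the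
residual masses. -/
theorem pre_mul_kerDist_le (θ θs : LMDP L S A) (j : ℕ) (τ : Fin j → S × A) (s : S) (a : A)
    (l₀ m₀ : Fin L) :
    θs.pre j τ s m₀ * kerDist θ θs l₀ m₀ s a ≤
      2 * (∑ m, if m₀ ≠ m then θs.pre j τ s m else 0) +
      2 * (∑ l, if l₀ ≠ l then θ.pre j τ s l else 0) +
      2 * ∑ s', |θ.obs (j + 1) (Fin.snoc τ (s, a)) s' -
        θs.obs (j + 1) (Fin.snoc τ (s, a)) s'| := by
  set rs := ∑ m, if m₀ ≠ m then θs.pre j τ s m else 0 with hrs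
  set r := ∑ l, if l₀ ≠ l then θ.pre j τ s l else 0 with hr
  set D : S → ℝ := fun s' => θ.obs (j + 1) (Fin.snoc τ (s, a)) s' -
        θs.obs (j + 1) (Fin.snoc τ (s, a)) s' with hD
  have hres : ∀ (η : LMDP L S A) (d : Fin L),
      ∑ s', (∑ m, if d ≠ m then η.pre j τ s m * η.ker m s a s' else 0) =
        ∑ m, if d ≠ m then η.pre j τ s m else 0 := by
    intro η d
    rw [Finset.sum_comm]
    refine Finset.sum_congr rfl fun m _ => ?_
    split_ifs
    · rw [← Finset.mul_sum, η.sum_ker, mul_one]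
    · simp
  have hnn : ∀ (η : LMDP L S A) (d : Fin L) s',
      0 ≤ ∑ m, if d ≠ m then η.pre j τ s m * η.ker m s a s' else 0 := fun η d s' =>
    Finset.sum_nonneg fun m _ => by
      split_ifs
      · exact mul_nonneg (η.pre_nonneg _ _ _ _) (η.ker_nonneg _ _ _ _)
      · exact le_rfl
  have hrs0 : 0 ≤ rs := by rw [hrs, ← hres θs m₀]; exact Finset.sum_nonneg fun s' _ => hnn _ _ _
  have hr0 : 0 ≤ r := by rw [hr, ← hres θ l₀]; exact Finset.sum_nonneg fun s' _ => hnn _ _ _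
  have hobs : ∀ (η : LMDP L S A) (d : Fin L) s', η.obs (j + 1) (Fin.snoc τ (s, a)) s' =
      η.pre j τ s d * η.ker d s a s' +
        ∑ m, if d ≠ m then η.pre j τ s m * η.ker m s a s' else 0 := fun η d s' => by
    simp only [LMDP.obs, LMDP.pre_snoc]
    exact sum_eq_add_sum_ne d _
  -- The total masses are also observable: summing the next-state law returns the law of the
  -- history, so the two main masses differ by at most ∑ |D| and the residuals.
  have h1 : |θs.pre j τ s m₀ - θ.pre j τ s l₀| ≤ (∑ s', |D s'|) + rs + r := by
    have e1 := sum_eq_add_sum_ne m₀ (θs.pre j τ s)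
    have e2 := sum_eq_add_sum_ne l₀ (θ.pre j τ s)
    have e3 : (∑ m, θ.pre j τ s m) - ∑ m, θs.pre j τ s m = ∑ s', D s' := by
      have a1 := θ.sum_obs_snoc j τ s a
      have a2 := θs.sum_obs_snoc j τ s a
      rw [hD, Finset.sum_sub_distrib, a1, a2, LMDP.obs, LMDP.obs]
    have e4 := Finset.abs_sum_le_sum_abs D Finset.univ
    rw [← e3] at e4
    rw [abs_le] at e4 ⊢
    rw [← hrs] at e1
    rw [← hr] at e2
    constructor <;> linarith [e4.1, e4.2]
  have h2 : ∀ s', θs.pre j τ s m₀ * |θ.ker l₀ s a s' - θs.ker m₀ s a s'| ≤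
      |θs.pre j τ s m₀ - θ.pre j τ s l₀| * θ.ker l₀ s a s' + |D s'| +
        (∑ m, if l₀ ≠ m then θ.pre j τ s m * θ.ker m s a s' else 0) +
        ∑ m, if m₀ ≠ m then θs.pre j τ s m * θs.ker m s a s' else 0 := by
    intro s'
    have a1 := hnn θ l₀ s'
    have a2 := hnn θs m₀ s'
    have e : θs.pre j τ s m₀ * (θ.ker l₀ s a s' - θs.ker m₀ s a s') =
        (θs.pre j τ s m₀ - θ.pre j τ s l₀) * θ.ker l₀ s a s' + D s' -
        (∑ m, if l₀ ≠ m then θ.pre j τ s m * θ.ker m s a s' else 0) +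
        ∑ m, if m₀ ≠ m then θs.pre j τ s m * θs.ker m s a s' else 0 := by
      simp only [hD]
      rw [hobs θ l₀, hobs θs m₀]
      ring
    rw [← abs_of_nonneg (θs.pre_nonneg j τ s m₀), ← abs_mul, e,
      abs_of_nonneg (θs.pre_nonneg j τ s m₀)]
    refine (abs_add_le _ _).trans (add_le_add ((abs_sub _ _).trans (add_le_add
      ((abs_add_le _ _).trans (add_le_add ?_ le_rfl)) ?_)) ?_)
    · rw [abs_mul, abs_of_nonneg (θ.ker_nonneg _ _ _ _)]
    · rw [abs_of_nonneg a1]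
    · rw [abs_of_nonneg a2]
  have h3 := Finset.sum_le_sum fun s' (_ : s' ∈ Finset.univ) => h2 s'
  simp only [Finset.sum_add_distrib, hres] at h3
  rw [← Finset.mul_sum, ← Finset.mul_sum, θ.sum_ker, mul_one, ← hrs, ← hr] at h3
  rw [kerDist]
  linarith

variable [Fintype A] {κ κe : ActionKernel S A} {θ θs : LMDP L S A} {δ : ℝ}

/-- The expected distance between the latent law of `θ` and the law of the index that `σ` matches to
the instance of `θs`. -/
def matchErr (θ θs : LMDP L S A) (κ : ActionKernel S A) (σ : Fin L → S → Fin L) (w i : ℕ) : ℝ :=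
  ∑ τ : Fin (w + i) → S × A, ∑ s, actWeight κ (w + i) τ *
    ∑ l, |θ.pre (w + i) τ s l -
      ∑ m, if σ m (pref w i τ s).2 = l then θs.pre (w + i) τ s m else 0|

theorem sum_abs_matched_snoc_le (σ : Fin L → Fin L) (j : ℕ) (τ : Fin j → S × A) (s : S) (a : A) :
    ∑ s', ∑ l, |θ.pre (j + 1) (Fin.snoc τ (s, a)) s' l -
        ∑ m, if σ m = l then θs.pre (j + 1) (Fin.snoc τ (s, a)) s' m else 0| ≤
      (∑ l, |θ.pre j τ s l - ∑ m, if σ m = l then θs.pre j τ s m else 0|) +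
        ∑ m, θs.pre j τ s m * kerDist θ θs (σ m) m s a := by
  have h1 : ∀ s' l, |θ.pre (j + 1) (Fin.snoc τ (s, a)) s' l -
        ∑ m, if σ m = l then θs.pre (j + 1) (Fin.snoc τ (s, a)) s' m else 0| ≤
      |θ.pre j τ s l - ∑ m, if σ m = l then θs.pre j τ s m else 0| * θ.ker l s a s' +
      ∑ m, if σ m = l then θs.pre j τ s m * |θ.ker (σ m) s a s' - θs.ker m s a s'| else 0 := by
    intro s' l
    have e : θ.pre (j + 1) (Fin.snoc τ (s, a)) s' l -
        ∑ m, (if σ m = l then θs.pre (j + 1) (Fin.snoc τ (s, a)) s' m else 0) =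
      (θ.pre j τ s l - ∑ m, if σ m = l then θs.pre j τ s m else 0) * θ.ker l s a s' +
      ∑ m, if σ m = l then θs.pre j τ s m * (θ.ker (σ m) s a s' - θs.ker m s a s') else 0 := by
      simp only [LMDP.pre_snoc]
      rw [sub_mul, Finset.sum_mul, sub_add, ← Finset.sum_sub_distrib]
      congr 1
      refine Finset.sum_congr rfl fun m _ => ?_
      split_ifs with h
      · rw [h]; ring
      · simp
    rw [e]
    refine (abs_add_le _ _).trans (add_le_add ?_ ((Finset.abs_sum_le_sum_abs _ _).trans
      (Finset.sum_le_sum fun m _ => ?_)))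
    · rw [abs_mul, abs_of_nonneg (θ.ker_nonneg _ _ _ _)]
    · split_ifs
      · rw [abs_mul, abs_of_nonneg (θs.pre_nonneg _ _ _ _)]
      · simp
  refine (Finset.sum_le_sum fun s' _ => Finset.sum_le_sum fun l _ => h1 s' l).trans
    (le_of_eq ?_)
  simp only [Finset.sum_add_distrib]
  congr 1
  · rw [Finset.sum_comm]
    simp only [← Finset.mul_sum, θ.sum_ker, mul_one]
  · simp only [kerDist, Finset.mul_sum]
    conv_rhs => rw [Finset.sum_comm]
    refine Finset.sum_congr rfl fun s' _ => ?_
    rw [Finset.sum_comm]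
    simp

/-- The matching reads only the state at step w, so a further step leaves it unchanged and adds just
the mismatch of the paired kernels. -/
theorem matchErr_succ_le (hκ : κ.IsProb) (σ : Fin L → S → Fin L) (w i : ℕ) :
    matchErr θ θs κ σ w (i + 1) ≤ matchErr θ θs κ σ w i +
      ∑ τ : Fin (w + i) → S × A, ∑ s, actWeight κ (w + i) τ * ∑ a, κ (w + i) τ s a *
        ∑ m, θs.pre (w + i) τ s m * kerDist θ θs (σ m (pref w i τ s).2) m s a := by
  have e : matchErr θ θs κ σ w (i + 1) = ∑ τ : Fin (w + i) → S × A, ∑ s,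
      actWeight κ (w + i) τ * ∑ a, κ (w + i) τ s a * ∑ s', ∑ l,
        |θ.pre (w + i + 1) (Fin.snoc τ (s, a)) s' l - ∑ m, if σ m (pref w i τ s).2 = l then
          θs.pre (w + i + 1) (Fin.snoc τ (s, a)) s' m else 0| := by
    refine (sum_snoc (w + i) _).trans ?_
    refine Finset.sum_congr rfl fun τ _ => Finset.sum_congr rfl fun s _ => ?_
    rw [Finset.mul_sum]
    refine Finset.sum_congr rfl fun a _ => ?_
    rw [← mul_assoc, Finset.mul_sum]
    refine Finset.sum_congr rfl fun s' _ => ?_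
    rw [pref_snoc]
    exact congrArg (· * _) (actWeight_snoc κ (w + i) τ (s, a))
  rw [e, matchErr]
  simp only [← Finset.sum_add_distrib]
  refine Finset.sum_le_sum fun τ _ => Finset.sum_le_sum fun s _ => ?_
  rw [← mul_add]
  refine mul_le_mul_of_nonneg_left ?_ (actWeight_nonneg hκ _ _)
  refine (Finset.sum_le_sum fun a _ => mul_le_mul_of_nonneg_left
    (sum_abs_matched_snoc_le (fun m => σ m (pref w i τ s).2) (w + i) τ s a)
    (hκ.nonneg _ _ _ _)).trans (le_of_eq ?_)
  simp only [mul_add, Finset.sum_add_distrib, ← Finset.sum_mul, hκ.sum_eq_one, one_mul]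

theorem sum_abs_obs_sub_le_matchErr (hκ : κ.IsProb) (σ : Fin L → S → Fin L) (w i : ℕ) :
    ∑ τ : Fin (w + i) → S × A, ∑ s, actWeight κ (w + i) τ *
        |θ.obs (w + i) τ s - θs.obs (w + i) τ s| ≤ matchErr θ θs κ σ w i := by
  refine Finset.sum_le_sum fun τ _ => Finset.sum_le_sum fun s _ =>
    mul_le_mul_of_nonneg_left ?_ (actWeight_nonneg hκ _ _)
  have : θ.obs (w + i) τ s - θs.obs (w + i) τ s = ∑ l, (θ.pre (w + i) τ s l -
      ∑ m, if σ m (pref w i τ s).2 = l then θs.pre (w + i) τ s m else 0) := by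
    rw [Finset.sum_sub_distrib, LMDP.obs, LMDP.obs]
    congr 1
    rw [Finset.sum_comm]
    simp
  rw [this]
  exact Finset.abs_sum_le_sum_abs _ _

open Classical in
/-- The probability under `θs` that the latent index is `x.1`, the state at step `w` is `x.2.1` and
the state at step `w + i` is `x.2.2`. -/
def occ (θs : LMDP L S A) (κ : ActionKernel S A) (w i : ℕ) (x : Fin L × S × S) : ℝ :=
  ∑ τ : Fin (w + i) → S × A, actWeight κ (w + i) τ *
    if (pref w i τ x.2.2).2 = x.2.1 then θs.pre (w + i) τ x.2.2 x.1 else 0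

/-- The largest distance over the actions between the kernels of `x.1` and of its match. -/
def kerGap (θ θs : LMDP L S A) (σ : Fin L → S → Fin L) (x : Fin L × S × S) : ℝ :=
  ⨆ a, kerDist θ θs (σ x.1 x.2.1) x.1 x.2.2 a

theorem kerDist_le_kerGap (σ : Fin L → S → Fin L) (m : Fin L) (s₁ s : S) (a : A) :
    kerDist θ θs (σ m s₁) m s a ≤ kerGap θ θs σ (m, s₁, s) :=
  le_ciSup (f := fun a => kerDist θ θs (σ m s₁) m s a) (Set.finite_range _).bddAbove a

theorem occ_nonneg (hκ : κ.IsProb) (w i : ℕ) (x : Fin L × S × S) : 0 ≤ occ θs κ w i x :=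
  Finset.sum_nonneg fun τ _ => mul_nonneg (actWeight_nonneg hκ _ _) (by
    split_ifs
    · exact θs.pre_nonneg _ _ _ _
    · exact le_rfl)

theorem sum_occ_mul (w i : ℕ) (g : Fin L × S × S → ℝ) :
    ∑ x, occ θs κ w i x * g x = ∑ τ : Fin (w + i) → S × A, ∑ s, actWeight κ (w + i) τ *
      ∑ m, θs.pre (w + i) τ s m * g (m, (pref w i τ s).2, s) := by
  classical
  simp only [occ, Finset.sum_mul]
  rw [Finset.sum_comm]
  refine Finset.sum_congr rfl fun τ _ => ?_
  rw [Fintype.sum_prod_type]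
  simp only [Fintype.sum_prod_type_right, Finset.mul_sum]
  rw [Finset.sum_comm]
  refine Finset.sum_congr rfl fun s _ => Finset.sum_congr rfl fun m _ => ?_
  rw [Finset.sum_eq_single (pref w i τ s).2]
  · simp [mul_assoc]
  · intro b _ hb
    simp [hb.symm]
  · simp

theorem sum_occ (hκ : κ.IsProb) (w i : ℕ) : ∑ x, occ θs κ w i x = 1 := by
  have := sum_occ_mul (θs := θs) (κ := κ) w i fun _ => 1
  simp only [mul_one] at this
  rw [this, ← θs.sum_obs hκ (w + i)]
  rfl

theorem occ_le_one (hκ : κ.IsProb) (w i : ℕ) (x : Fin L × S × S) : occ θs κ w i x ≤ 1 := by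
  rw [← sum_occ (θs := θs) hκ w i]
  exact Finset.single_le_sum (f := occ θs κ w i) (fun x _ => occ_nonneg hκ w i x)
    (Finset.mem_univ x)

theorem matchErr_succ_le_occ (hκ : κ.IsProb) (σ : Fin L → S → Fin L) (w i : ℕ) :
    matchErr θ θs κ σ w (i + 1) ≤ matchErr θ θs κ σ w i +
      ∑ x, occ θs κ w i x * kerGap θ θs σ x := by
  refine (matchErr_succ_le hκ σ w i).trans (add_le_add le_rfl ?_)
  rw [sum_occ_mul]
  refine Finset.sum_le_sum fun τ _ => Finset.sum_le_sum fun s _ =>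
    mul_le_mul_of_nonneg_left ?_ (actWeight_nonneg hκ _ _)
  calc _ ≤ ∑ a, κ (w + i) τ s a *
        ∑ m, θs.pre (w + i) τ s m * kerGap θ θs σ (m, (pref w i τ s).2, s) := by
        refine Finset.sum_le_sum fun a _ => mul_le_mul_of_nonneg_left ?_ (hκ.nonneg _ _ _ _)
        exact Finset.sum_le_sum fun m _ => mul_le_mul_of_nonneg_left
          (kerDist_le_kerGap σ _ _ _ a) (θs.pre_nonneg _ _ _ _)
    _ = _ := by rw [← Finset.sum_mul, hκ.sum_eq_one, one_mul]

theorem matchErr_le (hκ : κ.IsProb) (σ : Fin L → S → Fin L) (w i : ℕ) :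
    matchErr θ θs κ σ w i ≤ matchErr θ θs κ σ w 0 +
      ∑ j ∈ Finset.range i, ∑ x, occ θs κ w j x * kerGap θ θs σ x := by
  induction i with
  | zero => simp
  | succ i ih =>
    rw [Finset.sum_range_succ]
    linarith [matchErr_succ_le_occ (θ := θ) (θs := θs) hκ σ w i]

variable [Nonempty A]

theorem exists_kerGap_eq (θ θs : LMDP L S A) (σ : Fin L → S → Fin L) (x : Fin L × S × S) :
    ∃ a, kerDist θ θs (σ x.1 x.2.1) x.1 x.2.2 a = kerGap θ θs σ x :=
  exists_eq_ciSup_of_finite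

/-- The comparison with the matched index costs 2 past-decoding errors, one latent error and 2 bad
masses. Each bad mass is in turn at most 2 (past + future error) + 2 latent errors, whence 6, 4 and
5. -/
theorem matchErr_zero_le (πexp π : Policy (n + 1) S A) (hδ : 0 ≤ δ)
    (hθ : θ.StronglySeparated δ) {w k : ℕ} (hη : L * Real.exp (-(δ ^ 2 / 2)) ^ k ≤ 1 / 4) :
    matchErr θ θs π.ext (fun m s => matching θ θs πexp.ext s k m) w 0 ≤
      6 * (L * Real.exp (-(δ ^ 2 / 2)) ^ w) + 4 * (L * Real.exp (-(δ ^ 2 / 2)) ^ k) +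
        5 * latErr θ θs πexp.ext π.ext w k := by
  have h1 := pastDec_error_le (θ := θ) hδ hθ π.ext_isProb w
  have h2 := sum_badMass_le_latErr (θs := θs) πexp π hδ hθ (w := w) hη
  have h3 : matchErr θ θs π.ext (fun m s => matching θ θs πexp.ext s k m) w 0 ≤
      2 * (∑ τ : Fin w → S × A, ∑ s, actWeight π.ext w τ *
        ∑ m, if θ.pastDec w τ s ≠ m then θ.pre w τ s m else 0) +
      latErr θ θs πexp.ext π.ext w k +
      2 * ∑ τ : Fin w → S × A, ∑ s, actWeight π.ext w τ * badMass θ θs πexp.ext w τ s k := by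
    simp only [latErr, Finset.mul_sum _ _ (2 : ℝ), ← Finset.sum_add_distrib]
    refine Finset.sum_le_sum fun τ _ => Finset.sum_le_sum fun s _ => ?_
    have a1 := sum_abs_pre_sub_matching_le (θ := θ) (θs := θs) (κe := πexp.ext) w τ s k
    have a2 := abs_obs_sub_obs_le (θs := θs) hδ hθ πexp.ext_isProb w τ s k hη
    have hw := actWeight_nonneg π.ext_isProb w τ
    have := mul_le_mul_of_nonneg_left (a1.trans (add_le_add (add_le_add le_rfl a2) le_rfl)) hw
    refine this.trans (le_of_eq ?_)
    ring
  linarith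

end MatchedKernels

/-! ### Kernel distances of matched instances on past data -/

section InSample

variable {L n : ℕ} {S A : Type*} [Fintype S] [Fintype A] {κ κe : ActionKernel S A}
  {θ θs : LMDP L S A} {δ : ℝ}

theorem sq_sqrt_obs_sub_le (hκ : κ.IsProb) (j : ℕ) (τ : Fin j → S × A) (s : S) (k : ℕ) :
    (√(θ.obs j τ s) - √(θs.obs j τ s)) ^ 2 ≤ hellFut κ θ θs j τ s k := by
  have h := hell_sum_le (ι := (Fin k → S × A) × S) (ω := fun x => actWeight κ k x.1)
    (a := fun x => θ.preFut j τ s k x.1 x.2) (b := fun x => θs.preFut j τ s k x.1 x.2)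
    (fun x => actWeight_nonneg hκ _ _) (fun x => θ.preFut_nonneg _ _ _ _ _ _)
    (fun x => θs.preFut_nonneg _ _ _ _ _ _)
  simp only [Fintype.sum_prod_type, θs.sum_preFut hκ, θ.sum_preFut hκ] at h
  exact h

/-- If the past decoder of θs misses m, or that of θ misses the match of m, the trivial bound 2 on
the kernel distance is charged to the missed or unmatched mass. Otherwise both decoded indices are
the right ones and `pre_mul_kerDist_le` applies. -/
theorem pre_mul_kerDist_le_of_pref [DecidableEq S] (k w i : ℕ) (τ : Fin (w + i) → S × A)
    (m : Fin L) (s₁ s : S) (a : A) :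
    (if (pref w i τ s).2 = s₁ then θs.pre (w + i) τ s m else 0) *
        kerDist θ θs (matching θ θs κe s₁ k m) m s a ≤
      4 * missed θs w i τ s + 2 * missed θ w i τ s + 2 * unmatched θ θs κe k w i τ s +
      2 * ((if (pref w i τ s).2 = s₁ ∧ θs.pastDec w (pref w i τ s).1 (pref w i τ s).2 = m
        then 1 else 0) *
        ∑ s', |θ.obs (w + i + 1) (Fin.snoc τ (s, a)) s' -
          θs.obs (w + i + 1) (Fin.snoc τ (s, a)) s'|) := by
  have n1 := missed_nonneg (θ := θs) w i τ s
  have n2 := missed_nonneg (θ := θ) w i τ s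
  have n3 := unmatched_nonneg (θ := θ) (θs := θs) (κe := κe) k w i τ s
  have n4 : 0 ≤ ∑ s', |θ.obs (w + i + 1) (Fin.snoc τ (s, a)) s' -
          θs.obs (w + i + 1) (Fin.snoc τ (s, a)) s'| := Finset.sum_nonneg fun _ _ => abs_nonneg _
  have d0 := kerDist_nonneg θ θs (matching θ θs κe s₁ k m) m s a
  have d2 := kerDist_le_two θ θs (matching θ θs κe s₁ k m) m s a
  have p0 := θs.pre_nonneg (w + i) τ s m
  by_cases hs : (pref w i τ s).2 = s₁
  swap
  · simp only [hs, if_false, false_and, zero_mul]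
    linarith
  by_cases hm : θs.pastDec w (pref w i τ s).1 (pref w i τ s).2 = m
  swap
  · have : θs.pre (w + i) τ s m ≤ missed θs w i τ s := by
      have := Finset.single_le_sum (f := fun m =>
        if θs.pastDec w (pref w i τ s).1 (pref w i τ s).2 ≠ m then θs.pre (w + i) τ s m else 0)
        (fun m _ => by
          split_ifs
          · exact θs.pre_nonneg _ _ _ _
          · exact le_rfl) (Finset.mem_univ m)
      rwa [if_pos hm] at this
    rw [if_pos hs, if_neg fun h => hm h.2, zero_mul]
    nlinarith
  rw [if_pos hs, if_pos ⟨hs, hm⟩, one_mul]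
  by_cases hl : θ.pastDec w (pref w i τ s).1 (pref w i τ s).2 = matching θ θs κe s₁ k m
  swap
  · have : θs.pre (w + i) τ s m ≤ unmatched θ θs κe k w i τ s := by
      have := Finset.single_le_sum (f := fun m =>
        if θ.pastDec w (pref w i τ s).1 (pref w i τ s).2 ≠
          matching θ θs κe (pref w i τ s).2 k m then θs.pre (w + i) τ s m else 0)
        (fun m _ => by
          split_ifs
          · exact θs.pre_nonneg _ _ _ _
          · exact le_rfl) (Finset.mem_univ m)
      rwa [if_pos (by subst hs; exact hl)] at this
    nlinarith
  have h := pre_mul_kerDist_le θ θs (w + i) τ s a (matching θ θs κe s₁ k m) m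
  rw [← hl] at h ⊢
  have h' : (∑ m', if m ≠ m' then θs.pre (w + i) τ s m' else 0) = missed θs w i τ s := by
    rw [missed, hm]
  rw [h'] at h
  change _ ≤ 2 * missed θs w i τ s + 2 * missed θ w i τ s + _ at h
  linarith

theorem sqrt_add_le {x y : ℝ} (hx : 0 ≤ x) (hy : 0 ≤ y) : √(x + y) ≤ √x + √y := by
  rw [Real.sqrt_le_iff]
  refine ⟨by positivity, ?_⟩
  nlinarith [Real.sq_sqrt hx, Real.sq_sqrt hy, mul_nonneg (Real.sqrt_nonneg x) (Real.sqrt_nonneg y)]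

theorem add_two_sqrt_mono {D D' Q Q' : ℝ} (hQ0 : 0 ≤ Q) (hD0 : 0 ≤ D) (hD : D ≤ D')
    (hQ : Q ≤ Q') : D + 2 * √(D * Q) ≤ D' + 2 * √(D' * Q') := by
  have : 0 ≤ D' := hD0.trans hD
  gcongr

variable [Nonempty A]

/-- Sum the pointwise bound over the histories of one cell, at the maximizing action. The mass under
the square root is that of the cell itself, up to decoding error, which is what the pigeonhole
argument needs. -/
theorem occ_mul_kerGap_le (πexp π : Policy (n + 1) S A) (hδ : 0 ≤ δ)
    (hθ : θ.StronglySeparated δ) (hθs : θs.StronglySeparated δ) {w i k k' : ℕ} (hn : w + k = n)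
    (hn' : w + i + 1 + k' = n) (x : Fin L × S × S) :
    occ θs π.ext w i x * kerGap θ θs (fun m s => matching θ θs πexp.ext s k m) x ≤
      14 * (L * Real.exp (-(δ ^ 2 / 2)) ^ w) + 8 * (L * Real.exp (-(δ ^ 2 / 2)) ^ k) +
      8 * (Fintype.card A * hellSq (Policy.phi πexp w π).ext n θ θs) +
      2 * (Fintype.card A * hellSq (Policy.phi πexp (w + i + 1) π).ext n θ θs) +
      4 * √(Fintype.card A * hellSq (Policy.phi πexp (w + i + 1) π).ext n θ θs *
        (occ θs π.ext w i x + L * Real.exp (-(δ ^ 2 / 2)) ^ w)) := by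
  classical
  obtain ⟨m, s₁, s⟩ := x
  obtain ⟨a, ha⟩ := exists_kerGap_eq θ θs (fun m s => matching θ θs πexp.ext s k m) (m, s₁, s)
  rw [← ha]
  have hw : ∀ τ, 0 ≤ actWeight π.ext (w + i) τ := actWeight_nonneg π.ext_isProb _
  have hone : ∀ f : (Fin (w + i) → S × A) → S → ℝ, (∀ τ s, 0 ≤ f τ s) →
      ∑ τ, actWeight π.ext (w + i) τ * f τ s ≤ ∑ τ, ∑ s, actWeight π.ext (w + i) τ * f τ s :=
    fun f hf => Finset.sum_le_sum fun τ _ => Finset.single_le_sum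
      (f := fun s => actWeight π.ext (w + i) τ * f τ s)
      (fun s _ => mul_nonneg (hw τ) (hf τ s)) (Finset.mem_univ s)
  have b1 := (hone (missed θs w i) (missed_nonneg w i)).trans
    (sum_missed_le hδ hθs π.ext_isProb w i)
  have b2 := (hone (missed θ w i) (missed_nonneg w i)).trans
    (sum_missed_le hδ hθ π.ext_isProb w i)
  have b3 := ((hone (unmatched θ θs πexp.ext k w i) (unmatched_nonneg k w i)).trans
    (sum_unmatched π.ext_isProb k w i).le).trans (sum_badMass_le_hellSq πexp π hδ hθ hn)
  -- The cell is cut out by the decoded index rather than by the true one, so the indicator is a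
  -- function of the history and the Hellinger comparison of observable laws stays available.
  set ind : (Fin (w + i) → S × A) → ℝ := fun τ =>
    if (pref w i τ s).2 = s₁ ∧ θs.pastDec w (pref w i τ s).1 (pref w i τ s).2 = m
        then 1 else 0 with hind
  have ind0 : ∀ τ, 0 ≤ ind τ := fun τ => by simp only [hind]; split_ifs <;> norm_num
  have ind1 : ∀ τ, ind τ ≤ 1 := fun τ => by simp only [hind]; split_ifs <;> norm_num
  have b4 : ∑ τ, actWeight π.ext (w + i) τ * (ind τ * ∑ s',
      |θ.obs (w + i + 1) (Fin.snoc τ (s, a)) s' - θs.obs (w + i + 1) (Fin.snoc τ (s, a)) s'|) ≤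
      Fintype.card A * hellSq (Policy.phi πexp (w + i + 1) π).ext n θ θs +
      2 * √(Fintype.card A * hellSq (Policy.phi πexp (w + i + 1) π).ext n θ θs *
        (occ θs π.ext w i (m, s₁, s) + L * Real.exp (-(δ ^ 2 / 2)) ^ w)) := by
    have h := sum_abs_sub_le_hell (ι := (Fin (w + i) → S × A) × S)
      (ω := fun y => actWeight π.ext (w + i) y.1 * ind y.1)
      (a := fun y => θ.obs (w + i + 1) (Fin.snoc y.1 (s, a)) y.2)
      (b := fun y => θs.obs (w + i + 1) (Fin.snoc y.1 (s, a)) y.2)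
      (fun y => mul_nonneg (hw _) (ind0 _)) (fun y => θ.obs_nonneg _ _ _)
      (fun y => θs.obs_nonneg _ _ _)
    simp only [Fintype.sum_prod_type, ← Finset.mul_sum, LMDP.sum_obs_snoc, mul_assoc] at h
    refine h.trans (add_two_sqrt_mono ?_ ?_ ?_ ?_)
    · exact Finset.sum_nonneg fun τ _ => mul_nonneg (hw τ) (mul_nonneg (ind0 τ)
        (θs.obs_nonneg _ _ _))
    · exact Finset.sum_nonneg fun τ _ => mul_nonneg (hw τ) (mul_nonneg (ind0 τ)
        (Finset.sum_nonneg fun _ _ => sq_nonneg _))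
    · rw [← sum_hellFut_snoc_eq πexp π hn' θ θs]
      refine le_trans ?_ (hone (fun τ s => ∑ a, ∑ s', hellFut πexp.ext θ θs (w + i + 1)
        (Fin.snoc τ (s, a)) s' k') fun τ s => Finset.sum_nonneg fun _ _ =>
          Finset.sum_nonneg fun _ _ => hellFut_nonneg πexp.ext_isProb _ _ _ _ _ _)
      refine Finset.sum_le_sum fun τ _ => mul_le_mul_of_nonneg_left ?_ (hw τ)
      calc _ ≤ ∑ s', (√(θ.obs (w + i + 1) (Fin.snoc τ (s, a)) s') -
            √(θs.obs (w + i + 1) (Fin.snoc τ (s, a)) s')) ^ 2 :=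
            mul_le_of_le_one_left (Finset.sum_nonneg fun _ _ => sq_nonneg _) (ind1 τ)
        _ ≤ ∑ s', hellFut πexp.ext θ θs (w + i + 1) (Fin.snoc τ (s, a)) s' k' :=
            Finset.sum_le_sum fun s' _ => sq_sqrt_obs_sub_le πexp.ext_isProb _ _ _ _
        _ ≤ _ := Finset.single_le_sum (f := fun a => ∑ s', hellFut πexp.ext θ θs (w + i + 1)
              (Fin.snoc τ (s, a)) s' k') (fun a _ => Finset.sum_nonneg fun _ _ =>
                hellFut_nonneg πexp.ext_isProb _ _ _ _ _ _) (Finset.mem_univ a)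
    · refine le_trans ?_ (add_le_add le_rfl b1)
      rw [occ, ← Finset.sum_add_distrib]
      refine Finset.sum_le_sum fun τ _ => ?_
      rw [← mul_add]
      refine mul_le_mul_of_nonneg_left ?_ (hw τ)
      have n1 := missed_nonneg (θ := θs) w i τ s
      have p0 := θs.pre_nonneg (w + i) τ s m
      simp only [hind]
      split_ifs with h1 h2 h2
      · have := sum_eq_add_sum_ne m (θs.pre (w + i) τ s)
        rw [one_mul, LMDP.obs, this, missed, h1.2]
      · exact absurd h1.1 h2
      · linarith
      · linarith
  have key : occ θs π.ext w i (m, s₁, s) * kerDist θ θs (matching θ θs πexp.ext s₁ k m) m s a ≤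
      4 * (∑ τ, actWeight π.ext (w + i) τ * missed θs w i τ s) +
      2 * (∑ τ, actWeight π.ext (w + i) τ * missed θ w i τ s) +
      2 * (∑ τ, actWeight π.ext (w + i) τ * unmatched θ θs πexp.ext k w i τ s) +
      2 * ∑ τ, actWeight π.ext (w + i) τ * (ind τ * ∑ s',
        |θ.obs (w + i + 1) (Fin.snoc τ (s, a)) s' -
          θs.obs (w + i + 1) (Fin.snoc τ (s, a)) s'|) := by
    rw [occ, Finset.sum_mul]
    simp only [Finset.mul_sum _ _ (2 : ℝ), Finset.mul_sum _ _ (4 : ℝ), ← Finset.sum_add_distrib]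
    refine Finset.sum_le_sum fun τ _ => ?_
    have := mul_le_mul_of_nonneg_left (pre_mul_kerDist_le_of_pref (θ := θ) (θs := θs)
      (κe := πexp.ext) k w i τ m s₁ s a) (hw τ)
    rw [mul_assoc]
    refine this.trans (le_of_eq ?_)
    simp only [hind]
    ring
  refine key.trans ?_
  linarith

end InSample

/-! ### From past data to the prediction errors of all rounds -/

section OutOfSample

variable {L n : ℕ} {S A : Type*} [Fintype S] [Fintype A] {δ : ℝ} [Nonempty A]

theorem sum_occ_mul_kerGap_le (πexp : Policy (n + 1) S A) (π : ℕ → Policy (n + 1) S A)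
    (θ : ℕ → LMDP L S A) (θs : LMDP L S A) (hδ : 0 ≤ δ)
    (hθ : ∀ r, (θ r).StronglySeparated δ) (hθs : θs.StronglySeparated δ) {w i k k' K : ℕ}
    (hn : w + k = n) (hn' : w + i + 1 + k' = n) {h₀ : ℝ} (h₀0 : 0 ≤ h₀)
    (hh : ∀ r < K, ∀ i ≤ n,
      ∑ t ∈ Finset.range r, hellSq (Policy.phi πexp i (π t)).ext n (θ r) θs ≤ h₀)
    {U : ℝ} (hU : K * (16 * (L * Real.exp (-(δ ^ 2 / 2)) ^ w) +
      8 * (L * Real.exp (-(δ ^ 2 / 2)) ^ k)) + 12 * (Fintype.card A * h₀) ≤ U)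
    (x : Fin L × S × S) :
    ∑ r ∈ Finset.range K, occ θs (π r).ext w i x *
        kerGap (θ r) θs (fun m s => matching (θ r) θs πexp.ext s k m) x ≤
      6 * ((U + 1) * Real.log (1 + K / (U + 1))) +
        3 * √(16 * (Fintype.card A * h₀) * ((∑ r ∈ Finset.range K, occ θs (π r).ext w i x) + 1)) := by
  set P : ℕ → ℝ := fun r => occ θs (π r).ext w i x with hP
  set G : ℕ → ℝ := fun r => kerGap (θ r) θs (fun m s => matching (θ r) θs πexp.ext s k m) x with hG
  set e := L * Real.exp (-(δ ^ 2 / 2)) ^ w with he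
  set η := L * Real.exp (-(δ ^ 2 / 2)) ^ k with hη
  have e0 : 0 ≤ e := by positivity
  have η0 : 0 ≤ η := by positivity
  have hP0 : ∀ r, 0 ≤ P r := fun r => occ_nonneg (π r).ext_isProb _ _ _
  have hP1 : ∀ r, P r ≤ 1 := fun r => occ_le_one (π r).ext_isProb _ _ _
  have hG2 : ∀ r, G r ≤ 2 := fun r => by
    obtain ⟨a, ha⟩ := exists_kerGap_eq (θ r) θs (fun m s => matching (θ r) θs πexp.ext s k m) x
    simp only [hG]; rw [← ha]; exact kerDist_le_two _ _ _ _ _ _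
  have hAh : 0 ≤ Fintype.card A * h₀ := by positivity
  have hK0 : (0 : ℝ) ≤ K := by positivity
  have hU0 : 0 ≤ U := le_trans (by positivity) hU
  refine sum_le_of_pigeonhole hP0 hP1 hG2 hU0 (by positivity) fun r hr => ?_
  set X : ℕ → ℝ := fun t => Fintype.card A * hellSq (Policy.phi πexp (w + i + 1) (π t)).ext n (θ r) θs
    with hX
  set Y : ℕ → ℝ := fun t => Fintype.card A * hellSq (Policy.phi πexp w (π t)).ext n (θ r) θs
    with hY
  have hX0 : ∀ t, 0 ≤ X t := fun t => mul_nonneg (by positivity)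
    (hellSq_nonneg (Policy.ext_isProb _) _ _ _)
  have hXs : ∑ t ∈ Finset.range r, X t ≤ Fintype.card A * h₀ := by
    rw [hX, ← Finset.mul_sum]
    exact mul_le_mul_of_nonneg_left (hh r hr _ (by omega)) (by positivity)
  have hYs : ∑ t ∈ Finset.range r, Y t ≤ Fintype.card A * h₀ := by
    rw [hY, ← Finset.mul_sum]
    exact mul_le_mul_of_nonneg_left (hh r hr _ (by omega)) (by positivity)
  have h1 : (∑ t ∈ Finset.range r, P t) * G r ≤ ∑ t ∈ Finset.range r,
      (14 * e + 8 * η + 8 * Y t + 2 * X t + 4 * √(X t * (P t + e))) := by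
    rw [Finset.sum_mul]
    exact Finset.sum_le_sum fun t _ => occ_mul_kerGap_le πexp (π t) hδ (hθ r) hθs hn hn' x
  have h2 : ∑ t ∈ Finset.range r, √(X t * (P t + e)) ≤
      √((∑ t ∈ Finset.range r, X t) * ∑ t ∈ Finset.range r, (P t + e)) := by
    rw [Real.sqrt_mul (Finset.sum_nonneg fun t _ => hX0 t)]
    simp only [Real.sqrt_mul (hX0 _)]
    exact Real.sum_sqrt_mul_sqrt_le _ hX0 fun t => add_nonneg (hP0 t) e0
  set N := ∑ t ∈ Finset.range r, P t with hN
  have hN0 : 0 ≤ N := Finset.sum_nonneg fun t _ => hP0 t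
  have hrK : (r : ℝ) ≤ K := by exact_mod_cast hr.le
  -- The decoding error is split off the root by the inequality of arithmetic and geometric means.
  -- Together with the linear terms this gives the coefficients 14 + 2 = 16 and 8 + 2 + 2 = 12 in
  -- `hU`.
  have h3 : √((∑ t ∈ Finset.range r, X t) * ∑ t ∈ Finset.range r, (P t + e)) ≤
      √((Fintype.card A * h₀) * N) + (Fintype.card A * h₀ + K * e) / 2 := by
    have a1 : ∑ t ∈ Finset.range r, (P t + e) ≤ N + K * e := by
      rw [Finset.sum_add_distrib, Finset.sum_const, Finset.card_range, nsmul_eq_mul]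
      have := mul_le_mul_of_nonneg_right hrK e0
      linarith
    have a2 : (0 : ℝ) ≤ K * e := by positivity
    calc _ ≤ √((Fintype.card A * h₀) * (N + K * e)) := Real.sqrt_le_sqrt (mul_le_mul hXs a1
          (Finset.sum_nonneg fun t _ => add_nonneg (hP0 t) e0) hAh)
      _ ≤ √((Fintype.card A * h₀) * N) + √((Fintype.card A * h₀) * (K * e)) := by
          rw [mul_add]; exact sqrt_add_le (by positivity) (by positivity)
      _ ≤ _ := by
          refine add_le_add le_rfl ?_
          rw [Real.sqrt_le_iff]
          refine ⟨by positivity, ?_⟩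
          nlinarith [sq_nonneg (Fintype.card A * h₀ - K * e)]
  have h4 : √(16 * (Fintype.card A * h₀) * N) = 4 * √((Fintype.card A * h₀) * N) := by
    rw [mul_assoc, Real.sqrt_mul (by norm_num)]
    congr 1
    rw [show (16 : ℝ) = 4 ^ 2 by norm_num]
    exact Real.sqrt_sq (by norm_num)
  have h5 : ∑ t ∈ Finset.range r, (14 * e + 8 * η + 8 * Y t + 2 * X t + 4 * √(X t * (P t + e))) =
      r * (14 * e + 8 * η) + 8 * (∑ t ∈ Finset.range r, Y t) + 2 * (∑ t ∈ Finset.range r, X t) +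
        4 * ∑ t ∈ Finset.range r, √(X t * (P t + e)) := by
    simp only [Finset.sum_add_distrib, ← Finset.mul_sum, Finset.sum_const, Finset.card_range,
      nsmul_eq_mul]
    ring
  rw [h4]
  have h6 : (r : ℝ) * (14 * e + 8 * η) ≤ K * (14 * e + 8 * η) :=
    mul_le_mul_of_nonneg_right hrK (by positivity)
  rw [h5] at h1
  linarith

/-- The learning rate of the matched kernels at a single step. -/
def kerRate (L S A K : ℕ) (h₀ U : ℝ) : ℝ :=
  (L * S ^ 2) * (6 * ((U + 1) * Real.log (1 + K / (U + 1)))) +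
    3 * √(16 * (A * h₀) * ((L * S ^ 2) * (K + L * S ^ 2)))

theorem sum_sum_occ_mul_kerGap_le (πexp : Policy (n + 1) S A) (π : ℕ → Policy (n + 1) S A)
    (θ : ℕ → LMDP L S A) (θs : LMDP L S A) (hδ : 0 ≤ δ)
    (hθ : ∀ r, (θ r).StronglySeparated δ) (hθs : θs.StronglySeparated δ) {w i k k' K : ℕ}
    (hn : w + k = n) (hn' : w + i + 1 + k' = n) {h₀ : ℝ} (h₀0 : 0 ≤ h₀)
    (hh : ∀ r < K, ∀ i ≤ n,
      ∑ t ∈ Finset.range r, hellSq (Policy.phi πexp i (π t)).ext n (θ r) θs ≤ h₀)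
    {U : ℝ} (hU : K * (16 * (L * Real.exp (-(δ ^ 2 / 2)) ^ w) +
      8 * (L * Real.exp (-(δ ^ 2 / 2)) ^ k)) + 12 * (Fintype.card A * h₀) ≤ U) :
    ∑ r ∈ Finset.range K, ∑ x, occ θs (π r).ext w i x *
        kerGap (θ r) θs (fun m s => matching (θ r) θs πexp.ext s k m) x ≤
      kerRate L (Fintype.card S) (Fintype.card A) K h₀ U := by
  rw [Finset.sum_comm]
  refine (Finset.sum_le_sum fun x _ => sum_occ_mul_kerGap_le πexp π θ θs hδ hθ hθs hn hn' h₀0 hh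
    hU x).trans ?_
  have hcard : (Fintype.card (Fin L × S × S) : ℝ) = L * Fintype.card S ^ 2 := by
    simp [Fintype.card_prod, sq]
  rw [Finset.sum_add_distrib, Finset.sum_const, Finset.card_univ, nsmul_eq_mul, hcard, kerRate,
    ← Finset.mul_sum]
  refine add_le_add le_rfl (mul_le_mul_of_nonneg_left ?_ (by norm_num))
  have hB : 0 ≤ 16 * (Fintype.card A * h₀) := by positivity
  have hq : ∀ x, 0 ≤ (∑ r ∈ Finset.range K, occ θs (π r).ext w i x) + 1 := fun x =>
    add_nonneg (Finset.sum_nonneg fun r _ => occ_nonneg (π r).ext_isProb _ _ _) zero_le_one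
  -- Cauchy–Schwarz over the L S² cells, whose occupancies sum to one in every round.
  have h1 := sum_sqrt_mul_le_sqrt (ι := Fin L × S × S) (ω := fun _ => 1)
    (a := fun _ => 16 * (Fintype.card A * h₀))
    (b := fun x => (∑ r ∈ Finset.range K, occ θs (π r).ext w i x) + 1)
    (fun _ => zero_le_one) (fun _ => hB) hq
  simp only [one_mul, ← Real.sqrt_mul hB] at h1
  refine h1.trans (le_of_eq ?_)
  congr 1
  rw [Finset.sum_add_distrib, Finset.sum_comm]
  simp only [sum_occ (Policy.ext_isProb _), Finset.sum_const, Finset.card_univ, hcard,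
    Finset.card_range, nsmul_eq_mul, mul_one]
  ring

variable [Nonempty S]

/-- The sum of the prediction errors over the rounds. -/
theorem sum_abs_obs_sub_le (πexp : Policy (n + 1) S A) (π : ℕ → Policy (n + 1) S A)
    (θ : ℕ → LMDP L S A) (θs : LMDP L S A) (hδ : 0 ≤ δ)
    (hθ : ∀ r, (θ r).StronglySeparated δ) (hθs : θs.StronglySeparated δ) {w k K : ℕ}
    (hn : w + k = n) (hη : L * Real.exp (-(δ ^ 2 / 2)) ^ k ≤ 1 / 4) {h₀ : ℝ} (h₀0 : 0 ≤ h₀)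
    (hh : ∀ r < K, ∀ i ≤ n,
      ∑ t ∈ Finset.range r, hellSq (Policy.phi πexp i (π t)).ext n (θ r) θs ≤ h₀)
    {U : ℝ} (hU : K * (16 * (L * Real.exp (-(δ ^ 2 / 2)) ^ w) +
      8 * (L * Real.exp (-(δ ^ 2 / 2)) ^ k)) + 12 * (Fintype.card A * h₀) ≤ U) :
    ∑ r ∈ Finset.range K, ∑ τ : Fin n → S × A, ∑ s, actWeight (π r).ext n τ *
        |(θ r).obs n τ s - θs.obs n τ s| ≤
      K * (6 * (L * Real.exp (-(δ ^ 2 / 2)) ^ w) + 4 * (L * Real.exp (-(δ ^ 2 / 2)) ^ k)) +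
      5 * ((w + 1) * stepRate L (Fintype.card S) (Fintype.card A) K h₀) +
      k * kerRate L (Fintype.card S) (Fintype.card A) K h₀ U := by
  have h1 := sum_latErr_le πexp π θ θs hδ hθ hn hη h₀0 hh
  have h2 : ∀ i ∈ Finset.range k, ∑ r ∈ Finset.range K, ∑ x, occ θs (π r).ext w i x *
        kerGap (θ r) θs (fun m s => matching (θ r) θs πexp.ext s k m) x ≤
      kerRate L (Fintype.card S) (Fintype.card A) K h₀ U := fun i hi => by
    have hi' := Finset.mem_range.1 hi
    exact sum_sum_occ_mul_kerGap_le πexp π θ θs hδ hθ hθs hn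
      (k' := k - (i + 1)) (by omega) h₀0 hh hU
  have h3 := Finset.sum_le_sum h2
  rw [Finset.sum_comm, Finset.sum_const, Finset.card_range, nsmul_eq_mul] at h3
  subst hn
  have h4 : ∀ r ∈ Finset.range K, ∑ τ : Fin (w + k) → S × A, ∑ s, actWeight (π r).ext (w + k) τ *
        |(θ r).obs (w + k) τ s - θs.obs (w + k) τ s| ≤
      6 * (L * Real.exp (-(δ ^ 2 / 2)) ^ w) + 4 * (L * Real.exp (-(δ ^ 2 / 2)) ^ k) +
        5 * latErr (θ r) θs πexp.ext (π r).ext w k +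
      ∑ i ∈ Finset.range k, ∑ x, occ θs (π r).ext w i x *
        kerGap (θ r) θs (fun m s => matching (θ r) θs πexp.ext s k m) x := fun r _ =>
    (sum_abs_obs_sub_le_matchErr (π r).ext_isProb
      (fun m s => matching (θ r) θs πexp.ext s k m) w k).trans
      ((matchErr_le (π r).ext_isProb _ w k).trans
        (add_le_add (matchErr_zero_le πexp (π r) hδ (hθ r) hη) le_rfl))
  refine (Finset.sum_le_sum h4).trans ?_
  rw [Finset.sum_add_distrib, Finset.sum_add_distrib, ← Finset.mul_sum, Finset.sum_const,
    Finset.card_range, nsmul_eq_mul]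
  linarith

end OutOfSample

/-! ### A likelihood ratio supermartingale for adaptive data -/

section SequentialLikelihood

variable {X : Type*}

/-- The product of conditional weights along a sequence. -/
def seqProd (p : (k : ℕ) → (Fin k → X) → X → ℝ) : (k : ℕ) → (Fin k → X) → ℝ
  | 0, _ => 1
  | k + 1, τ => seqProd p k (Fin.init τ) * p k (Fin.init τ) (τ (Fin.last k))

/-- The property `P` holds for all prefixes of a sequence. -/
def seqGood (P : (k : ℕ) → (Fin k → X) → Prop) : (k : ℕ) → (Fin k → X) → Prop
  | 0, τ => P 0 τ
  | k + 1, τ => seqGood P k (Fin.init τ) ∧ P (k + 1) τ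

variable {p r : (k : ℕ) → (Fin k → X) → X → ℝ}

theorem seqProd_take (p : (k : ℕ) → (Fin k → X) → X → ℝ) (x : ℕ → X) (k : ℕ) :
    seqProd p k (fun i => x i) = ∏ t ∈ Finset.range k, p t (fun i => x i) (x t) := by
  induction k with
  | zero => rfl
  | succ k ih => rw [Finset.prod_range_succ, ← ih]; rfl

theorem seqGood_take {P : (k : ℕ) → (Fin k → X) → Prop} {x : ℕ → X} {K : ℕ}
    (h : seqGood P K fun i => x i) {k : ℕ} (hk : k ≤ K) : P k fun i => x i := by
  induction K with
  | zero =>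
    obtain rfl : k = 0 := by omega
    exact h
  | succ K ih =>
    rcases Nat.lt_or_ge K k with h1 | h1
    · obtain rfl : k = K + 1 := by omega
      exact h.2
    · exact ih h.1 h1

theorem seqProd_nonneg (hp : ∀ k τ x, 0 ≤ p k τ x) (k : ℕ) (τ : Fin k → X) :
    0 ≤ seqProd p k τ := by
  induction k with
  | zero => exact zero_le_one
  | succ k ih => exact mul_nonneg (ih _) (hp _ _ _)

variable [Fintype X]

theorem sum_seqProd_succ (k : ℕ) (F : (Fin k → X) → X → ℝ) :
    ∑ τ : Fin (k + 1) → X, seqProd p k (Fin.init τ) * F (Fin.init τ) (τ (Fin.last k)) =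
      ∑ τ, seqProd p k τ * ∑ x, F τ x := by
  rw [← (Fin.snocEquiv fun _ : Fin (k + 1) => X).sum_comp, Fintype.sum_prod_type_right]
  simp only [Finset.mul_sum]
  refine Finset.sum_congr rfl fun τ _ => Finset.sum_congr rfl fun x _ => ?_
  simp [Fin.snocEquiv]

/-- The product of the factors `r` is a nonnegative supermartingale under the law `p`; the last
factor is integrated out first. -/
theorem sum_seqProd_mul_le (hp : ∀ k τ x, 0 ≤ p k τ x) (hr : ∀ k τ x, 0 ≤ r k τ x)
    (h : ∀ k τ, ∑ x, p k τ x * r k τ x ≤ 1) (k : ℕ) :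
    ∑ τ, seqProd p k τ * seqProd r k τ ≤ 1 := by
  induction k with
  | zero => simp [seqProd]
  | succ k ih =>
    calc _ = ∑ τ : Fin (k + 1) → X, seqProd p k (Fin.init τ) * (seqProd r k (Fin.init τ) *
          (p k (Fin.init τ) (τ (Fin.last k)) * r k (Fin.init τ) (τ (Fin.last k)))) := by
          refine Finset.sum_congr rfl fun τ _ => ?_
          rw [seqProd, seqProd]
          ring
      _ = ∑ τ, seqProd p k τ * (seqProd r k τ * ∑ x, p k τ x * r k τ x) := by
          rw [sum_seqProd_succ k fun τ x => seqProd r k τ * (p k τ x * r k τ x)]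
          simp only [Finset.mul_sum]
      _ ≤ ∑ τ, seqProd p k τ * seqProd r k τ := by
          refine Finset.sum_le_sum fun τ _ => mul_le_mul_of_nonneg_left ?_ (seqProd_nonneg hp _ _)
          exact mul_le_of_le_one_right (seqProd_nonneg hr _ _) (h k τ)
      _ ≤ 1 := ih

theorem sum_seqProd (hp1 : ∀ k τ, ∑ x, p k τ x = 1) (k : ℕ) : ∑ τ, seqProd p k τ = 1 := by
  induction k with
  | zero => simp [seqProd]
  | succ k ih =>
    simp only [seqProd]
    rw [sum_seqProd_succ k fun τ x => p k τ x]
    simp [hp1, ih]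

-- A union bound over the K + 1 prefixes. Later steps have conditional mass one, so they do not
-- change the probability of a prefix event.
open Classical in
theorem sum_not_seqGood_le (hp : ∀ k τ x, 0 ≤ p k τ x) (hp1 : ∀ k τ, ∑ x, p k τ x = 1)
    {P : (k : ℕ) → (Fin k → X) → Prop} {c : ℝ}
    (h : ∀ k, ∑ τ, (if P k τ then 0 else seqProd p k τ) ≤ c) (K : ℕ) :
    ∑ τ, (if seqGood P K τ then 0 else seqProd p K τ) ≤ (K + 1) * c := by
  induction K with
  | zero =>
    refine le_trans (le_of_eq ?_) (le_of_le_of_eq (h 0) (by simp))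
    exact Finset.sum_congr rfl fun τ _ => by by_cases hP : P 0 τ <;> simp [seqGood, hP]
  | succ K ih =>
    calc _ ≤ ∑ τ : Fin (K + 1) → X, (seqProd p K (Fin.init τ) *
            ((if seqGood P K (Fin.init τ) then 0 else 1) *
              p K (Fin.init τ) (τ (Fin.last K))) +
            if P (K + 1) τ then 0 else seqProd p (K + 1) τ) := by
          refine Finset.sum_le_sum fun τ _ => ?_
          have h1 := seqProd_nonneg hp K (Fin.init τ)
          have h2 := hp K (Fin.init τ) (τ (Fin.last K))
          have h3 := mul_nonneg h1 h2
          by_cases g1 : seqGood P K (Fin.init τ) <;> by_cases g2 : P (K + 1) τ <;>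
            simp [seqGood, seqProd, g1, g2, h3]
      _ = (∑ τ : Fin K → X, if seqGood P K τ then 0 else seqProd p K τ) +
            ∑ τ, (if P (K + 1) τ then 0 else seqProd p (K + 1) τ) := by
          rw [Finset.sum_add_distrib, sum_seqProd_succ K fun τ x =>
            (if seqGood P K τ then 0 else 1) * p K τ x]
          simp only [← Finset.mul_sum, hp1, mul_one, mul_ite, mul_zero]
      _ ≤ _ := by
          push_cast
          linarith [h (K + 1)]

/-- The factor of the likelihood ratio supermartingale. -/
def likRatio (p q : X → ℝ) (x : X) : ℝ := √(q x / p x) * Real.exp (1 - ∑ y, √(q y * p y))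

theorem likRatio_nonneg (p q : X → ℝ) (x : X) : 0 ≤ likRatio p q x := by
  unfold likRatio; positivity

/-- The expectation of √(q/p) is at most b = ∑ √(q p), and b ≤ exp(b - 1). Nothing is asked of the
total mass of q, so upper brackets are allowed. -/
theorem sum_mul_likRatio_le {p q : X → ℝ} (hp : ∀ x, 0 ≤ p x) :
    ∑ x, p x * likRatio p q x ≤ 1 := by
  set b := ∑ y, √(q y * p y) with hb
  have h1 : ∀ x, p x * likRatio p q x = √(q x * p x) * Real.exp (1 - b) := fun x => by
    rw [likRatio, ← mul_assoc]
    congr 1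
    rcases (hp x).eq_or_lt with h | h
    · simp [← h]
    · have : q x * p x = (p x) ^ 2 * (q x / p x) := by field_simp
      rw [this, Real.sqrt_mul (sq_nonneg _), Real.sqrt_sq h.le]
  simp only [h1, ← Finset.sum_mul]
  rw [← hb]
  have h2 := Real.add_one_le_exp (b - 1)
  calc b * Real.exp (1 - b) ≤ Real.exp (b - 1) * Real.exp (1 - b) :=
        mul_le_mul_of_nonneg_right (by linarith) (Real.exp_pos _).le
    _ = 1 := by rw [← Real.exp_add]; simp

/-- The square of the factor is (q/p) exp(2 - 2b), while the squared Hellinger distance is 2 - 2 ∑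
√(p' p). Replacing p' by its bracket adds mass at most ξ², which raises b by at most ξ by
Cauchy–Schwarz. -/
theorem mul_exp_hell_le {p p' q : X → ℝ} (hp : ∀ x, 0 ≤ p x) (hp1 : ∑ x, p x = 1)
    (hp' : ∀ x, 0 ≤ p' x) (hp'1 : ∑ x, p' x = 1) (hq : ∀ x, p' x ≤ q x) {ξ : ℝ} (hξ : 0 ≤ ξ)
    (hq1 : ∑ x, q x ≤ 1 + ξ ^ 2) {x : X} (hx : 0 < p x) :
    p' x * Real.exp (∑ y, (√(p' y) - √(p y)) ^ 2) ≤
      p x * likRatio p q x ^ 2 * Real.exp (2 * ξ) := by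
  set b := ∑ y, √(q y * p y) with hb
  set D := ∑ y, (√(p' y) - √(p y)) ^ 2 with hD
  have h1 : D = 2 - 2 * ∑ y, √(p' y * p y) := by
    have : ∀ y, (√(p' y) - √(p y)) ^ 2 = p' y + p y - 2 * √(p' y * p y) := fun y => by
      rw [Real.sqrt_mul (hp' y), sub_sq, Real.sq_sqrt (hp' y), Real.sq_sqrt (hp y)]; ring
    simp only [hD, this, Finset.sum_sub_distrib, Finset.sum_add_distrib, ← Finset.mul_sum, hp1,
      hp'1]
    norm_num
  have h2 : b ≤ (∑ y, √(p' y * p y)) + ξ := by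
    calc b ≤ ∑ y, (√(p' y * p y) + √((q y - p' y) * p y)) := by
          refine Finset.sum_le_sum fun y _ => ?_
          have : q y * p y = p' y * p y + (q y - p' y) * p y := by ring
          rw [this]
          exact sqrt_add_le (mul_nonneg (hp' y) (hp y))
            (mul_nonneg (sub_nonneg.2 (hq y)) (hp y))
      _ ≤ _ := by
          rw [Finset.sum_add_distrib]
          refine add_le_add le_rfl ?_
          have := sum_sqrt_mul_le_sqrt (ω := fun _ : X => 1) (a := fun y => q y - p' y) (b := p)
            (fun _ => zero_le_one) (fun y => sub_nonneg.2 (hq y)) hp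
          simp only [one_mul, hp1, mul_one, Finset.sum_sub_distrib, hp'1] at this
          simp only [Real.sqrt_mul (sub_nonneg.2 (hq _))]
          refine this.trans ?_
          rw [Real.sqrt_le_iff]
          exact ⟨hξ, by linarith⟩
  have h3 : p x * likRatio p q x ^ 2 = q x * Real.exp (2 * (1 - b)) := by
    rw [likRatio, mul_pow, Real.sq_sqrt (div_nonneg ((hp' x).trans (hq x)) hx.le), ← mul_assoc,
      mul_div_cancel₀ _ hx.ne', ← Real.exp_nat_mul, ← hb]
    norm_num
  rw [h3, mul_assoc, ← Real.exp_add]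
  refine mul_le_mul (hq x) (Real.exp_le_exp.2 ?_) (Real.exp_pos _).le ((hp' x).trans (hq x))
  linarith

variable {G : Type*} [Fintype G]

/-- All the likelihood ratio supermartingales are bounded by `Q`. -/
def LikBounded (p : (k : ℕ) → (Fin k → X) → X → ℝ) (q : G → (k : ℕ) → (Fin k → X) → X → ℝ)
    (Q : ℝ) (k : ℕ) (τ : Fin k → X) : Prop :=
  ∀ g, seqProd (fun k τ => likRatio (p k τ) (q g k τ)) k τ ≤ Q

-- Markov's inequality for each supermartingale and a union bound over the brackets.
open Classical in
theorem sum_not_likBounded_le (hp : ∀ k τ x, 0 ≤ p k τ x)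
    (q : G → (k : ℕ) → (Fin k → X) → X → ℝ) {Q : ℝ} (hQ : 0 < Q) (k : ℕ) :
    ∑ τ, (if LikBounded p q Q k τ then 0 else seqProd p k τ) ≤ Fintype.card G / Q := by
  calc _ ≤ ∑ τ, ∑ g, seqProd p k τ * seqProd (fun k τ => likRatio (p k τ) (q g k τ)) k τ / Q := by
        refine Finset.sum_le_sum fun τ _ => ?_
        have h0 : ∀ g, 0 ≤ seqProd p k τ * seqProd (fun k τ => likRatio (p k τ) (q g k τ)) k τ / Q :=
          fun g => div_nonneg (mul_nonneg (seqProd_nonneg hp _ _)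
            (seqProd_nonneg (fun _ _ _ => likRatio_nonneg _ _ _) _ _)) hQ.le
        split_ifs with h
        · exact Finset.sum_nonneg fun g _ => h0 g
        · rw [LikBounded] at h
          push Not at h
          obtain ⟨g, hg⟩ := h
          refine le_trans ?_ (Finset.single_le_sum (fun g _ => h0 g) (Finset.mem_univ g))
          rw [le_div_iff₀ hQ]
          exact mul_le_mul_of_nonneg_left hg.le (seqProd_nonneg hp _ _)
    _ = ∑ g, (∑ τ, seqProd p k τ * seqProd (fun k τ => likRatio (p k τ) (q g k τ)) k τ) / Q := by
        rw [Finset.sum_comm]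
        simp only [Finset.sum_div]
    _ ≤ ∑ _g : G, 1 / Q := by
        refine Finset.sum_le_sum fun g _ => div_le_div_of_nonneg_right ?_ hQ.le
        exact sum_seqProd_mul_le hp (fun _ _ _ => likRatio_nonneg _ _ _)
          (fun k τ => sum_mul_likRatio_le (hp k τ)) k
    _ = _ := by simp [div_eq_mul_inv]

theorem prod_mul_exp_hell_le (hp : ∀ k τ x, 0 ≤ p k τ x) (hp1 : ∀ k τ, ∑ x, p k τ x = 1)
    {p' q : (k : ℕ) → (Fin k → X) → X → ℝ}
    (hp' : ∀ k τ x, 0 ≤ p' k τ x) (hp'1 : ∀ k τ, ∑ x, p' k τ x = 1)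
    (hq : ∀ k τ x, p' k τ x ≤ q k τ x) {ξ : ℝ} (hξ : 0 ≤ ξ)
    (hq1 : ∀ k τ, ∑ x, q k τ x ≤ 1 + ξ ^ 2) {x : ℕ → X} {k : ℕ}
    (hx : ∀ t < k, 0 < p t (fun i => x i) (x t)) {Q : ℝ}
    (hQ : seqProd (fun k τ => likRatio (p k τ) (q k τ)) k (fun i => x i) ≤ Q) :
    (∏ t ∈ Finset.range k, p' t (fun i => x i) (x t)) * Real.exp (∑ t ∈ Finset.range k,
        ∑ y, (√(p' t (fun i => x i) y) - √(p t (fun i => x i) y)) ^ 2) ≤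
      (∏ t ∈ Finset.range k, p t (fun i => x i) (x t)) * (Q ^ 2 * Real.exp (2 * ξ) ^ k) := by
  rw [Real.exp_sum, ← Finset.prod_mul_distrib]
  calc _ ≤ ∏ t ∈ Finset.range k, (p t (fun i => x i) (x t) *
        likRatio (p t fun i => x i) (q t fun i => x i) (x t) ^ 2 * Real.exp (2 * ξ)) := by
        refine Finset.prod_le_prod (fun t _ => mul_nonneg (hp' _ _ _) (Real.exp_pos _).le)
          fun t ht => ?_
        exact mul_exp_hell_le (hp t _) (hp1 t _) (hp' t _) (hp'1 t _) (hq t _) hξ (hq1 t _)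
          (hx t (Finset.mem_range.1 ht))
    _ = (∏ t ∈ Finset.range k, p t (fun i => x i) (x t)) *
        ((seqProd (fun k τ => likRatio (p k τ) (q k τ)) k (fun i => x i)) ^ 2 *
          Real.exp (2 * ξ) ^ k) := by
        rw [seqProd_take, Finset.prod_mul_distrib, Finset.prod_mul_distrib, Finset.prod_pow,
          Finset.prod_const, Finset.card_range, mul_assoc]
    _ ≤ _ := by
        refine mul_le_mul_of_nonneg_left (mul_le_mul_of_nonneg_right (pow_le_pow_left₀ ?_ hQ 2)
          (by positivity)) (Finset.prod_nonneg fun t _ => hp _ _ _)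
        exact seqProd_nonneg (fun _ _ _ => likRatio_nonneg _ _ _) _ _

end SequentialLikelihood

/-! ### Mixtures of policies and the exploration strategy -/

section MixedPolicies

variable {L H n : ℕ} {S A : Type*} [Fintype S] [Fintype A]

/-- The average of a function of the policies over a mixture. -/
def mixAvg (F : Policy H S A → ℝ) (μ : MixedPolicy H S A) : ℝ := μ.sum fun π w => w * F π

theorem mixAvg_zero (F : Policy H S A → ℝ) : mixAvg F 0 = 0 := Finsupp.sum_zero_index

theorem mixAvg_add (F : Policy H S A → ℝ) (μ μ' : MixedPolicy H S A) :
    mixAvg F (μ + μ') = mixAvg F μ + mixAvg F μ' := by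
  classical
  exact Finsupp.sum_add_index' (fun _ => zero_mul _) fun _ _ _ => add_mul _ _ _

theorem mixAvg_single (F : Policy H S A → ℝ) (π : Policy H S A) (w : ℝ) :
    mixAvg F (Finsupp.single π w) = w * F π := Finsupp.sum_single_index (zero_mul _)

theorem mixAvg_sum {ι : Type*} (F : Policy H S A → ℝ) (s : Finset ι) (μ : ι → MixedPolicy H S A) :
    mixAvg F (∑ i ∈ s, μ i) = ∑ i ∈ s, mixAvg F (μ i) := by
  classical
  induction s using Finset.induction_on with
  | empty => simp [mixAvg_zero]
  | insert a s ha ih => rw [Finset.sum_insert ha, Finset.sum_insert ha, mixAvg_add, ih]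

theorem mixAvg_explore [Nonempty A] (F : Policy H S A → ℝ) (πexp : Policy H S A) (W : ℕ)
    (π : Policy H S A) :
    mixAvg F (explore πexp W π) = 1 / 2 * F (π.circ W πexp) +
      ∑ h ∈ Finset.range H, 1 / (2 * (H : ℝ)) * F (Policy.phi πexp h π) := by
  simp only [explore, mixAvg_add, mixAvg_sum, mixAvg_single]

theorem sum_mixAvg {ι : Type*} (s : Finset ι) (F : ι → Policy H S A → ℝ) (μ : MixedPolicy H S A) :
    ∑ i ∈ s, mixAvg (F i) μ = mixAvg (fun π => ∑ i ∈ s, F i π) μ := by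
  simp only [mixAvg, Finsupp.sum, Finset.mul_sum]
  exact Finset.sum_comm

/-- The probability of the actions of a trajectory under a mixture of policies. -/
def mixWeight (μ : MixedPolicy H S A) (τ : Traj H S A) : ℝ :=
  mixAvg (fun π => actWeight π.ext H τ) μ

theorem mixAvg_mul (F : Policy H S A → ℝ) (c : ℝ) (μ : MixedPolicy H S A) :
    mixAvg (fun π => F π * c) μ = mixAvg F μ * c := by
  simp only [mixAvg, Finsupp.sum, Finset.sum_mul, mul_assoc]

theorem mixProb_eq (θ : LMDP L S A) (μ : MixedPolicy (n + 1) S A) (τ : Traj (n + 1) S A) :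
    θ.mixProb μ τ = mixWeight μ τ * θ.obs n (Fin.init τ) (τ (Fin.last n)).1 := by
  rw [mixWeight, ← mixAvg_mul]
  simp only [← trajProb_eq]
  rfl

variable [Nonempty A]

theorem mixWeight_explore_nonneg (πexp : Policy H S A) (W : ℕ) (π : Policy H S A)
    (τ : Traj H S A) : 0 ≤ mixWeight (explore πexp W π) τ := by
  rw [mixWeight, mixAvg_explore]
  have h : ∀ π : Policy H S A, 0 ≤ actWeight π.ext H τ := fun π =>
    actWeight_nonneg π.ext_isProb _ _
  exact add_nonneg (mul_nonneg (by norm_num) (h _)) (Finset.sum_nonneg fun i _ =>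
    mul_nonneg (by positivity) (h _))

theorem sum_mixWeight (μ : MixedPolicy (n + 1) S A) (F : (Fin n → S × A) → S → ℝ) :
    ∑ τ : Traj (n + 1) S A, mixWeight μ τ * F (Fin.init τ) (τ (Fin.last n)).1 =
      mixAvg (fun π => ∑ τ : Fin n → S × A, ∑ s, actWeight π.ext n τ * F τ s) μ := by
  simp only [mixWeight, ← mixAvg_mul]
  rw [sum_mixAvg]
  congr 1
  funext π
  exact sum_traj π F

theorem mixAvg_explore_le (F : Policy (n + 1) S A → ℝ) (πexp : Policy (n + 1) S A) (W : ℕ)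
    (π : Policy (n + 1) S A) {c : ℝ} (h : ∀ π, F π ≤ c) : mixAvg F (explore πexp W π) ≤ c := by
  rw [mixAvg_explore]
  calc _ ≤ 1 / 2 * c + ∑ _h ∈ Finset.range (n + 1), 1 / (2 * ((n + 1 : ℕ) : ℝ)) * c := by
        gcongr with i
        · exact h _
        · exact h _
    _ = c := by
        rw [Finset.sum_const, Finset.card_range, nsmul_eq_mul]
        field_simp
        ring

theorem mixAvg_explore_const (πexp : Policy (n + 1) S A) (W : ℕ)
    (π : Policy (n + 1) S A) (c : ℝ) : mixAvg (fun _ => c) (explore πexp W π) = c := by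
  rw [mixAvg_explore, Finset.sum_const, Finset.card_range, nsmul_eq_mul]
  field_simp
  ring

theorem mixProb_explore_nonneg (θ : LMDP L S A) (πexp : Policy (n + 1) S A) (W : ℕ)
    (π : Policy (n + 1) S A) (τ : Traj (n + 1) S A) : 0 ≤ θ.mixProb (explore πexp W π) τ := by
  rw [mixProb_eq]
  exact mul_nonneg (mixWeight_explore_nonneg _ _ _ _) (θ.obs_nonneg _ _ _)

theorem sum_mixProb_explore (θ : LMDP L S A) (πexp : Policy (n + 1) S A) (W : ℕ)
    (π : Policy (n + 1) S A) : ∑ τ, θ.mixProb (explore πexp W π) τ = 1 := by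
  simp only [mixProb_eq]
  rw [sum_mixWeight]
  simp only [θ.sum_obs (Policy.ext_isProb _), mixAvg_explore_const]

/-- The squared Hellinger distance of the trajectory laws under a mixture of policies. -/
def mixHell (μ : MixedPolicy H S A) (θ θ' : LMDP L S A) : ℝ :=
  ∑ τ, (√(θ.mixProb μ τ) - √(θ'.mixProb μ τ)) ^ 2

/-- The mixed action weight is a common factor of the two trajectory laws, so the squared distance
is linear in the mixture. Each φ_i has weight 1 / (2H) in it. -/
theorem hellSq_phi_le_mixHell (θ θ' : LMDP L S A) (πexp : Policy (n + 1) S A) (W : ℕ)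
    (π : Policy (n + 1) S A) {i : ℕ} (hi : i ≤ n) :
    hellSq (Policy.phi πexp i π).ext n θ θ' ≤
      2 * (n + 1) * mixHell (explore πexp W π) θ θ' := by
  have h1 : mixHell (explore πexp W π) θ θ' =
      mixAvg (fun π => hellSq π.ext n θ θ') (explore πexp W π) := by
    have := sum_mixWeight (explore πexp W π) fun τ s => (√(θ.obs n τ s) - √(θ'.obs n τ s)) ^ 2
    refine Eq.trans (Finset.sum_congr rfl fun τ _ => ?_) this
    have hw := mixWeight_explore_nonneg πexp W π τ
    rw [mixProb_eq, mixProb_eq, Real.sqrt_mul hw, Real.sqrt_mul hw, ← mul_sub, mul_pow,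
      Real.sq_sqrt hw]
  have h0 : ∀ π : Policy (n + 1) S A, 0 ≤ hellSq π.ext n θ θ' := fun π =>
    hellSq_nonneg π.ext_isProb _ _ _
  rw [h1, mixAvg_explore]
  have h2 := Finset.single_le_sum (f := fun h => 1 / (2 * ((n + 1 : ℕ) : ℝ)) *
    hellSq (Policy.phi πexp h π).ext n θ θ') (s := Finset.range (n + 1))
    (fun h _ => mul_nonneg (by positivity) (h0 _)) (Finset.mem_range.2 (Nat.lt_succ_of_le hi))
  have h3 : (0 : ℝ) ≤ 2 * (n + 1) := by positivity
  have h4 := mul_le_mul_of_nonneg_left (h2.trans (le_add_of_nonneg_left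
    (mul_nonneg (by norm_num : (0 : ℝ) ≤ 1 / 2) (h0 (π.circ W πexp))))) h3
  refine le_trans (le_of_eq ?_) h4
  push_cast
  field_simp

end MixedPolicies

/-! ### A finite family of upper brackets for all latent MDPs -/

section Grid

variable {L n : ℕ} {S A : Type*}

/-- Parameters of an unnormalized latent MDP in the grid `{0, 1 / N, …, 1}`. -/
abbrev GridModel (N L : ℕ) (S A : Type*) : Type _ :=
  (Fin L → Fin (N + 1)) × (Fin L → S → Fin (N + 1)) × (Fin L → S → A → S → Fin (N + 1))

/-- The weight of the states of a history in a grid model. -/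
def gridObs {N : ℕ} (g : GridModel N L S A) (n : ℕ) (τ : Fin n → S × A) (s : S) : ℝ :=
  ∑ m, (g.1 m : ℝ) / N * chain (fun s => (g.2.1 m s : ℝ) / N)
    (fun s a s' => (g.2.2 m s a s' : ℝ) / N) n τ s

/-- Rounding up to the grid. -/
def roundUp (N : ℕ) (x : ℝ) : Fin (N + 1) := ⟨min N ⌈N * x⌉₊, by omega⟩

theorem le_roundUp {N : ℕ} (hN : 0 < N) {x : ℝ} (hx : x ≤ 1) : x ≤ (roundUp N x : ℝ) / N := by
  have hN' : (0 : ℝ) < N := by exact_mod_cast hN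
  rw [le_div_iff₀ hN', roundUp]
  push_cast
  refine le_min (by nlinarith) ?_
  rw [mul_comm]
  exact Nat.le_ceil _

theorem roundUp_le {N : ℕ} (hN : 0 < N) {x : ℝ} (hx : 0 ≤ x) :
    (roundUp N x : ℝ) / N ≤ x + 1 / N := by
  have hN' : (0 : ℝ) < N := by exact_mod_cast hN
  rw [div_le_iff₀ hN', add_mul, one_div_mul_cancel hN'.ne', roundUp]
  push_cast
  refine (min_le_right _ _).trans ?_
  rw [mul_comm x]
  exact (Nat.ceil_lt_add_one (by positivity)).le

theorem chain_mono {ν ν' : S → ℝ} {T T' : S → A → S → ℝ} (hν : ∀ s, 0 ≤ ν s)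
    (hT : ∀ s a s', 0 ≤ T s a s') (hνν : ∀ s, ν s ≤ ν' s) (hTT : ∀ s a s', T s a s' ≤ T' s a s')
    (n : ℕ) (τ : Fin n → S × A) (s : S) : chain ν T n τ s ≤ chain ν' T' n τ s := by
  induction n generalizing s with
  | zero => exact hνν s
  | succ n ih =>
    exact mul_le_mul (ih _ _) (hTT _ _ _) (hT _ _ _)
      ((chain_nonneg hν hT _ _ _).trans (ih _ _))

variable [Fintype S] [Fintype A]

theorem sum_chain_le {κ : ActionKernel S A} (hκ : κ.IsProb) {ν : S → ℝ} {T : S → A → S → ℝ}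
    (hν0 : ∀ s, 0 ≤ ν s) (hT0 : ∀ s a s', 0 ≤ T s a s') {c : ℝ} (hc : 0 ≤ c)
    (hν : ∑ s, ν s ≤ c) (hT : ∀ s a, ∑ s', T s a s' ≤ c) (n : ℕ) :
    ∑ τ : Fin n → S × A, ∑ s, actWeight κ n τ * chain ν T n τ s ≤ c ^ (n + 1) := by
  induction n with
  | zero => simpa using hν
  | succ n ih =>
    rw [sum_snoc, pow_succ]
    refine le_trans ?_ (mul_le_mul_of_nonneg_right ih hc)
    rw [Finset.sum_mul]
    refine Finset.sum_le_sum fun τ _ => ?_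
    rw [Finset.sum_mul]
    refine Finset.sum_le_sum fun s _ => ?_
    simp only [chain_snoc, actWeight_snoc]
    calc _ = ∑ a, actWeight κ n τ * chain ν T n τ s * κ n τ s a * ∑ s', T s a s' := by
          refine Finset.sum_congr rfl fun a _ => ?_
          rw [Finset.mul_sum]
          exact Finset.sum_congr rfl fun s' _ => by ring
      _ ≤ ∑ a, actWeight κ n τ * chain ν T n τ s * κ n τ s a * c := by
          refine Finset.sum_le_sum fun a _ => mul_le_mul_of_nonneg_left (hT s a) ?_
          exact mul_nonneg (mul_nonneg (actWeight_nonneg hκ _ _) (chain_nonneg hν0 hT0 _ _ _))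
            (hκ.nonneg _ _ _ _)
      _ = _ := by rw [← Finset.sum_mul, ← Finset.mul_sum, hκ.sum_eq_one, mul_one]

/-- The grid model obtained by rounding up all the parameters. -/
def LMDP.toGrid (θ : LMDP L S A) (N : ℕ) : GridModel N L S A :=
  (fun m => roundUp N (θ.mix m), fun m s => roundUp N (θ.init m s),
    fun m s a s' => roundUp N (θ.ker m s a s'))

theorem dist_le_one {X : Type*} [Fintype X] (p : Dist X) (x : X) : p x ≤ 1 := by
  rw [← stdSimplex.sum_eq_one p]
  exact Finset.single_le_sum (f := fun x => p x) (fun x _ => stdSimplex.zero_le _ _)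
    (Finset.mem_univ x)

theorem obs_le_gridObs (θ : LMDP L S A) {N : ℕ} (hN : 0 < N) (n : ℕ) (τ : Fin n → S × A) (s : S) :
    θ.obs n τ s ≤ gridObs (θ.toGrid N) n τ s := by
  refine Finset.sum_le_sum fun m _ => ?_
  refine mul_le_mul (le_roundUp hN (dist_le_one _ _)) ?_
    (chain_nonneg (fun _ => stdSimplex.zero_le _ _) (θ.ker_nonneg m) _ _ _) (by positivity)
  exact chain_mono (fun _ => stdSimplex.zero_le _ _) (θ.ker_nonneg m)
    (fun s => le_roundUp hN (dist_le_one _ _)) (fun s a s' => le_roundUp hN (dist_le_one _ _)) _ _ _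

theorem sum_roundUp_le {X : Type*} [Fintype X] (p : Dist X) {N : ℕ} (hN : 0 < N) :
    ∑ x, (roundUp N (p x) : ℝ) / N ≤ Real.exp (Fintype.card X / N) := by
  calc _ ≤ ∑ x, (p x + 1 / (N : ℝ)) :=
        Finset.sum_le_sum fun x _ => roundUp_le hN (stdSimplex.zero_le _ _)
    _ = Fintype.card X / N + 1 := by
        rw [Finset.sum_add_distrib, stdSimplex.sum_eq_one]
        simp [div_eq_mul_inv, add_comm]
    _ ≤ _ := Real.add_one_le_exp _

/-- Rounding up inflates the mixing law by at most exp(L/N) and the initial law and each of the n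
transitions by at most exp(|S|/N); the factors multiply along the chain. -/
theorem sum_gridObs_le {κ : ActionKernel S A} (hκ : κ.IsProb) (θ : LMDP L S A) {N : ℕ}
    (hN : 0 < N) (n : ℕ) :
    ∑ τ : Fin n → S × A, ∑ s, actWeight κ n τ * gridObs (θ.toGrid N) n τ s ≤
      Real.exp ((L + Fintype.card S * (n + 1)) / N) := by
  have h1 : ∀ m, ∑ τ : Fin n → S × A, ∑ s, actWeight κ n τ *
      chain (fun s => ((θ.toGrid N).2.1 m s : ℝ) / N)
      (fun s a s' => ((θ.toGrid N).2.2 m s a s' : ℝ) / N) n τ s ≤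
      Real.exp (Fintype.card S / N) ^ (n + 1) := fun m =>
    sum_chain_le hκ (fun _ => by positivity) (fun _ _ _ => by positivity) (Real.exp_pos _).le
      (sum_roundUp_le _ hN) (fun s a => sum_roundUp_le (θ.trans m s a) hN) n
  calc _ = ∑ m, ((θ.toGrid N).1 m : ℝ) / N * ∑ τ : Fin n → S × A, ∑ s, actWeight κ n τ *
          chain (fun s => ((θ.toGrid N).2.1 m s : ℝ) / N)
            (fun s a s' => ((θ.toGrid N).2.2 m s a s' : ℝ) / N) n τ s := by
        simp only [gridObs, Finset.mul_sum]
        rw [Finset.sum_comm_cycle]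
        refine Finset.sum_congr rfl fun m _ => Finset.sum_congr rfl fun τ _ =>
          Finset.sum_congr rfl fun s _ => ?_
        ring
    _ ≤ ∑ m, ((θ.toGrid N).1 m : ℝ) / N * Real.exp (Fintype.card S / N) ^ (n + 1) :=
        Finset.sum_le_sum fun m _ => mul_le_mul_of_nonneg_left (h1 m) (by positivity)
    _ ≤ Real.exp (L / N) * Real.exp (Fintype.card S / N) ^ (n + 1) := by
        rw [← Finset.sum_mul]
        refine mul_le_mul_of_nonneg_right ?_ (by positivity)
        have := sum_roundUp_le θ.mix hN
        rw [Fintype.card_fin] at this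
        exact this
    _ = _ := by
        rw [← Real.exp_nat_mul, ← Real.exp_add]
        congr 1
        push_cast
        ring

theorem card_gridModel [DecidableEq S] [DecidableEq A] (N : ℕ) :
    Fintype.card (GridModel N L S A) = (N + 1) ^ (L + L * Fintype.card S +
      L * (Fintype.card S * (Fintype.card A * Fintype.card S))) := by
  simp only [GridModel, Fintype.card_prod, Fintype.card_fun, Fintype.card_fin, ← pow_mul, ← pow_add]
  congr 1
  ring

end Grid

/-! ### Maximum likelihood confidence sets -/

section Concentration

variable {L H n : ℕ} {S A : Type*} [Fintype S] [Fintype A] [Nonempty A]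

/-- The exploration strategy of the next round, given the observed trajectories. -/
def nextExplore (πexp : Policy H S A) (W : ℕ) (sel : Selection L H S A) (k : ℕ)
    (τ : Fin k → Traj H S A) : MixedPolicy H S A :=
  explore πexp W (sel (dataset πexp W sel k τ)).2

theorem runProb_eq_seqProd (θ : LMDP L S A) (πexp : Policy H S A) (W : ℕ)
    (sel : Selection L H S A) (k : ℕ) (τ : Fin k → Traj H S A) :
    runProb θ πexp W sel k τ =
      seqProd (fun k τ => θ.mixProb (nextExplore πexp W sel k τ)) k τ := by
  induction k with
  | zero => rfl
  | succ k ih => rw [runProb, seqProd, ih]; rfl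

theorem logLik_dataset (θ : LMDP L S A) (πexp : Policy (n + 1) S A) (W : ℕ)
    (sel : Selection L (n + 1) S A) (x : ℕ → Traj (n + 1) S A) (k : ℕ) :
    θ.logLik (dataset πexp W sel k fun i => x i) = elog (∏ t ∈ Finset.range k,
      θ.mixProb (nextExplore πexp W sel t fun i => x i) (x t)) := by
  induction k with
  | zero => simp [LMDP.logLik, dataset, elog_one]
  | succ k ih =>
    rw [Finset.prod_range_succ, mul_comm, elog_mul, ← ih]
    swap
    · exact mixProb_explore_nonneg _ _ _ _ _
    simp only [LMDP.logLik, dataset, List.map_cons, List.sum_cons]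
    rfl

open Classical in
/-- With high probability, the likelihoods of all models are controlled in all rounds. -/
theorem exists_likelihood_event (πexp : Policy (n + 1) S A) (W : ℕ)
    (sel : Selection L (n + 1) S A) (θs : LMDP L S A) {K N : ℕ} (hK : 1 ≤ K) (hN : 0 < N)
    (hNK : 2 * (L + Fintype.card S * (n + 1)) * K ^ 2 ≤ N) {p β : ℝ} (hp : 0 < p)
    (hβ : 2 * Real.log (Fintype.card (GridModel N L S A) * (K + 1) / p) + 2 ≤ β) :
    ∃ Good : (Fin K → Traj (n + 1) S A) → Prop,
      ∑ τ, (if Good τ then 0 else runProb θs πexp W sel K τ) ≤ p ∧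
      ∀ x : ℕ → Traj (n + 1) S A, Good (fun i => x i) → 0 < runProb θs πexp W sel K (fun i => x i) →
        ∀ θ : LMDP L S A, ∀ k ≤ K,
          0 < ∏ t ∈ Finset.range k, θs.mixProb (nextExplore πexp W sel t fun i => x i) (x t) ∧
          (∏ t ∈ Finset.range k, θ.mixProb (nextExplore πexp W sel t fun i => x i) (x t)) *
            Real.exp (∑ t ∈ Finset.range k,
              mixHell (nextExplore πexp W sel t fun i => x i) θ θs) ≤
          Real.exp β *
            ∏ t ∈ Finset.range k, θs.mixProb (nextExplore πexp W sel t fun i => x i) (x t) := by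
  set G := GridModel N L S A with hG
  set P : LMDP L S A → (k : ℕ) → (Fin k → Traj (n + 1) S A) → Traj (n + 1) S A → ℝ :=
    fun θ k τ => θ.mixProb (nextExplore πexp W sel k τ) with hP
  set q : G → (k : ℕ) → (Fin k → Traj (n + 1) S A) → Traj (n + 1) S A → ℝ :=
    fun g k τ x => mixWeight (nextExplore πexp W sel k τ) x *
      gridObs g n (Fin.init x) (x (Fin.last n)).1 with hq
  -- With this threshold, the union bound over the brackets and the K + 1 prefixes gives exactly p.
  set Q : ℝ := Fintype.card G * (K + 1) / p with hQdef
  have hGpos : (0 : ℝ) < Fintype.card G := by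
    have : Nonempty G := ⟨θs.toGrid N⟩
    exact_mod_cast Fintype.card_pos
  have hQ : 0 < Q := by positivity
  have hP0 : ∀ θ k τ x, 0 ≤ P θ k τ x := fun θ k τ x => mixProb_explore_nonneg _ _ _ _ _
  have hP1 : ∀ θ k τ, ∑ x, P θ k τ x = 1 := fun θ k τ => sum_mixProb_explore _ _ _ _
  have hPq : ∀ (θ : LMDP L S A) k τ x, P θ k τ x ≤ q (θ.toGrid N) k τ x := fun θ k τ x => by
    simp only [hP, hq]
    rw [mixProb_eq]
    exact mul_le_mul_of_nonneg_left (obs_le_gridObs θ hN _ _ _) (mixWeight_explore_nonneg _ _ _ _)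
  have hK0 : (0 : ℝ) < K := by exact_mod_cast hK
  -- The grid is so fine that a bracket has excess mass at most ξ² with ξ = 1/K. Over K rounds this
  -- loses a factor exp(2), the summand 2 in `hβ`.
  have hq1 : ∀ (θ : LMDP L S A) k τ, ∑ x, q (θ.toGrid N) k τ x ≤ 1 + (1 / (K : ℝ)) ^ 2 := by
    intro θ k τ
    simp only [hq]
    rw [sum_mixWeight]
    refine mixAvg_explore_le _ _ _ _ fun π =>
      (sum_gridObs_le π.ext_isProb θ hN n).trans ?_
    have hN' : (0 : ℝ) < N := by exact_mod_cast hN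
    have hNK' : 2 * (L + Fintype.card S * (n + 1)) * (K : ℝ) ^ 2 ≤ N := by exact_mod_cast hNK
    set z : ℝ := (L + Fintype.card S * (n + 1)) / N with hz
    have hz0 : 0 ≤ z := by positivity
    have hK1 : (1 : ℝ) ≤ K := by exact_mod_cast hK
    have hzK : 2 * z ≤ (1 / (K : ℝ)) ^ 2 := by
      rw [hz, one_div, inv_pow, ← one_div, le_div_iff₀ (by positivity), mul_div_assoc', div_mul_eq_mul_div,
        div_le_one hN']
      exact hNK'
    have hK2 : (1 / (K : ℝ)) ^ 2 ≤ 1 := pow_le_one₀ (by positivity)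
      ((div_le_one hK0).2 hK1)
    have hz1 : |z| ≤ 1 := by rw [abs_of_nonneg hz0]; linarith
    have := Real.abs_exp_sub_one_le hz1
    rw [abs_of_nonneg hz0] at this
    linarith [le_abs_self (Real.exp z - 1)]
  refine ⟨seqGood (LikBounded (P θs) q Q) K, ?_, ?_⟩
  · have h1 := sum_not_seqGood_le (hP0 θs) (hP1 θs)
      (fun k => sum_not_likBounded_le (hP0 θs) q hQ k) K
    simp only [runProb_eq_seqProd]
    refine h1.trans (le_of_eq ?_)
    rw [hQdef]
    field_simp
  · intro x hgood hrun θ k hk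
    have hpos : ∀ t < K, 0 < P θs t (fun i => x i) (x t) := by
      rw [runProb_eq_seqProd, seqProd_take] at hrun
      intro t ht
      refine lt_of_le_of_ne (hP0 _ _ _ _) fun h => hrun.ne' ?_
      exact Finset.prod_eq_zero (Finset.mem_range.2 ht) h.symm
    refine ⟨Finset.prod_pos fun t ht => hpos t (by have := Finset.mem_range.1 ht; omega), ?_⟩
    have h1 := prod_mul_exp_hell_le (hP0 θs) (hP1 θs) (hP0 θ) (hP1 θ) (hPq θ)
      (ξ := 1 / K) (by positivity) (hq1 θ) (x := x) (k := k) (fun t ht => hpos t (by omega))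
      (seqGood_take hgood hk (θ.toGrid N))
    refine h1.trans ?_
    rw [mul_comm]
    refine mul_le_mul_of_nonneg_right ?_ (Finset.prod_nonneg fun t _ => hP0 _ _ _ _)
    calc Q ^ 2 * Real.exp (2 * (1 / K)) ^ k = Real.exp (2 * Real.log Q + k * (2 * (1 / K))) := by
          rw [← Real.exp_nat_mul, Real.exp_add]
          congr 1
          rw [mul_comm 2, Real.exp_mul, Real.exp_log hQ]
          norm_num
      _ ≤ Real.exp β := by
          refine Real.exp_le_exp.2 (le_trans ?_ hβ)
          have : (k : ℝ) * (2 * (1 / K)) ≤ 2 := by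
            rw [mul_one_div, mul_div_assoc', div_le_iff₀ hK0]
            have : (k : ℝ) ≤ K := by exact_mod_cast hk
            linarith
          linarith

variable {πexp : Policy (n + 1) S A} {W : ℕ} {sel : Selection L (n + 1) S A} {θs : LMDP L S A}
  {β : ℝ} {x : ℕ → Traj (n + 1) S A} {k : ℕ} {Θ : Set (LMDP L S A)}

theorem mem_confidenceSet_of_likelihood
    (hx : ∀ θ : LMDP L S A,
      (∏ t ∈ Finset.range k, θ.mixProb (nextExplore πexp W sel t fun i => x i) (x t)) *
        Real.exp (∑ t ∈ Finset.range k, mixHell (nextExplore πexp W sel t fun i => x i) θ θs) ≤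
      Real.exp β *
        ∏ t ∈ Finset.range k, θs.mixProb (nextExplore πexp W sel t fun i => x i) (x t))
    (hθs : θs ∈ Θ) : θs ∈ confidenceSet Θ β (dataset πexp W sel k fun i => x i) := by
  refine ⟨hθs, fun θ _ => ?_⟩
  rw [logLik_dataset, logLik_dataset]
  apply EReal.sub_le_of_le_add
  have h0 : 0 ≤ ∏ t ∈ Finset.range k, θs.mixProb (nextExplore πexp W sel t fun i => x i) (x t) :=
    Finset.prod_nonneg fun t _ => mixProb_explore_nonneg _ _ _ _ _
  have h1 : 0 ≤ ∏ t ∈ Finset.range k, θ.mixProb (nextExplore πexp W sel t fun i => x i) (x t) :=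
    Finset.prod_nonneg fun t _ => mixProb_explore_nonneg _ _ _ _ _
  rw [← elog_exp, ← elog_mul h0, elog_le_elog_iff (by positivity), mul_comm]
  refine le_trans (le_mul_of_one_le_right h1 (Real.one_le_exp ?_)) (hx θ)
  exact Finset.sum_nonneg fun t _ => Finset.sum_nonneg fun _ _ => sq_nonneg _

/-- Membership gives likelihood(θs) ≤ e^β likelihood(θ), and the event gives likelihood(θ) e^D ≤ e^β
likelihood(θs). Multiplying, D ≤ 2β. -/
theorem sum_mixHell_le_of_mem {θ : LMDP L S A}
    (hpos : 0 < ∏ t ∈ Finset.range k, θs.mixProb (nextExplore πexp W sel t fun i => x i) (x t))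
    (hx : (∏ t ∈ Finset.range k, θ.mixProb (nextExplore πexp W sel t fun i => x i) (x t)) *
        Real.exp (∑ t ∈ Finset.range k, mixHell (nextExplore πexp W sel t fun i => x i) θ θs) ≤
      Real.exp β *
        ∏ t ∈ Finset.range k, θs.mixProb (nextExplore πexp W sel t fun i => x i) (x t))
    (hθs : θs ∈ Θ) (hθ : θ ∈ confidenceSet Θ β (dataset πexp W sel k fun i => x i)) :
    ∑ t ∈ Finset.range k, mixHell (nextExplore πexp W sel t fun i => x i) θ θs ≤ 2 * β := by
  have h := hθ.2 θs hθs
  rw [logLik_dataset, logLik_dataset, EReal.sub_le_iff_le_add (.inl (EReal.coe_ne_bot _))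
    (.inl (EReal.coe_ne_top _))] at h
  have h1 : 0 ≤ ∏ t ∈ Finset.range k, θ.mixProb (nextExplore πexp W sel t fun i => x i) (x t) :=
    Finset.prod_nonneg fun t _ => mixProb_explore_nonneg _ _ _ _ _
  rw [← elog_exp, ← elog_mul h1, elog_le_elog_iff (by positivity)] at h
  set D := ∑ t ∈ Finset.range k, mixHell (nextExplore πexp W sel t fun i => x i) θ θs
  set a := ∏ t ∈ Finset.range k, θs.mixProb (nextExplore πexp W sel t fun i => x i) (x t)
  set b := ∏ t ∈ Finset.range k, θ.mixProb (nextExplore πexp W sel t fun i => x i) (x t)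
  have h2 : a * Real.exp D ≤ a * Real.exp (2 * β) := by
    calc a * Real.exp D ≤ b * Real.exp β * Real.exp D :=
          mul_le_mul_of_nonneg_right h (Real.exp_pos _).le
      _ = Real.exp β * (b * Real.exp D) := by ring
      _ ≤ Real.exp β * (Real.exp β * a) := mul_le_mul_of_nonneg_left hx (Real.exp_pos _).le
      _ = a * Real.exp (2 * β) := by rw [two_mul, Real.exp_add]; ring
  exact Real.exp_le_exp.1 (le_of_mul_le_mul_left h2 hpos)

end Concentration

/-! ### Existence of optimistic choices by compactness -/

section Existence

variable {L H n : ℕ} {S A : Type*} [Fintype S] [Fintype A]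

/-- The parameters of a latent MDP as a point of a product of simplices. -/
abbrev Params (L : ℕ) (S A : Type*) [Fintype S] : Type _ :=
  Dist (Fin L) × (Fin L → Dist S) × (Fin L → S → A → Dist S)

/-- The latent MDP with the given parameters. -/
def Params.toLMDP (q : Params L S A) : LMDP L S A := ⟨q.1, q.2.1, q.2.2⟩

theorem Params.exists_toLMDP (θ : LMDP L S A) : ∃ q : Params L S A, q.toLMDP = θ :=
  ⟨(θ.mix, θ.init, θ.trans), rfl⟩

theorem continuous_dist_apply {X : Type*} [Fintype X] (x : X) :
    Continuous fun p : Dist X => p x :=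
  (continuous_apply x).comp continuous_subtype_val

theorem continuous_trajProb (τ : Traj H S A) :
    Continuous fun z : Params L S A × Policy H S A => z.1.toLMDP.trajProb z.2 τ := by
  refine continuous_finsetSum _ fun m _ => Continuous.mul ?_ (continuous_finsetProd _ fun h _ =>
    Continuous.mul ?_ ?_)
  · exact (continuous_dist_apply m).comp (continuous_fst.comp continuous_fst)
  · simp only [LMDP.stepProb]
    split_ifs
    · exact (continuous_dist_apply _).comp ((continuous_apply m).comp
        (continuous_fst.comp (continuous_snd.comp continuous_fst)))
    · refine (continuous_dist_apply _).comp ?_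
      exact (continuous_apply_apply _ _).comp ((continuous_apply m).comp
        (continuous_snd.comp (continuous_snd.comp continuous_fst)))
  · refine (continuous_dist_apply _).comp ?_
    exact (continuous_apply_apply _ _).comp ((continuous_apply h).comp continuous_snd)

theorem continuous_value (R : Fin H → S → A → ℝ) :
    Continuous fun z : Params L S A × Policy H S A => z.1.toLMDP.value R z.2 :=
  continuous_finsetSum _ fun τ _ => (continuous_trajProb τ).mul continuous_const

theorem continuous_mixProb (μ : MixedPolicy H S A) (τ : Traj H S A) :
    Continuous fun q : Params L S A => q.toLMDP.mixProb μ τ :=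
  continuous_finsetSum _ fun _ _ => continuous_const.mul
    ((continuous_trajProb τ).comp (continuous_id.prodMk continuous_const))

/-- The premise of separation, positive weights, is open, so its negation is a closed alternative
and the class is an intersection of finite unions of closed sets. -/
theorem isClosed_separated (δ : ℝ) :
    IsClosed {q : Params L S A | q.toLMDP ∈ separatedClass L S A δ} := by
  have h : {q : Params L S A | q.toLMDP ∈ separatedClass L S A δ} =
      ⋂ (m : Fin L) (l : Fin L) (_ : m ≠ l) (s : S) (a : A),
        ({q | q.1 m ≤ 0} ∪ {q | q.1 l ≤ 0} ∪ {q | δ ≤ tvDist (q.2.2 m s a) (q.2.2 l s a)}) := by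
    ext q
    simp only [separatedClass, LMDP.StronglySeparated, LMDP.supp, Set.mem_ofPred_eq, Set.mem_iInter,
      Set.mem_union, Params.toLMDP]
    constructor
    · intro h m l hml s a
      by_cases h1 : 0 < q.1 m
      · by_cases h2 : 0 < q.1 l
        · exact Or.inr (h m h1 l h2 hml s a)
        · exact Or.inl (Or.inr (not_lt.1 h2))
      · exact Or.inl (Or.inl (not_lt.1 h1))
    · intro h m h1 l h2 hml s a
      rcases h m l hml s a with (h3 | h3) | h3
      · exact absurd h3 (not_le.2 h1)
      · exact absurd h3 (not_le.2 h2)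
      · exact h3
  rw [h]
  refine isClosed_iInter fun m => isClosed_iInter fun l => isClosed_iInter fun _ =>
    isClosed_iInter fun s => isClosed_iInter fun a => ?_
  have hmix : ∀ m : Fin L, IsClosed {q : Params L S A | q.1 m ≤ 0} := fun m =>
    isClosed_le ((continuous_dist_apply m).comp continuous_fst) continuous_const
  have htr : ∀ (m : Fin L) (x : S), Continuous fun q : Params L S A => q.2.2 m s a x := fun m x =>
    (continuous_dist_apply x).comp ((continuous_apply_apply s a).comp
      ((continuous_apply m).comp (continuous_snd.comp continuous_snd)))
  refine ((hmix m).union (hmix l)).union (isClosed_le continuous_const ?_)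
  exact continuous_const.mul (continuous_finsetSum _ fun x _ => ((htr m x).sub (htr l x)).abs)

/-- With all the weight on one instance, separation is vacuous. -/
theorem exists_mem_separatedClass [Nonempty S] (hL : 1 ≤ L) (δ : ℝ) :
    ∃ θ : LMDP L S A, θ ∈ separatedClass L S A δ := by
  refine ⟨⟨⟨Pi.single ⟨0, hL⟩ 1, single_mem_stdSimplex ℝ _⟩, fun _ => stdSimplex.barycenter,
    fun _ _ _ => stdSimplex.barycenter⟩, ?_⟩
  have h : ∀ m : Fin L, (0 : ℝ) < (Pi.single ⟨0, hL⟩ 1 : Fin L → ℝ) m → m = ⟨0, hL⟩ := fun m hm => by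
    by_contra h
    rw [Pi.single_eq_of_ne h] at hm
    exact lt_irrefl _ hm
  intro m hm l hl hml
  exact absurd ((h m hm).trans (h l hl).symm) hml

variable [Nonempty S] [Nonempty A]

/-- The likelihood is continuous on a compact parameter space, so its maximum is attained and the
confidence set is a closed condition. By `hdec` the decoding constraint is void; hence no continuity
of the decoding error, whose decoder breaks ties arbitrarily, is needed. -/
theorem exists_isOptimisticChoice (πexp : Policy (n + 1) S A) (W : ℕ)
    (sel : Selection L (n + 1) S A) (R : Fin (n + 1) → S → A → ℝ) {δ β εs : ℝ} (hL : 1 ≤ L)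
    (hβ : 0 ≤ β)
    (hdec : ∀ θ ∈ separatedClass L S A δ, ∀ π : Policy (n + 1) S A, θ.decodeError W π ≤ εs)
    (k : ℕ) (x : ℕ → Traj (n + 1) S A) :
    ∃ z, IsOptimisticChoice (separatedClass L S A δ) R β εs W
      (dataset πexp W sel k fun i => x i) z := by
  set f : Params L S A → ℝ := fun q => ∏ t ∈ Finset.range k,
    q.toLMDP.mixProb (nextExplore πexp W sel t fun i => x i) (x t) with hf
  have hfc : Continuous f := continuous_finsetProd _ fun t _ => continuous_mixProb _ _
  have hf0 : ∀ q, 0 ≤ f q := fun q => Finset.prod_nonneg fun t _ =>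
    mixProb_explore_nonneg _ _ _ _ _
  have hcomp : IsCompact {q : Params L S A | q.toLMDP ∈ separatedClass L S A δ} :=
    (isClosed_separated δ).isCompact
  have hne : {q : Params L S A | q.toLMDP ∈ separatedClass L S A δ}.Nonempty := by
    obtain ⟨θ, hθ⟩ := exists_mem_separatedClass (S := S) (A := A) hL δ
    obtain ⟨q, rfl⟩ := Params.exists_toLMDP θ
    exact ⟨q, hθ⟩
  obtain ⟨q₀, hq₀, hmax⟩ := hcomp.exists_isMaxOn hne hfc.continuousOn
  have hconf : ∀ q : Params L S A,
      q.toLMDP ∈ confidenceSet (separatedClass L S A δ) β (dataset πexp W sel k fun i => x i) ↔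
        q.toLMDP ∈ separatedClass L S A δ ∧ f q₀ ≤ f q * Real.exp β := by
    intro q
    have key : ∀ q' : Params L S A, q'.toLMDP.logLik (dataset πexp W sel k fun i => x i) - (β : EReal) ≤
        q.toLMDP.logLik (dataset πexp W sel k fun i => x i) ↔ f q' ≤ f q * Real.exp β := by
      intro q'
      rw [logLik_dataset, logLik_dataset, EReal.sub_le_iff_le_add (.inl (EReal.coe_ne_bot _))
        (.inl (EReal.coe_ne_top _)), ← elog_exp, ← elog_mul (hf0 q),
        elog_le_elog_iff (mul_nonneg (hf0 q) (Real.exp_pos _).le)]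
    constructor
    · exact fun h => ⟨h.1, (key q₀).1 (h.2 _ hq₀)⟩
    · refine fun h => ⟨h.1, fun θ hθ => ?_⟩
      obtain ⟨q', rfl⟩ := Params.exists_toLMDP θ
      exact (key q').2 ((hmax hθ).trans h.2)
  have hcomp' : IsCompact ({q : Params L S A | q.toLMDP ∈ separatedClass L S A δ ∧
      f q₀ ≤ f q * Real.exp β} ×ˢ (Set.univ : Set (Policy (n + 1) S A))) := by
    refine IsCompact.prod (IsClosed.isCompact ?_) isCompact_univ
    exact (isClosed_separated δ).inter (isClosed_le continuous_const (hfc.mul continuous_const))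
  obtain ⟨z, hz, hzmax⟩ := hcomp'.exists_isMaxOn
    ⟨(q₀, πexp), ⟨hq₀, le_mul_of_one_le_right (hf0 _) (Real.one_le_exp hβ)⟩, trivial⟩
    (continuous_value R).continuousOn
  refine ⟨(z.1.toLMDP, z.2), ⟨(hconf z.1).2 hz.1, hdec _ hz.1.1 _⟩, ?_⟩
  rintro ⟨θ, π⟩ hθ -
  obtain ⟨q, rfl⟩ := Params.exists_toLMDP θ
  exact hzmax (a := (q, π)) ⟨(hconf q).1 hθ, trivial⟩

open Classical in
theorem exists_isOMLE (πexp : Policy (n + 1) S A) (W K : ℕ)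
    (R : Fin (n + 1) → S → A → ℝ) {δ β εs : ℝ} (hL : 1 ≤ L) (hβ : 0 ≤ β)
    (hdec : ∀ θ ∈ separatedClass L S A δ, ∀ π : Policy (n + 1) S A, θ.decodeError W π ≤ εs) :
    ∃ sel : Selection L (n + 1) S A,
      IsOMLE (separatedClass L S A δ) R πexp β εs W K sel := by
  obtain ⟨θ₀, -⟩ := exists_mem_separatedClass (S := S) (A := A) hL δ
  set sel : Selection L (n + 1) S A := fun D =>
    if h : ∃ z, IsOptimisticChoice (separatedClass L S A δ) R β εs W D z then h.choose
    else (θ₀, πexp) with hsel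
  refine ⟨sel, fun k _ τ => ?_⟩
  have : Nonempty (Traj (n + 1) S A) := inferInstance
  -- The observed trajectories are padded to an infinite sequence, so that all prefixes are
  -- restrictions of one function.
  set x : ℕ → Traj (n + 1) S A := fun t => if h : t < k then τ ⟨t, h⟩ else Classical.arbitrary _
    with hx
  have hτ : τ = fun i : Fin k => x i := by
    funext i
    simp [hx]
  have h := exists_isOptimisticChoice πexp W sel R hL hβ hdec k x
  rw [← hτ] at h
  have e : sel (dataset πexp W sel k τ) = h.choose := dif_pos h
  rw [e]
  exact h.choose_spec

end Existence

/-! ### Optimism and the regret bound -/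

section Regret

variable {L H n : ℕ} {S A : Type*} [Fintype S] [Fintype A]

theorem sum_reward_le_one {R : Fin H → S → A → ℝ} (hR : IsReward R) (τ : Traj H S A) :
    ∑ h, R h (τ h).1 (τ h).2 ≤ 1 :=
  (Finset.sum_le_sum fun h _ => le_ciSup (f := fun x : S × A => R h x.1 x.2)
    (Set.finite_range _).bddAbove (τ h)).trans hR.2

variable [Nonempty A]

/-- The total reward lies in [0, 1]. It may depend on the last action, but the probabilities of
actions given the history are common to both models and factor out. -/
theorem value_sub_value_le {R : Fin (n + 1) → S → A → ℝ} (hR : IsReward R) (θ θs : LMDP L S A)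
    (π : Policy (n + 1) S A) :
    θ.value R π - θs.value R π ≤
      ∑ τ : Fin n → S × A, ∑ s, actWeight π.ext n τ * |θ.obs n τ s - θs.obs n τ s| := by
  rw [LMDP.value, LMDP.value, ← Finset.sum_sub_distrib,
    ← sum_traj π fun τ s => |θ.obs n τ s - θs.obs n τ s|]
  refine Finset.sum_le_sum fun τ _ => ?_
  have h0 : 0 ≤ ∑ h, R h (τ h).1 (τ h).2 := Finset.sum_nonneg fun h _ => (hR.1 h _ _).1
  have h1 := sum_reward_le_one hR τ
  have hw := actWeight_nonneg π.ext_isProb (n + 1) τ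
  rw [trajProb_eq, trajProb_eq, ← sub_mul, ← mul_sub, mul_assoc]
  refine mul_le_mul_of_nonneg_left ?_ hw
  calc _ ≤ |θ.obs n (Fin.init τ) (τ (Fin.last n)).1 - θs.obs n (Fin.init τ) (τ (Fin.last n)).1| *
        ∑ h, R h (τ h).1 (τ h).2 := mul_le_mul_of_nonneg_right (le_abs_self _) h0
    _ ≤ _ := mul_le_of_le_one_right (abs_nonneg _) h1

theorem mixValue_eq_mixAvg (θ : LMDP L S A) (R : Fin H → S → A → ℝ) (μ : MixedPolicy H S A) :
    θ.mixValue R μ = mixAvg (θ.value R) μ := by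
  have h : ∀ τ, θ.mixProb μ τ = mixAvg (fun π => θ.trajProb π τ) μ := fun _ => rfl
  simp only [LMDP.mixValue, h, ← mixAvg_mul]
  rw [sum_mixAvg]
  rfl

theorem mixValue_output (θ : LMDP L S A) (R : Fin H → S → A → ℝ) (πexp : Policy H S A) (W : ℕ)
    (sel : Selection L H S A) (K : ℕ) (x : ℕ → Traj H S A) :
    θ.mixValue R (output πexp W sel K fun i => x i) = 1 / (K : ℝ) * ∑ t ∈ Finset.range K,
      θ.value R (sel (dataset πexp W sel t fun i => x i)).2 := by
  rw [mixValue_eq_mixAvg, output]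
  suffices h : ∀ (c : ℝ) (k : ℕ), mixAvg (θ.value R)
      ((chosenPolicies πexp W sel k fun i => x i).map fun π => Finsupp.single π c).sum =
      c * ∑ t ∈ Finset.range k, θ.value R (sel (dataset πexp W sel t fun i => x i)).2 from h _ K
  intro c k
  induction k with
  | zero => simp [chosenPolicies, mixAvg_zero]
  | succ k ih =>
    rw [Finset.sum_range_succ, mul_add, ← ih, chosenPolicies, List.map_cons, List.sum_cons,
      mixAvg_add, mixAvg_single, add_comm]
    rfl

theorem runProb_nonneg (θ : LMDP L S A) (πexp : Policy (n + 1) S A) (W : ℕ)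
    (sel : Selection L (n + 1) S A) (k : ℕ) (τ : Fin k → Traj (n + 1) S A) :
    0 ≤ runProb θ πexp W sel k τ := by
  rw [runProb_eq_seqProd]
  exact seqProd_nonneg (fun _ _ _ => mixProb_explore_nonneg _ _ _ _ _) _ _

theorem sum_runProb (θ : LMDP L S A) (πexp : Policy (n + 1) S A) (W : ℕ)
    (sel : Selection L (n + 1) S A) (k : ℕ) : ∑ τ, runProb θ πexp W sel k τ = 1 := by
  simp only [runProb_eq_seqProd]
  exact sum_seqProd (fun _ _ => sum_mixProb_explore _ _ _ _) k

variable [Nonempty S]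

/-- OMLE succeeds with high probability once its parameters satisfy the bounds of the analysis. -/
theorem one_sub_le_successProb [DecidableEq S] [DecidableEq A] {πexp : Policy (n + 1) S A}
    {R : Fin (n + 1) → S → A → ℝ}
    (hR : IsReward R) {δ β εs ε p U : ℝ} (hδ : 0 ≤ δ) (hp : 0 < p) (hβ0 : 0 ≤ β) {w k K N : ℕ}
    (hn : w + k = n) (hK : 1 ≤ K) (hN : 0 < N)
    (hNK : 2 * (L + Fintype.card S * (n + 1)) * K ^ 2 ≤ N)
    (hβ : 2 * Real.log (Fintype.card (GridModel N L S A) * (K + 1) / p) + 2 ≤ β)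
    (hη : L * Real.exp (-(δ ^ 2 / 2)) ^ k ≤ 1 / 4)
    (hεs : L * Real.exp (-(δ ^ 2 / 2)) ^ w ≤ εs)
    (hU : K * (16 * (L * Real.exp (-(δ ^ 2 / 2)) ^ w) +
      8 * (L * Real.exp (-(δ ^ 2 / 2)) ^ k)) + 12 * (Fintype.card A * (4 * (n + 1) * β)) ≤ U)
    (hε : K * (6 * (L * Real.exp (-(δ ^ 2 / 2)) ^ w) + 4 * (L * Real.exp (-(δ ^ 2 / 2)) ^ k)) +
      5 * ((w + 1) * stepRate L (Fintype.card S) (Fintype.card A) K (4 * (n + 1) * β)) +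
      k * kerRate L (Fintype.card S) (Fintype.card A) K (4 * (n + 1) * β) U ≤ K * ε)
    {sel : Selection L (n + 1) S A}
    (hsel : IsOMLE (separatedClass L S A δ) R πexp β εs (w + 1) K sel)
    {θs : LMDP L S A} (hθs : θs ∈ separatedClass L S A δ) :
    1 - p ≤ successProb θs R πexp (w + 1) sel K ε := by
  classical
  have hβ' : 2 * Real.log (Fintype.card (GridModel N L S A) * (K + 1) / p) + 2 ≤ β := hβ
  obtain ⟨Good, hGood, hx⟩ := exists_likelihood_event πexp (w + 1) sel θs hK hN hNK hp
    (β := β) (by convert hβ')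
  have hK0 : (0 : ℝ) < K := by exact_mod_cast hK
  have hopt : ∀ τ : Fin K → Traj (n + 1) S A, Good τ → 0 < runProb θs πexp (w + 1) sel K τ →
      θs.IsEpsOptimal R ε (output πexp (w + 1) sel K τ) := by
    intro τ hτ hrun π₀
    set x : ℕ → Traj (n + 1) S A := fun t => if h : t < K then τ ⟨t, h⟩ else Classical.arbitrary _
      with hxdef
    have hτx : τ = fun i : Fin K => x i := by
      funext i
      simp [hxdef]
    rw [hτx] at hτ hrun ⊢
    have key := hx x hτ hrun
    set D : ℕ → Dataset (n + 1) S A := fun t => dataset πexp (w + 1) sel t fun i => x i with hD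
    -- After the last round the sequence is continued by `θs`, because the learning lemmas want
    -- separated models at all times.
    set θ : ℕ → LMDP L S A := fun r => if r < K then (sel (D r)).1 else θs with hθdef
    set π : ℕ → Policy (n + 1) S A := fun r => (sel (D r)).2 with hπdef
    have hθr : ∀ r < K, θ r = (sel (D r)).1 := fun r hr => if_pos hr
    have hchoice : ∀ r < K, IsOptimisticChoice (separatedClass L S A δ) R β εs (w + 1) (D r)
        (θ r, π r) := fun r hr => by
      rw [hθr r hr]
      exact hsel r hr fun i => x i
    have hθsep : ∀ r, (θ r).StronglySeparated δ := fun r => by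
      by_cases hr : r < K
      · exact (hchoice r hr).1.1.1
      · simp only [hθdef, hr, if_false]
        exact hθs
    have hh : ∀ r < K, ∀ i ≤ n, ∑ t ∈ Finset.range r,
        hellSq (Policy.phi πexp i (π t)).ext n (θ r) θs ≤ 4 * (n + 1) * β := by
      intro r hr i hi
      obtain ⟨h1, h2⟩ := key (θ r) r hr.le
      have h3 := sum_mixHell_le_of_mem h1 h2 hθs (hchoice r hr).1.1
      calc _ ≤ ∑ t ∈ Finset.range r, 2 * (n + 1) *
            mixHell (explore πexp (w + 1) (π t)) (θ r) θs :=
            Finset.sum_le_sum fun t _ => hellSq_phi_le_mixHell _ _ _ _ _ hi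
        _ ≤ _ := by
            rw [← Finset.mul_sum]
            have h4 : (0 : ℝ) ≤ 2 * (n + 1) := by positivity
            refine (mul_le_mul_of_nonneg_left h3 h4).trans (le_of_eq (by ring))
    have hreg := sum_abs_obs_sub_le πexp π θ θs hδ hθsep hθs hn hη (by positivity) hh hU
    have hstep : ∀ r ∈ Finset.range K, θs.value R π₀ - θs.value R (π r) ≤
        ∑ τ : Fin n → S × A, ∑ s, actWeight (π r).ext n τ *
          |(θ r).obs n τ s - θs.obs n τ s| := by
      intro r hr
      have hr' := Finset.mem_range.1 hr
      have h1 := mem_confidenceSet_of_likelihood (fun θ => (key θ r hr'.le).2) hθs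
      -- Optimism: the true model with an arbitrary policy is a feasible competitor, since its
      -- decoding error is at most `εs` for every policy.
      have h2 := (hchoice r hr').2 (θs, π₀) h1
        ((decodeError_le hδ hθs (by omega) π₀).trans hεs)
      have h3 := value_sub_value_le hR (θ r) θs (π r)
      dsimp only at h2
      linarith
    have hsum := (Finset.sum_le_sum hstep).trans (hreg.trans hε)
    rw [Finset.sum_sub_distrib, Finset.sum_const, Finset.card_range, nsmul_eq_mul] at hsum
    rw [mixValue_output, one_div]
    have : θs.value R π₀ - (K : ℝ)⁻¹ * ∑ t ∈ Finset.range K, θs.value R (π t) =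
        (K : ℝ)⁻¹ * (K * θs.value R π₀ - ∑ t ∈ Finset.range K, θs.value R (π t)) := by
      field_simp
    refine this.le.trans ?_
    rw [inv_mul_le_iff₀ hK0]
    exact hsum
  have h1 := sum_runProb θs πexp (w + 1) sel K
  rw [successProb]
  -- Runs of probability zero may fail to be optimal, but they contribute nothing to either sum.
  have h2 : 1 ≤ (∑ τ, Set.indicator {τ | θs.IsEpsOptimal R ε (output πexp (w + 1) sel K τ)}
      (runProb θs πexp (w + 1) sel K) τ) +
      ∑ τ, (if Good τ then 0 else runProb θs πexp (w + 1) sel K τ) := by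
    rw [← h1, ← Finset.sum_add_distrib]
    refine Finset.sum_le_sum fun τ _ => ?_
    have h0 := runProb_nonneg θs πexp (w + 1) sel K τ
    have h3 : 0 ≤ Set.indicator {τ | θs.IsEpsOptimal R ε (output πexp (w + 1) sel K τ)}
      (runProb θs πexp (w + 1) sel K) τ :=
      Set.indicator_nonneg (fun τ _ => runProb_nonneg _ _ _ _ _ _) τ
    split_ifs with hg
    · rcases h0.eq_or_lt with h | h
      · rw [← h, add_zero]
        exact h3
      · rw [Set.indicator_of_mem (hopt τ hg h)]
        linarith
    · linarith
  linarith

end Regret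

/-! ### Numerical bounds on the error terms -/

section Numerics

theorem exp_neg_twenty_le : Real.exp (-20) ≤ 1 / 10 ^ 8 := by
  have h1 : (2.7 : ℝ) ^ 20 ≤ Real.exp 1 ^ 20 :=
    pow_le_pow_left₀ (by norm_num) (by linarith [Real.exp_one_gt_d9]) 20
  rw [← Real.exp_nat_mul] at h1
  rw [Real.exp_neg, one_div]
  refine inv_anti₀ (by positivity) ?_
  norm_num at h1 ⊢
  linarith

/-- The horizon is long enough for the decoding errors to be negligible. -/
theorem misspecification_le {L S H δ ε : ℝ} (hL : 1 ≤ L) (hS : 1 ≤ S) (hδ : 0 < δ) (hδ1 : δ ≤ 1)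
    (hε : 0 < ε) (hε1 : ε ≤ 1) (hH : (10 * Real.log (L * S / (ε * δ)) + 100) / δ ^ 2 ≤ H) :
    100 ≤ δ ^ 2 * H ∧
      L ^ 2 * S ^ 2 * H * (δ ^ 2 * H) * Real.exp (-(δ ^ 2 * H / 4)) ≤ ε / 10 ^ 5 := by
  set x := δ ^ 2 * H with hx
  set y := L * S / (ε * δ) with hy
  have hεδ : 0 < ε * δ := mul_pos hε hδ
  have hLS : 1 ≤ L * S := by nlinarith
  have hy1 : 1 ≤ y := by
    rw [hy, le_div_iff₀ hεδ]
    nlinarith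
  have hlog : 0 ≤ Real.log y := Real.log_nonneg hy1
  have hδ2 : 0 < δ ^ 2 := by positivity
  have h1 : 10 * Real.log y + 100 ≤ x := by
    rw [div_le_iff₀ hδ2] at hH
    linarith
  have hx100 : 100 ≤ x := by linarith
  refine ⟨hx100, ?_⟩
  -- The assumption on H reads 10 log y + 100 ≤ x. So y² costs exp((x - 100)/5) and x² costs
  -- exp(x/20); as 1/5 + 1/20 = 1/4, the factor exp(-x/4) cancels both and leaves exp(-20).
  have hy2 : y ^ 2 ≤ Real.exp ((x - 100) / 5) := by
    have : y ^ 2 = Real.exp (2 * Real.log y) := by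
      rw [mul_comm, Real.exp_mul, Real.exp_log (by linarith)]
      norm_num
    rw [this]
    exact Real.exp_le_exp.2 (by linarith)
  have hx2 : x ^ 2 ≤ 800 * Real.exp (x / 20) := by
    have := Real.quadratic_le_exp_of_nonneg (x := x / 20) (by linarith)
    nlinarith
  have e1 : L ^ 2 * S ^ 2 * H * x * Real.exp (-(x / 4)) =
      ε ^ 2 * (y ^ 2 * x ^ 2 * Real.exp (-(x / 4))) := by
    have hHx : H = x / δ ^ 2 := by rw [hx]; field_simp
    rw [hHx, hy]
    field_simp
  rw [e1]
  have h2 : y ^ 2 * x ^ 2 * Real.exp (-(x / 4)) ≤ 800 * Real.exp (-20) := by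
    calc _ ≤ Real.exp ((x - 100) / 5) * (800 * Real.exp (x / 20)) * Real.exp (-(x / 4)) := by
          gcongr
      _ = 800 * (Real.exp ((x - 100) / 5) * Real.exp (x / 20) * Real.exp (-(x / 4))) := by ring
      _ = _ := by
          rw [← Real.exp_add, ← Real.exp_add]
          congr 2
          ring
  have h3 := exp_neg_twenty_le
  have hε2 : ε ^ 2 ≤ ε := by nlinarith
  calc _ ≤ ε * (800 * Real.exp (-20)) := mul_le_mul hε2 h2 (by positivity) hε.le
    _ ≤ ε * (1 / 10 ^ 5) := mul_le_mul_of_nonneg_left (by linarith) hε.le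
    _ = _ := by ring

/-- Half of the horizon gives half of the exponent. The missing step costs exp(δ²/2) ≤ exp(1/2) ≤ 2.
-/
theorem mul_exp_pow_le {L H δ : ℝ} (hL : 0 ≤ L) (hδ : 0 ≤ δ) (hδ1 : δ ≤ 1) {w : ℕ}
    (hw : H / 2 - 1 ≤ w) :
    L * Real.exp (-(δ ^ 2 / 2)) ^ w ≤ 2 * L * Real.exp (-(δ ^ 2 * H / 4)) := by
  have h2 : Real.exp (1 / 2) ≤ 2 := by
    have h : Real.exp (1 / 2) ^ 2 = Real.exp 1 := by rw [← Real.exp_nat_mul]; norm_num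
    nlinarith [Real.exp_pos (1 / 2), Real.exp_one_lt_d9]
  have h3 : Real.exp (-(δ ^ 2 / 2)) ^ w ≤ Real.exp (1 / 2) * Real.exp (-(δ ^ 2 * H / 4)) := by
    rw [← Real.exp_nat_mul, ← Real.exp_add]
    refine Real.exp_le_exp.2 ?_
    have hδ2 : 0 ≤ δ ^ 2 := sq_nonneg δ
    have hδ2' : δ ^ 2 ≤ 1 := by nlinarith
    nlinarith [mul_le_mul_of_nonneg_left hw hδ2]
  calc _ ≤ L * (2 * Real.exp (-(δ ^ 2 * H / 4))) :=
        mul_le_mul_of_nonneg_left (h3.trans (mul_le_mul_of_nonneg_right h2 (Real.exp_pos _).le)) hL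
    _ = _ := by ring

/-- The part linear in K keeps a logarithm of m alone. Thus the decoding error is multiplied by
log(1 + 1/m), of order δ²H, and not by log K. -/
theorem mul_log_one_add_div_le {K m b : ℝ} (hK : 0 < K) (hm : 0 < m) (hb : 1 ≤ b) :
    (K * m + b) * Real.log (1 + K / (K * m + b)) ≤
      K * m * Real.log (1 + 1 / m) + b * Real.log (1 + K) := by
  have hKm : 0 < K * m := mul_pos hK hm
  have hab : 0 < K * m + b := by linarith
  rw [add_mul]
  refine add_le_add (mul_le_mul_of_nonneg_left ?_ hKm.le) (mul_le_mul_of_nonneg_left ?_ (by linarith))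
  · refine Real.log_le_log (by positivity) (add_le_add le_rfl ?_)
    rw [div_le_div_iff₀ hab hm]
    nlinarith
  · refine Real.log_le_log (by positivity) (add_le_add le_rfl ?_)
    exact div_le_self hK.le (by linarith)

/-- The rate is of order √(K Y) with Y = L² S⁴ A² H ι², so H times the rate needs K of order Y H² /
ε²; the assumption on K leaves a factor H to spare. -/
theorem stepRate_le {L S A K : ℕ} {H ι q ε : ℝ} (hL : (1 : ℝ) ≤ L) (hS : (1 : ℝ) ≤ S)
    (hA : (1 : ℝ) ≤ A) (hH : 1 ≤ H) (hι : 1 ≤ ι) (hε : 0 < ε)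
    (hq : (A : ℝ) * q = 400 * (L * S ^ 2 * A ^ 2 * H * ι))
    (hlog : Real.log (L * S + K) ≤ 7 * ι)
    (hK : 2 * 10 ^ 9 * ((L : ℝ) ^ 2 * S ^ 4 * A ^ 2 * H ^ 4 * ι ^ 2 / ε ^ 2) ≤ K) :
    5 * (H * stepRate L S A K q) ≤ K * ε / 8 := by
  have hK0 : (0 : ℝ) ≤ K := by positivity
  set V : ℝ := L * S ^ 2 * A ^ 2 * H * ι with hV
  have hLV : (L : ℝ) ≤ V := by
    have : (1 : ℝ) ≤ S ^ 2 * A ^ 2 * H * ι :=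
      one_le_mul_of_one_le_of_one_le (one_le_mul_of_one_le_of_one_le
        (one_le_mul_of_one_le_of_one_le (one_le_pow₀ hS) (one_le_pow₀ hA)) hH) hι
    calc (L : ℝ) ≤ L * (S ^ 2 * A ^ 2 * H * ι) := le_mul_of_one_le_right (by linarith) this
      _ = V := by rw [hV]; ring
  have h1 : 16 * (L : ℝ) + 128 * A * q ≤ 51216 * V := by
    have : 128 * (A : ℝ) * q = 51200 * V := by rw [mul_assoc, hq]; ring
    linarith
  have hV0 : 0 ≤ V := by positivity
  have hLS0 : (0 : ℝ) ≤ L * S := by positivity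
  have h2 : (16 * (L : ℝ) + 128 * A * q) * (2 * ((L * S) * Real.log (L * S + K))) ≤
      51216 * V * (14 * (L * S * ι)) := by
    have hlog0 : 0 ≤ Real.log (L * S + K) := Real.log_nonneg (by nlinarith)
    refine mul_le_mul h1 ?_ (by positivity) (by positivity)
    nlinarith [mul_le_mul_of_nonneg_left hlog hLS0]
  have h3 : 51216 * V * (14 * (L * S * ι)) ≤ 720000 * (L ^ 2 * S ^ 4 * A ^ 2 * H * ι ^ 2) := by
    have : (V * (L * S * ι)) * 1 ≤ (V * (L * S * ι)) * S :=
      mul_le_mul_of_nonneg_left hS (by positivity)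
    have e : (V * (L * S * ι)) * S = L ^ 2 * S ^ 4 * A ^ 2 * H * ι ^ 2 := by rw [hV]; ring
    have h0 : 0 ≤ V * (L * S * ι) := by positivity
    nlinarith
  have h4 : stepRate L S A K q ≤ √(K * (720000 * (L ^ 2 * S ^ 4 * A ^ 2 * H * ι ^ 2))) :=
    Real.sqrt_le_sqrt (mul_le_mul_of_nonneg_left (h2.trans h3) hK0)
  set Y : ℝ := L ^ 2 * S ^ 4 * A ^ 2 * H * ι ^ 2 with hY
  have hY0 : 0 ≤ Y := by positivity
  have h5 : 2 * 10 ^ 9 * (Y * H ^ 2) ≤ K * ε ^ 2 := by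
    have : 2 * 10 ^ 9 * ((L : ℝ) ^ 2 * S ^ 4 * A ^ 2 * H ^ 4 * ι ^ 2) ≤ K * ε ^ 2 := by
      rw [mul_div_assoc', div_le_iff₀ (by positivity)] at hK
      exact hK
    refine le_trans (mul_le_mul_of_nonneg_left ?_ (by norm_num)) this
    have e : Y * H ^ 2 * H = (L : ℝ) ^ 2 * S ^ 4 * A ^ 2 * H ^ 4 * ι ^ 2 := by rw [hY]; ring
    rw [← e]
    exact le_mul_of_one_le_right (by positivity) hH
  have h6 : 5 * H * √(K * (720000 * Y)) ≤ K * ε / 8 := by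
    have : 5 * H * √(K * (720000 * Y)) = √((5 * H) ^ 2 * (K * (720000 * Y))) := by
      rw [Real.sqrt_mul (sq_nonneg _), Real.sqrt_sq (by positivity)]
    rw [this, Real.sqrt_le_iff]
    refine ⟨by positivity, ?_⟩
    have h7 := mul_le_mul_of_nonneg_left h5 hK0
    have h8 : 0 ≤ K * (Y * H ^ 2) := by positivity
    nlinarith
  calc 5 * (H * stepRate L S A K q) ≤ 5 * (H * √(K * (720000 * Y))) := by
        gcongr
    _ = 5 * H * √(K * (720000 * Y)) := by ring
    _ ≤ _ := h6

theorem kerRate_le {L S A K : ℕ} {H ι q ε m U x : ℝ} (hL : (1 : ℝ) ≤ L) (hS : (1 : ℝ) ≤ S)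
    (hA : (1 : ℝ) ≤ A) (hH : 1 ≤ H) (hι : 1 ≤ ι) (hε : 0 < ε) (hε1 : ε ≤ 1) (hm : 0 < m)
    (hq : (A : ℝ) * q = 400 * (L * S ^ 2 * A ^ 2 * H * ι))
    (hlog : Real.log (1 + K) ≤ 7 * ι) (hlogm : Real.log (1 + 1 / m) ≤ x)
    (hmx : 6 * (H * (L * S ^ 2)) * (m * x) ≤ ε / 4)
    (hU : U = K * m + 12 * (A * q)) (hKLS : (L : ℝ) * S ^ 2 ≤ K)
    (hK : 2 * 10 ^ 9 * ((L : ℝ) ^ 2 * S ^ 4 * A ^ 2 * H ^ 4 * ι ^ 2 / ε ^ 2) ≤ K) :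
    H * kerRate L S A K q U ≤ K * ε / 2 := by
  set V : ℝ := L * S ^ 2 * A ^ 2 * H * ι with hV
  have hV1 : 1 ≤ V :=
    one_le_mul_of_one_le_of_one_le (one_le_mul_of_one_le_of_one_le
      (one_le_mul_of_one_le_of_one_le (one_le_mul_of_one_le_of_one_le hL (one_le_pow₀ hS))
        (one_le_pow₀ hA)) hH) hι
  have hLS1 : (1 : ℝ) ≤ L * S ^ 2 := one_le_mul_of_one_le_of_one_le hL (one_le_pow₀ hS)
  have hK0 : (0 : ℝ) < K := by linarith
  set Y : ℝ := L ^ 2 * S ^ 4 * A ^ 2 * H * ι ^ 2 with hY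
  have hY0 : 0 ≤ Y := by positivity
  have h5 : 2 * 10 ^ 9 * (Y * H ^ 2) ≤ K * ε ^ 2 := by
    have : 2 * 10 ^ 9 * ((L : ℝ) ^ 2 * S ^ 4 * A ^ 2 * H ^ 4 * ι ^ 2) ≤ K * ε ^ 2 := by
      rw [mul_div_assoc', div_le_iff₀ (by positivity)] at hK
      exact hK
    refine le_trans (mul_le_mul_of_nonneg_left ?_ (by norm_num)) this
    have e : Y * H ^ 2 * H = (L : ℝ) ^ 2 * S ^ 4 * A ^ 2 * H ^ 4 * ι ^ 2 := by rw [hY]; ring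
    rw [← e]
    exact le_mul_of_one_le_right (by positivity) hH
  have hlog0 : 0 ≤ Real.log (1 + (K : ℝ)) := Real.log_nonneg (by linarith)
  have hX0 : 0 ≤ H * (L * (S : ℝ) ^ 2) := by positivity
  have a1 : (U + 1) * Real.log (1 + K / (U + 1)) ≤ K * (m * x) + 4801 * V * (7 * ι) := by
    have e : U + 1 = K * m + (12 * (A * q) + 1) := by rw [hU]; ring
    rw [e]
    refine (mul_log_one_add_div_le hK0 hm (by rw [hq]; linarith)).trans ?_
    rw [mul_assoc]
    refine add_le_add (mul_le_mul_of_nonneg_left (mul_le_mul_of_nonneg_left hlogm hm.le) hK0.le)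
      (mul_le_mul ?_ hlog hlog0 (by linarith))
    rw [hq]
    linarith
  have a2 : H * ((L * S ^ 2) * (6 * ((U + 1) * Real.log (1 + K / (U + 1))))) ≤
      K * ε / 4 + K * ε / 8 := by
    calc _ = 6 * (H * (L * S ^ 2)) * ((U + 1) * Real.log (1 + K / (U + 1))) := by ring
      _ ≤ 6 * (H * (L * S ^ 2)) * (K * (m * x) + 4801 * V * (7 * ι)) :=
          mul_le_mul_of_nonneg_left a1 (by positivity)
      _ = K * (6 * (H * (L * S ^ 2)) * (m * x)) + 201642 * (Y * H) := by rw [hV, hY]; ring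
      _ ≤ K * (ε / 4) + K * ε / 8 := by
          refine add_le_add (mul_le_mul_of_nonneg_left hmx hK0.le) ?_
          have b1 : Y * H ≤ Y * H ^ 2 := mul_le_mul_of_nonneg_left (by nlinarith) hY0
          have b2 : K * ε ^ 2 ≤ K * ε := mul_le_mul_of_nonneg_left (by nlinarith) hK0.le
          nlinarith [mul_nonneg hY0 (zero_le_one.trans hH)]
      _ = _ := by ring
  have a3 : H * (3 * √(16 * (A * q) * ((L * S ^ 2) * (K + L * S ^ 2)))) ≤ K * ε / 8 := by
    have e : H * (3 * √(16 * (A * q) * ((L * S ^ 2) * (K + L * S ^ 2)))) =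
        √((3 * H) ^ 2 * (16 * (A * q) * ((L * S ^ 2) * (K + L * S ^ 2)))) := by
      rw [Real.sqrt_mul (sq_nonneg _), Real.sqrt_sq (by positivity)]
      ring
    rw [e, Real.sqrt_le_iff]
    refine ⟨by positivity, ?_⟩
    rw [hq]
    calc (3 * H) ^ 2 * (16 * (400 * V) * ((L * S ^ 2) * (K + L * S ^ 2))) ≤
          (3 * H) ^ 2 * (16 * (400 * V) * ((L * S ^ 2) * (K + K))) := by gcongr
      _ = 115200 * K * (L ^ 2 * S ^ 4 * A ^ 2 * H * ι * H ^ 2) * 1 := by rw [hV]; ring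
      _ ≤ 115200 * K * (L ^ 2 * S ^ 4 * A ^ 2 * H * ι * H ^ 2) * ι :=
          mul_le_mul_of_nonneg_left hι (by positivity)
      _ = 115200 * K * (Y * H ^ 2) := by rw [hY]; ring
      _ ≤ (K * ε / 8) ^ 2 := by
          have h7 := mul_le_mul_of_nonneg_left h5 hK0.le
          have h8 : 0 ≤ K * (Y * H ^ 2) := by positivity
          nlinarith
  rw [kerRate, mul_add]
  linarith

end Numerics

/-! ### Logarithmic bounds on the parameters -/

section Parameters

variable {L S A H ε p Z : ℝ}

theorem le_log_of_scale (hL : 1 ≤ L) (hS : 1 ≤ S) (hA : 1 ≤ A) (hH : 1 ≤ H) (hε : 0 < ε)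
    (hε1 : ε ≤ 1) (hp : 0 < p) (hp1 : p < 1) (hZ : Z = 4 * 10 ^ 9 * (L * S * A * H) / (ε * p)) :
    1 ≤ Real.log Z ∧ 5 * (L * S * H) ≤ Z ∧ 2 / p ≤ Z ∧ 2 ≤ Z := by
  have h1 : 1 ≤ L * S * A * H := one_le_mul_of_one_le_of_one_le
    (one_le_mul_of_one_le_of_one_le (one_le_mul_of_one_le_of_one_le hL hS) hA) hH
  have hεp : 0 < ε * p := mul_pos hε hp
  have hεp1 : ε * p ≤ p := by nlinarith
  have h2 : 4 * 10 ^ 9 * (L * S * A * H) ≤ Z := by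
    rw [hZ, le_div_iff₀ hεp]
    exact mul_le_of_le_one_right (by linarith) (by linarith)
  have hZ3 : 3 ≤ Z := by linarith
  refine ⟨?_, ?_, ?_, by linarith⟩
  · rw [Real.le_log_iff_exp_le (by linarith)]
    linarith [Real.exp_one_lt_d9]
  · have : L * S * H ≤ L * S * A * H := by
      have h3 : 0 ≤ L * S * H := by positivity
      nlinarith [mul_le_mul_of_nonneg_left hA h3]
    linarith
  · rw [hZ, div_le_div_iff₀ hp hεp]
    nlinarith

/-- A polynomial bound of the number of rounds in Z makes log K a multiple of log Z. This breaks the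
circle between K and the logarithms in its definition. -/
theorem rounds_le_pow (hL : 1 ≤ L) (hS : 1 ≤ S) (hA : 1 ≤ A) (hH : 1 ≤ H) (hε : 0 < ε)
    (hε1 : ε ≤ 1) (hp : 0 < p) (hp1 : p < 1) (hZ : Z = 4 * 10 ^ 9 * (L * S * A * H) / (ε * p)) :
    4 * 10 ^ 9 * (L ^ 2 * S ^ 4 * A ^ 2 * H ^ 4 * Real.log Z ^ 2 / ε ^ 2) ≤ Z ^ 6 := by
  obtain ⟨h1, -, -, h2⟩ := le_log_of_scale hL hS hA hH hε hε1 hp hp1 hZ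
  have hlog : Real.log Z ^ 2 ≤ Z ^ 2 :=
    pow_le_pow_left₀ (by linarith) ((Real.log_le_sub_one_of_pos (by linarith)).trans (by linarith)) 2
  set X := L * S * A * H / ε with hX
  have hX0 : 0 ≤ X := by positivity
  have hXZ : 4 * 10 ^ 9 * X ≤ Z := by
    rw [hZ, hX, mul_div_assoc', div_le_div_iff₀ hε (mul_pos hε hp)]
    have : 0 ≤ 4 * 10 ^ 9 * (L * S * A * H) * ε := by positivity
    nlinarith
  have hM : L ^ 2 * S ^ 4 * A ^ 2 * H ^ 4 / ε ^ 2 ≤ X ^ 4 := by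
    rw [hX, div_pow, div_le_div_iff₀ (by positivity) (by positivity)]
    have a1 : ε ^ 4 ≤ ε ^ 2 := pow_le_pow_of_le_one hε.le hε1 (by norm_num)
    have a2 : L ^ 2 ≤ L ^ 4 := pow_le_pow_right₀ hL (by norm_num)
    have a3 : A ^ 2 ≤ A ^ 4 := pow_le_pow_right₀ hA (by norm_num)
    calc _ ≤ L ^ 4 * S ^ 4 * A ^ 4 * H ^ 4 * ε ^ 2 := by gcongr
      _ = _ := by ring
  calc _ = 4 * 10 ^ 9 * (L ^ 2 * S ^ 4 * A ^ 2 * H ^ 4 / ε ^ 2) * Real.log Z ^ 2 := by ring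
    _ ≤ (4 * 10 ^ 9 * X) ^ 4 * Z ^ 2 := by
        refine mul_le_mul ?_ hlog (by positivity) (by positivity)
        rw [mul_pow]
        exact mul_le_mul (by norm_num) hM (by positivity) (by positivity)
    _ ≤ Z ^ 4 * Z ^ 2 := by gcongr
    _ = Z ^ 6 := by ring

theorem log_le_of_le_pow {z Z : ℝ} (hz : 0 < z) {k : ℕ} (h : z ≤ Z ^ k) :
    Real.log z ≤ k * Real.log Z := by
  rw [← Real.log_pow]
  exact Real.log_le_log hz h

theorem log_one_add_one_div_le {m x : ℝ} (hx : 4 ≤ x) (hm : Real.exp (-(x / 4)) ≤ m) :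
    Real.log (1 + 1 / m) ≤ x := by
  have hm0 : 0 < m := (Real.exp_pos _).trans_le hm
  rw [Real.log_le_iff_le_exp (by positivity)]
  have a1 : 1 / m ≤ Real.exp (x / 4) := by
    rw [Real.exp_neg] at hm
    rw [one_div]
    exact inv_le_of_inv_le₀ (Real.exp_pos _) hm
  have a2 : Real.exp x = Real.exp (x / 4) * Real.exp (x * (3 / 4)) := by
    rw [← Real.exp_add]; congr 1; ring
  have a3 := Real.add_one_le_exp (x * (3 / 4))
  have a4 : 1 ≤ Real.exp (x / 4) := Real.one_le_exp (by linarith)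
  calc 1 + 1 / m ≤ Real.exp (x / 4) * 2 := by linarith
    _ ≤ Real.exp (x / 4) * Real.exp (x * (3 / 4)) :=
        mul_le_mul_of_nonneg_left (by linarith) (by linarith)
    _ = Real.exp x := a2.symm

/-- With K ≤ Z⁶ one has N + 1 ≤ Z¹³ and (K + 1)/p ≤ Z⁷, and the grid has at most 3 L S² A
parameters. Then 13 · 3 + 7 = 46 and 2 · 46 + 2 ≤ 100. -/
theorem two_log_card_le {L S A n K d N : ℕ} {p Z : ℝ} (hL : 1 ≤ L) (hS : 1 ≤ S) (hA : 1 ≤ A)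
    (hK : 1 ≤ K) (hp : 0 < p) (hι : 1 ≤ Real.log Z)
    (hZ1 : 5 * ((L : ℝ) * S * (n + 1)) ≤ Z) (hZ2 : 2 / p ≤ Z) (hKZ : (K : ℝ) ≤ Z ^ 6)
    (hN : N = 2 * (L + S * (n + 1)) * K ^ 2) (hd : d = L + L * S + L * (S * (A * S))) :
    2 * Real.log (((N + 1) ^ d : ℕ) * (K + 1) / p) + 2 ≤
      100 * (L * S ^ 2 * A) * Real.log Z := by
  have hK' : (1 : ℝ) ≤ K := by exact_mod_cast hK
  have hL' : (1 : ℝ) ≤ L := by exact_mod_cast hL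
  have hS' : (1 : ℝ) ≤ S := by exact_mod_cast hS
  have hA' : (1 : ℝ) ≤ A := by exact_mod_cast hA
  have hn : (1 : ℝ) ≤ n + 1 := by linarith [(Nat.cast_nonneg n : (0 : ℝ) ≤ n)]
  have hLSn : (1 : ℝ) ≤ L * S * (n + 1) :=
    one_le_mul_of_one_le_of_one_le (one_le_mul_of_one_le_of_one_le hL' hS') hn
  have hZ0 : 0 < Z := by linarith
  have h1 : (N : ℝ) + 1 ≤ Z ^ 13 := by
    have a1 : (L : ℝ) ≤ L * S * (n + 1) := by
      rw [mul_assoc]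
      exact le_mul_of_one_le_right (by linarith) (one_le_mul_of_one_le_of_one_le hS' hn)
    have a2 : (S : ℝ) * (n + 1) ≤ L * S * (n + 1) := by
      rw [mul_assoc]
      exact le_mul_of_one_le_left (by positivity) hL'
    have hK2 : (1 : ℝ) ≤ (K : ℝ) ^ 2 := one_le_pow₀ hK'
    have e : (N : ℝ) = 2 * (L + S * (n + 1)) * K ^ 2 := by rw [hN]; push_cast; ring
    calc (N : ℝ) + 1 ≤ 2 * (2 * (L * S * (n + 1))) * K ^ 2 + (L * S * (n + 1)) * K ^ 2 := by
          rw [e]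
          refine add_le_add ?_ (one_le_mul_of_one_le_of_one_le hLSn hK2)
          gcongr
          linarith
      _ = 5 * (L * S * (n + 1)) * K ^ 2 := by ring
      _ ≤ Z * (Z ^ 6) ^ 2 := by gcongr
      _ = Z ^ 13 := by ring
  have h2 : ((K : ℝ) + 1) / p ≤ Z ^ 7 := by
    calc ((K : ℝ) + 1) / p ≤ K * (2 / p) := by
          rw [mul_div_assoc', div_le_div_iff_of_pos_right hp]
          linarith
      _ ≤ Z ^ 6 * Z := by gcongr
      _ = Z ^ 7 := by ring
  have h3 : (((N + 1) ^ d : ℕ) : ℝ) * (K + 1) / p ≤ Z ^ (13 * d + 7) := by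
    rw [mul_div_assoc, pow_add, pow_mul]
    push_cast
    gcongr
  have h4 := log_le_of_le_pow (by positivity) h3
  have h5 : (d : ℝ) ≤ 3 * (L * S ^ 2 * A) := by
    rw [hd]
    push_cast
    have b1 : (1 : ℝ) ≤ (S : ℝ) ^ 2 * A := one_le_mul_of_one_le_of_one_le (one_le_pow₀ hS') hA'
    have b2 : (1 : ℝ) ≤ (S : ℝ) * A := one_le_mul_of_one_le_of_one_le hS' hA'
    have c1 : (L : ℝ) ≤ L * (S ^ 2 * A) := le_mul_of_one_le_right (by linarith) b1
    have c2 : (L : ℝ) * S ≤ L * S * (S * A) := le_mul_of_one_le_right (by positivity) b2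
    nlinarith
  have h6 : (1 : ℝ) ≤ L * S ^ 2 * A :=
    one_le_mul_of_one_le_of_one_le (one_le_mul_of_one_le_of_one_le hL' (one_le_pow₀ hS')) hA'
  push_cast at h4 ⊢
  have h7 : (13 * (d : ℝ) + 7) * Real.log Z ≤ 46 * (L * S ^ 2 * A) * Real.log Z := by
    refine mul_le_mul_of_nonneg_right ?_ (by linarith)
    linarith
  have h8 : 1 ≤ L * S ^ 2 * A * Real.log Z := one_le_mul_of_one_le_of_one_le h6 hι
  nlinarith

end Parameters

end LatentMDP

end

/-! ### Choice of the parameters and conclusion -/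

open LatentMDP in
theorem corollary4p3 :
    ∃ (C C₁ : ℝ) (c : ℕ), 0 < C ∧ 0 < C₁ ∧
      ∀ (S A : Type*) [Fintype S] [Nonempty S] [Fintype A] [Nonempty A] (L H : ℕ) (δ ε p : ℝ),
        1 ≤ L → 0 < δ → δ ≤ 1 → 0 < ε → ε ≤ 1 → 0 < p → p < 1 →
        (10 * Real.log (L * Fintype.card S / (ε * δ)) + C) / δ ^ 2 ≤ H →
        ∃ (K W : ℕ) (β εs : ℝ),
          1 ≤ K ∧ 1 ≤ W ∧ W ≤ H ∧ 0 < β ∧ 0 < εs ∧ εs ≤ 1 ∧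
          (K : ℝ) ≤ C₁ * ((L : ℝ) ^ 2 * (Fintype.card S : ℝ) ^ 4 * (Fintype.card A : ℝ) ^ 2 *
              (H : ℝ) ^ 4 / ε ^ 2) *
            Real.log (C₁ * (L * Fintype.card S * Fintype.card A * H) / (ε * p)) ^ c ∧
          ∀ (πexp : Policy H S A) (R : Fin H → S → A → ℝ), IsReward R →
            (∃ sel : Selection L H S A,
              IsOMLE (separatedClass L S A δ) R πexp β εs W K sel) ∧
            ∀ sel : Selection L H S A,
              IsOMLE (separatedClass L S A δ) R πexp β εs W K sel →
              ∀ θ ∈ separatedClass L S A δ,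
                1 - p ≤ successProb θ R πexp W sel K ε := by
  classical
  -- The constant 100 is that of `misspecification_le`. 4 · 10⁹ is twice the factor 2 · 10⁹ in K, to
  -- allow for rounding up, and 2 is the power of ι in K.
  refine ⟨100, 4 * 10 ^ 9, 2, by norm_num, by norm_num, ?_⟩
  intro S A _ _ _ _ L H δ ε p hL hδ hδ1 hε hε1 hp hp1 hH
  have hL' : (1 : ℝ) ≤ L := by exact_mod_cast hL
  have hS : 1 ≤ Fintype.card S := Fintype.card_pos
  have hA : 1 ≤ Fintype.card A := Fintype.card_pos
  have hS' : (1 : ℝ) ≤ Fintype.card S := by exact_mod_cast hS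
  have hA' : (1 : ℝ) ≤ Fintype.card A := by exact_mod_cast hA
  obtain ⟨hx, hmis⟩ := misspecification_le hL' hS' hδ hδ1 hε hε1 hH
  have hδ2 : δ ^ 2 ≤ 1 := pow_le_one₀ hδ.le hδ1
  have hH100 : (100 : ℝ) ≤ H := hx.trans (mul_le_of_le_one_left (Nat.cast_nonneg H) hδ2)
  obtain ⟨n, rfl⟩ : ∃ n, H = n + 1 := by
    refine ⟨H - 1, ?_⟩
    have : 100 ≤ H := by exact_mod_cast hH100
    omega
  push_cast at hx hmis hH100
  -- The split at half of the horizon leaves at least H/2 - 1 steps on either side.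
  obtain ⟨w, hw⟩ : ∃ w : ℕ, w = (n + 1) / 2 := ⟨_, rfl⟩
  obtain ⟨k, hk⟩ : ∃ k : ℕ, k = n - w := ⟨_, rfl⟩
  have hn : w + k = n := by omega
  have hH1 : (1 : ℝ) ≤ n + 1 := by linarith
  set ι : ℝ := Real.log (4 * 10 ^ 9 * (L * Fintype.card S * Fintype.card A * (n + 1 : ℕ)) / (ε * p))
    with hι
  set Z : ℝ := 4 * 10 ^ 9 * (L * Fintype.card S * Fintype.card A * (n + 1)) / (ε * p) with hZ
  have hιZ : ι = Real.log Z := by rw [hι, hZ]; push_cast; rfl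
  obtain ⟨hι1, hZ1, hZ2, hZ3⟩ := le_log_of_scale hL' hS' hA' hH1 hε hε1 hp hp1 hZ
  have hpow := rounds_le_pow hL' hS' hA' hH1 hε hε1 hp hp1 hZ
  rw [← hιZ] at hι1 hpow
  set M : ℝ := (L : ℝ) ^ 2 * (Fintype.card S : ℝ) ^ 4 * (Fintype.card A : ℝ) ^ 2 *
    ((n : ℝ) + 1) ^ 4 * ι ^ 2 / ε ^ 2 with hM
  have hLS2 : (L : ℝ) * (Fintype.card S : ℝ) ^ 2 ≤ M := by
    rw [hM, le_div_iff₀ (by positivity)]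
    have a1 : ε ^ 2 ≤ 1 := pow_le_one₀ hε.le hε1
    have a2 : (1 : ℝ) ≤ L * (Fintype.card S : ℝ) ^ 2 * (Fintype.card A : ℝ) ^ 2 *
        ((n : ℝ) + 1) ^ 4 * ι ^ 2 :=
      one_le_mul_of_one_le_of_one_le (one_le_mul_of_one_le_of_one_le
        (one_le_mul_of_one_le_of_one_le (one_le_mul_of_one_le_of_one_le hL' (one_le_pow₀ hS'))
          (one_le_pow₀ hA')) (one_le_pow₀ hH1)) (one_le_pow₀ hι1)
    have a3 : (0 : ℝ) ≤ L * (Fintype.card S : ℝ) ^ 2 := by positivity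
    calc _ ≤ L * (Fintype.card S : ℝ) ^ 2 * 1 := mul_le_mul_of_nonneg_left a1 a3
      _ ≤ L * (Fintype.card S : ℝ) ^ 2 * (L * (Fintype.card S : ℝ) ^ 2 *
          (Fintype.card A : ℝ) ^ 2 * ((n : ℝ) + 1) ^ 4 * ι ^ 2) :=
          mul_le_mul_of_nonneg_left a2 a3
      _ = _ := by ring
  have hLS1 : (L : ℝ) * Fintype.card S ≤ L * (Fintype.card S : ℝ) ^ 2 :=
    mul_le_mul_of_nonneg_left (le_self_pow₀ hS' two_ne_zero) (by linarith only [hL'])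
  have hLS0 : (1 : ℝ) ≤ L * Fintype.card S := one_le_mul_of_one_le_of_one_le hL' hS'
  have hM1 : 1 ≤ M := by linarith
  set K : ℕ := ⌈2 * 10 ^ 9 * M⌉₊ with hK
  have hKM : 2 * 10 ^ 9 * M ≤ K := Nat.le_ceil _
  have hKM' : (K : ℝ) ≤ 4 * 10 ^ 9 * M := by
    have := (Nat.ceil_lt_add_one (by positivity : 0 ≤ 2 * 10 ^ 9 * M)).le
    linarith
  have hLSK : (L : ℝ) * (Fintype.card S : ℝ) ^ 2 ≤ K := by linarith only [hLS2, hKM, hM1]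
  have hK1 : (1 : ℝ) ≤ K := by linarith only [hLSK, hLS1, hLS0]
  have hK1' : 1 ≤ K := by exact_mod_cast hK1
  have hKZ : (K : ℝ) ≤ Z ^ 6 := hKM'.trans hpow
  have h2KZ : 2 * (K : ℝ) ≤ Z ^ 7 := by
    calc 2 * (K : ℝ) ≤ Z * Z ^ 6 := mul_le_mul hZ3 hKZ (by positivity) (by linarith)
      _ = Z ^ 7 := by ring
  have hlog : ∀ z : ℝ, 0 < z → z ≤ 2 * K → Real.log z ≤ 7 * ι := fun z hz h => by
    have := log_le_of_le_pow hz (h.trans h2KZ)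
    rw [hιZ]
    exact_mod_cast this
  set β : ℝ := 100 * (L * Fintype.card S ^ 2 * Fintype.card A) * ι with hβ
  set x : ℝ := δ ^ 2 * (n + 1) with hxdef
  set μ : ℝ := 2 * L * Real.exp (-(x / 4)) with hμ
  have hwr : ((n : ℝ) + 1) / 2 - 1 ≤ w := by
    have : n + 1 ≤ 2 * w + 2 := by omega
    have : ((n + 1 : ℕ) : ℝ) ≤ ((2 * w + 2 : ℕ) : ℝ) := by exact_mod_cast this
    push_cast at this
    linarith
  have hkr : ((n : ℝ) + 1) / 2 - 1 ≤ k := by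
    have : n + 1 ≤ 2 * k + 2 := by omega
    have : ((n + 1 : ℕ) : ℝ) ≤ ((2 * k + 2 : ℕ) : ℝ) := by exact_mod_cast this
    push_cast at this
    linarith
  have hw1 : L * Real.exp (-(δ ^ 2 / 2)) ^ w ≤ μ :=
    mul_exp_pow_le (by linarith) hδ.le hδ1 hwr
  have hk1 : L * Real.exp (-(δ ^ 2 / 2)) ^ k ≤ μ :=
    mul_exp_pow_le (by linarith) hδ.le hδ1 hkr
  have hμ0 : 0 < μ := by positivity
  have hμε : 10 * μ ≤ ε / 8 := by
    have a1 : (1 : ℝ) ≤ L * (Fintype.card S : ℝ) ^ 2 * (n + 1) * x :=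
      one_le_mul_of_one_le_of_one_le (one_le_mul_of_one_le_of_one_le
        (one_le_mul_of_one_le_of_one_le hL' (one_le_pow₀ hS')) hH1) (by linarith)
    have a2 : L * Real.exp (-(x / 4)) ≤
        L ^ 2 * (Fintype.card S : ℝ) ^ 2 * (n + 1) * x * Real.exp (-(x / 4)) := by
      calc _ ≤ (L * Real.exp (-(x / 4))) * (L * (Fintype.card S : ℝ) ^ 2 * (n + 1) * x) :=
            le_mul_of_one_le_right (by positivity) a1
        _ = _ := by ring
    have a3 := a2.trans hmis
    rw [hμ]
    linarith
  -- 24 = 16 + 8 adds up the decoding errors in the definition of U.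
  set m : ℝ := 24 * μ with hm
  have hm0 : 0 < m := by positivity
  have hlogm : Real.log (1 + 1 / m) ≤ x := by
    refine log_one_add_one_div_le (by linarith) ?_
    rw [hm, hμ]
    calc Real.exp (-(x / 4)) ≤ 48 * L * Real.exp (-(x / 4)) :=
          le_mul_of_one_le_left (Real.exp_pos _).le (by linarith only [hL'])
      _ = _ := by ring
  have hmx : 6 * (((n : ℝ) + 1) * (L * (Fintype.card S : ℝ) ^ 2)) * (m * x) ≤ ε / 4 := by
    calc _ = 288 * (L ^ 2 * (Fintype.card S : ℝ) ^ 2 * (n + 1) * x * Real.exp (-(x / 4))) := by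
          rw [hm, hμ]; ring
      _ ≤ _ := by linarith
  have hq : (Fintype.card A : ℝ) * (4 * (n + 1) * β) =
      400 * (L * Fintype.card S ^ 2 * Fintype.card A ^ 2 * (n + 1) * ι) := by rw [hβ]; ring
  have hβ0 : 0 < β := by positivity
  clear_value K M ι Z β x μ m
  -- The threshold `εs` is the bound of `decodeError_le`, so every policy is admissible in every
  -- separated model.
  refine ⟨K, w + 1, β, L * Real.exp (-(δ ^ 2 / 2)) ^ w, hK1', by omega, by omega, hβ0,
    by positivity, by linarith, ?_, ?_⟩
  · refine hKM'.trans (le_of_eq ?_)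
    rw [hM]
    push_cast
    ring
  intro πexp R hR
  refine ⟨exists_isOMLE πexp (w + 1) K R hL hβ0.le fun θ hθ π =>
    decodeError_le hδ.le hθ (by omega) π, fun sel hsel θ hθ => ?_⟩
  refine one_sub_le_successProb (U := K * m + 12 * (Fintype.card A * (4 * (n + 1) * β)))
    (N := 2 * (L + Fintype.card S * (n + 1)) * K ^ 2) hR hδ.le hp hβ0.le hn hK1' ?_ le_rfl ?_ ?_ le_rfl
    ?_ ?_ hsel hθ
  · have : 0 < K := hK1'
    positivity
  · rw [card_gridModel]
    have := two_log_card_le hL hS hA hK1' hp (by rwa [← hιZ]) hZ1 hZ2 hKZ rfl rfl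
    rw [← hιZ] at this
    rw [hβ]
    exact this
  · linarith
  · refine add_le_add (mul_le_mul_of_nonneg_left ?_ (by linarith)) le_rfl
    linarith
  -- The budget per round: ε/8 for the decoding errors, ε/8 for the latent errors and ε/2 for the
  -- matched kernels.
  · rw [hM] at hKM
    have hst := stepRate_le (q := 4 * (n + 1) * β) hL' hS' hA' hH1 hι1 hε hq
      (hlog _ (by linarith) (by linarith)) hKM
    have hkt := kerRate_le (q := 4 * (n + 1) * β) hL' hS' hA' hH1 hι1 hε hε1 hm0 hq
      (hlog _ (by linarith) (by linarith)) hlogm hmx rfl hLSK hKM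
    set U := K * m + 12 * (Fintype.card A * (4 * (n + 1) * β))
    have hsr : 0 ≤ stepRate L (Fintype.card S) (Fintype.card A) K (4 * (n + 1) * β) :=
      Real.sqrt_nonneg _
    have hU0 : 0 ≤ U := by positivity
    have hkr0 : 0 ≤ kerRate L (Fintype.card S) (Fintype.card A) K (4 * (n + 1) * β) U := by
      have : 0 ≤ Real.log (1 + K / (U + 1)) :=
        Real.log_nonneg (le_add_of_nonneg_right (by positivity))
      unfold kerRate
      positivity
    have hwn : (w : ℝ) + 1 ≤ n + 1 := by
      have : w ≤ n := by omega
      have : (w : ℝ) ≤ n := by exact_mod_cast this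
      linarith
    have hkn : (k : ℝ) ≤ n + 1 := by
      have : k ≤ n := by omega
      have : (k : ℝ) ≤ n := by exact_mod_cast this
      linarith
    have t1 : 5 * (((w : ℝ) + 1) * stepRate L (Fintype.card S) (Fintype.card A) K
        (4 * (n + 1) * β)) ≤ K * ε / 8 :=
      le_trans (mul_le_mul_of_nonneg_left (mul_le_mul_of_nonneg_right hwn hsr) (by norm_num)) hst
    have t2 := (mul_le_mul_of_nonneg_right hkn hkr0).trans hkt
    have t3 : (K : ℝ) * (6 * (L * Real.exp (-(δ ^ 2 / 2)) ^ w) +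
        4 * (L * Real.exp (-(δ ^ 2 / 2)) ^ k)) ≤ K * (ε / 8) :=
      mul_le_mul_of_nonneg_left (by linarith) (by linarith)
    have t4 : 0 ≤ K * ε := by positivity
    linarith
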